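/- **Setting.** Let $n\ge 0$, let $\mathcal X_t,\mathcal Y_t$ ($t\ge 0$) and $\mathcal Y^{-1}$ be Polish spaces with their Borel $\sigma$-algebras, $\mu$ a probability measure on $\mathcal Y^{-1}$ (the law of the initial data $y^{-1}$), and $P_t(dx_t|x^{t-1})$ the stochastic kernels of the source, with $P_{0,t}(dx^t)=P_0(dx_0)\cdots P_t(dx_t|x^{t-1})$. Write $x^t=(x_0,\dots,x_t)$, $y_0^t=(y_0,\dots,y_t)$, $y^t=(y^{-1},y_0^t)$. Let $\rho_t(x^t,y_0^t)\in[0,\infty]$ be measurable (it may depend on only some of the coordinates), and $d_{0,n}=\sum_{t=0}^n\rho_t$. For stochastic kernels $Q_t(dy_t|y^{t-1},x^t)$ put $\overrightarrow Q_{0,t}(dy_0^t|y^{-1},x^t)=\otimes_{i=0}^tQ_i(dy_i|y^{i-1},x^i)$; the joint law is $\mu(dy^{-1})\otimes P_{0,n}(dx^n)\otimes\overrightarrow Q_{0,n}(dy_0^n|y^{-1},x^n)$, $\mathbf E^{Q}$ is its expectation, $\Pi^{Q}_{0,n}(dy_0^n|y^{-1})$ the conditional law of $y_0^n$ given $y^{-1}$,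 and $\Pi_t^{Q}(dy_t|y^{t-1})$ the regular conditional law of $y_t$ given $y^{t-1}$. Let $$\mathbb I_{0,n}(P_{0,n},\overrightarrow Q_{0,n})=\int\log\frac{d\overrightarrow Q_{0,n}(\cdot|y^{-1},x^n)}{d\Pi^{Q}_{0,n}(\cdot|y^{-1})}(y_0^n)\;d\big(\mu\otimes P_{0,n}\otimes \overrightarrow Q_{0,n}\big)\in[0,\infty]$$ (the relative entropy between $\mu\otimes P_{0,n}\otimes\overrightarrow Q_{0,n}$ and $\mu\otimes(P_{0,n}\times\Pi_{0,n}^{Q})$, equal to $\infty$ without absolute continuity; the same formula is used for any kernel in place of $\overrightarrow Q_{0,n}$), and for $D\ge0$ $$R_{0,n}(D)=\inf\Big\{\mathbb I_{0,n}(P_{0,n},\overrightarrow Q_{0,n}):\ \tfrac1{n+1}\mathbf E^{Q}\{d_{0,n}(X^n,Y^n)\}\le D\Big\}.$$ **Theorem.** Suppose that $Q^*=\{Q_t^*\}$ satisfies the distortion constraint and attains the infimum $R_{0,n}(D)$, and that $\mathbb I_{0,n}(P_{0,n},\cdot)$ is Gâteaux differentiable at $\overrightarrow Q^*_{0,n}$: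 for every causal $\overrightarrow Q_{0,n}$ (it is enough to consider those with $\overrightarrow Q_{0,n}(\cdot|y^{-1},x^n)\le C\,\Pi^{Q^*}_{0,n}(\cdot|y^{-1})$ for a constant $C$ and $\mu\otimes P_{0,n}$-almost all $(y^{-1},x^n)$) the function $\varepsilon\mapsto\mathbb I_{0,n}(P_{0,n},\overrightarrow Q^*_{0,n}+\varepsilon(\overrightarrow Q_{0,n}-\overrightarrow Q^*_{0,n}))$ is finite for small $\varepsilon\ge0$ and has a finite right derivative at $\varepsilon=0$. Then there is a real $s\le0$ which is a Lagrange multiplier of the constraint, i.e. $R_{0,n}(D)\le\mathbb I_{0,n}(P_{0,n},\overrightarrow Q_{0,n})-s\big(\mathbf E^{Q}\{d_{0,n}\}-(n+1)D\big)$ for all causal $Q$, such that, with $g_{n,n}=0$ and, for $t=n-1,\dots,0$, $$g_{t,n}(x^t,y^t)=-\int_{\mathcal X_{t+1}}P_{t+1}(dx_{t+1}|x^t)\,\log\int_{\mathcal Y_{t+1}}e^{s\rho_{t+1}(x^{t+1},y_0^{t+1})-g_{t+1,n}(x^{t+1},y^{t+1})}\,\Pi^{Q^*}_{t+1}(dy_{t+1}|y^t),$$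 all these integrals being well defined and finite for almost all arguments (for the joint law of $Q^*$), the following hold. **(1)** For $t=0,\dots,n$ and almost all $(y^{t-1},x^t)$ (for the joint law of $Q^*$), the denominator below is positive and finite and $$Q_t^*(dy_t|y^{t-1},x^t)=\frac{e^{s\rho_t(x^t,y_0^t)-g_{t,n}(x^t,y^t)}\,\Pi_t^{Q^*}(dy_t|y^{t-1})}{\int_{\mathcal Y_t}e^{s\rho_t(x^t,y_0^t)-g_{t,n}(x^t,y^t)}\,\Pi_t^{Q^*}(dy_t|y^{t-1})}.$$ **(2)** $R_{0,n}(D)<\infty$, and, with integrable integrands, $$\frac{R_{0,n}(D)}{n+1}=sD-\frac1{n+1}\sum_{t=0}^n\int\Big\{\int_{\mathcal Y_t}g_{t,n}(x^t,y^t)\,Q^*_t(dy_t|y^{t-1},x^t)+\log\int_{\mathcal Y_t}e^{s\rho_t(x^t,y_0^t)-g_{t,n}(x^t,y^t)}\,\Pi_t^{Q^*}(dy_t|y^{t-1})\Big\}\,P_t(dx_t|x^{t-1})\otimes(P_{0,t-1}\otimes\overrightarrow Q^*_{0,t-1})(dx^{t-1},dy_0^{t-1}|y^{-1})\otimes\mu(dy^{-1}).$$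 **(3)** If $R_{0,n}(D)>0$, then $s<0$ and $$\frac1{n+1}\sum_{t=0}^n\int\rho_t(x^t,y_0^t)\,(P_{0,t}\otimes\overrightarrow Q^*_{0,t})(dx^t,dy_0^t|y^{-1})\otimes\mu(dy^{-1})=D.$$ -/

import Mathlib

open MeasureTheory ProbabilityTheory Filter Topology
open scoped ENNReal NNReal

noncomputable section

namespace NRDF

universe u v w

/-- `Hist X t = X 0 × ⋯ × X (t - 1)`: the first `t` coordinates. Thus the string
`(x_0, …, x_t)`, usually written `x^t`, is a point of `Hist X (t + 1)`. -/
def Hist (X : ℕ → Type u) : ℕ → Type u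
  | 0 => PUnit
  | t + 1 => Hist X t × X t

/-- Append one coordinate to a history. -/
def Hist.snoc {X : ℕ → Type u} {t : ℕ} (h : Hist X t) (x : X t) : Hist X (t + 1) := (h, x)

/-- Forget the last coordinate of a history. -/
def Hist.init {X : ℕ → Type u} {t : ℕ} (h : Hist X (t + 1)) : Hist X t := Prod.fst h

/-- The last coordinate of a history. -/
def Hist.last {X : ℕ → Type u} {t : ℕ} (h : Hist X (t + 1)) : X t := Prod.snd h

/-- The product σ-algebra on histories. -/
instance Hist.instMeasurableSpace {X : ℕ → Type u} [∀ t, MeasurableSpace (X t)] :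
    ∀ t, MeasurableSpace (Hist X t)
  | 0 => (inferInstance : MeasurableSpace PUnit)
  | t + 1 =>
    letI := Hist.instMeasurableSpace (X := X) t
    (inferInstance : MeasurableSpace (Hist X t × X t))

section basic

variable {X : ℕ → Type u} [∀ t, MeasurableSpace (X t)]

theorem Hist.measurable_init {t : ℕ} : Measurable (Hist.init : Hist X (t + 1) → Hist X t) :=
  measurable_fst

theorem Hist.measurable_last {t : ℕ} : Measurable (Hist.last : Hist X (t + 1) → X t) :=
  measurable_snd

theorem Hist.measurable_snoc {t : ℕ} :
    Measurable (fun p : Hist X t × X t => Hist.snoc p.1 p.2) :=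
  measurable_id

end basic

/-- A source: the conditional distributions `P_t(dx_t | x^{t-1})` for `t = 0, 1, …`
(for `t = 0` the conditioning history is the unique point of `Hist X 0`, so that `P_0` is a
probability measure on `X 0`). -/
structure Source (X : ℕ → Type u) [∀ t, MeasurableSpace (X t)] where
  kernel : ∀ t, Kernel (Hist X t) (X t)
  markov : ∀ t, IsMarkovKernel (kernel t)

/-- A causal reproduction: the conditional distributions `Q_t(dy_t | y^{t-1}, x^t)` for
`t = 0, 1, …`, where `y^{t-1} = (y^{-1}, y_0, …, y_{t-1})` is a point of `W × Hist Y t`, the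
space `W` being the one of the initial data `y^{-1}`. -/
structure Reproduction (W : Type w) (X : ℕ → Type u) (Y : ℕ → Type v) [MeasurableSpace W]
    [∀ t, MeasurableSpace (X t)] [∀ t, MeasurableSpace (Y t)] where
  kernel : ∀ t, Kernel ((W × Hist Y t) × Hist X (t + 1)) (Y t)
  markov : ∀ t, IsMarkovKernel (kernel t)

attribute [instance] Source.markov Reproduction.markov

/-- A distortion function, given by measurable functions `ρ_t(x^t, y_0^t) ∈ [0, ∞]`. -/
structure Distortion (X : ℕ → Type u) (Y : ℕ → Type v)
    [∀ t, MeasurableSpace (X t)] [∀ t, MeasurableSpace (Y t)] where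
  rho : ∀ t, Hist X (t + 1) → Hist Y (t + 1) → ℝ≥0∞
  measurable : ∀ t, Measurable (Function.uncurry (rho t))

variable {W : Type w} {X : ℕ → Type u} {Y : ℕ → Type v} [MeasurableSpace W]
  [∀ t, MeasurableSpace (X t)] [∀ t, MeasurableSpace (Y t)]

/-- `P.law t` is the law of `(x_0, …, x_{t-1})`; in particular `P_{0,n} = P.law (n + 1)`. -/
def Source.law (P : Source X) : ∀ t, Measure (Hist X t)
  | 0 => (Measure.dirac PUnit.unit : Measure PUnit)
  | t + 1 => (P.law t ⊗ₘ P.kernel t : Measure (Hist X t × X t))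

instance Source.instLaw (P : Source X) : ∀ t, IsProbabilityMeasure (P.law t)
  | 0 => (inferInstance : IsProbabilityMeasure (Measure.dirac PUnit.unit : Measure PUnit))
  | t + 1 =>
    haveI := P.instLaw t
    (inferInstance : IsProbabilityMeasure (P.law t ⊗ₘ P.kernel t))

/-- `Q.causal t` is the conditional distribution
`Q_0(dy_0 | y^{-1}, x_0) ⋯ Q_{t-1}(dy_{t-1} | y^{t-2}, x^{t-1})` of `(y_0, …, y_{t-1})` given
`y^{-1}` and `(x_0, …, x_{t-1})`; the kernel `Q⃗_{0,n}` is `Q.causal (n + 1)`. -/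
def Reproduction.causal (Q : Reproduction W X Y) : ∀ t, Kernel (W × Hist X t) (Hist Y t)
  | 0 => (Kernel.const _ (Measure.dirac PUnit.unit) : Kernel (W × Hist X 0) PUnit)
  | t + 1 =>
    ((Q.causal t).comap (fun a : W × Hist X (t + 1) => (a.1, a.2.init))
        (measurable_fst.prodMk (Hist.measurable_init.comp measurable_snd)) ⊗ₖ
      (Q.kernel t).comap
        (fun a : (W × Hist X (t + 1)) × Hist Y t => ((a.1.1, a.2), a.1.2)) (by fun_prop) :
      Kernel (W × Hist X (t + 1)) (Hist Y t × Y t))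

instance Reproduction.instCausal (Q : Reproduction W X Y) : ∀ t, IsMarkovKernel (Q.causal t)
  | 0 => (inferInstance : IsMarkovKernel
      (Kernel.const (W × Hist X 0) (Measure.dirac PUnit.unit) : Kernel (W × Hist X 0) PUnit))
  | t + 1 =>
    haveI := Q.instCausal t
    (inferInstance : IsMarkovKernel
      ((Q.causal t).comap (fun a : W × Hist X (t + 1) => (a.1, a.2.init))
          (measurable_fst.prodMk (Hist.measurable_init.comp measurable_snd)) ⊗ₖ
        (Q.kernel t).comap
          (fun a : (W × Hist X (t + 1)) × Hist Y t => ((a.1.1, a.2), a.1.2)) (by fun_prop)))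

/-- The joint distribution `P_{0,n} ⊗ K` of `(x^n, y_0^n)` given `y^{-1}`
(with `N = n + 1` coordinates). -/
def jointKernel (P : Source X) {N : ℕ} (K : Kernel (W × Hist X N) (Hist Y N)) :
    Kernel W (Hist X N × Hist Y N) :=
  Kernel.const W (P.law N) ⊗ₖ K

/-- The marginal distribution `Π_{0,n}(dy_0^n | y^{-1})` of `y_0^n` given `y^{-1}`. -/
def outputLaw (P : Source X) {N : ℕ} (K : Kernel (W × Hist X N) (Hist Y N)) :
    Kernel W (Hist Y N) :=
  (jointKernel P K).snd

/-- The product distribution `P_{0,n} × Π_{0,n}` of `(x^n, y_0^n)` given `y^{-1}`. -/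
def productKernel (P : Source X) {N : ℕ} (K : Kernel (W × Hist X N) (Hist Y N)) :
    Kernel W (Hist X N × Hist Y N) :=
  Kernel.const W (P.law N) ×ₖ outputLaw P K

/-- The functional `𝕀_{0,n}(P_{0,n}, K)`: the relative entropy (natural logarithm) between the
joint distribution `P_{0,n} ⊗ K` and the product distribution `P_{0,n} × Π_{0,n}`, both
conditional on `y^{-1}`, with `y^{-1}` distributed according to `μ`. -/
def info (μ : Measure W) (P : Source X) {N : ℕ} (K : Kernel (W × Hist X N) (Hist Y N)) : ℝ≥0∞ :=
  InformationTheory.klDiv (μ ⊗ₘ jointKernel P K) (μ ⊗ₘ productKernel P K)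

/-- The law of `(y^{-1}, (x_0, …, x_{t-1}), (y_0, …, y_{t-1}))`. -/
def jointLaw (μ : Measure W) (P : Source X) (Q : Reproduction W X Y) (t : ℕ) :
    Measure (W × (Hist X t × Hist Y t)) :=
  μ ⊗ₘ jointKernel P (Q.causal t)

instance (μ : Measure W) [IsProbabilityMeasure μ] (P : Source X) (Q : Reproduction W X Y) (t : ℕ) :
    IsProbabilityMeasure (jointLaw μ P Q t) := by
  unfold jointLaw jointKernel; infer_instance

/-- The law of `(y^{t-1}, x^t)`, i.e. of everything on which `y_t` depends:
`P_t(dx_t | x^{t-1}) ⊗ (P_{0,t-1} ⊗ Q⃗_{0,t-1})(dx^{t-1}, dy_0^{t-1} | y^{-1}) ⊗ μ(dy^{-1})`. -/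
def pastLaw (μ : Measure W) (P : Source X) (Q : Reproduction W X Y) (t : ℕ) :
    Measure ((W × Hist Y t) × Hist X (t + 1)) :=
  (jointLaw μ P Q t ⊗ₘ (P.kernel t).comap (fun a => a.2.1) (by fun_prop)).map
    (fun a => ((a.1.1, a.1.2.2), a.1.2.1.snoc a.2))

theorem measurable_pastLaw_aux (t : ℕ) :
    Measurable (fun a : (W × (Hist X t × Hist Y t)) × X t =>
      ((a.1.1, a.1.2.2), a.1.2.1.snoc a.2)) :=
  Measurable.prodMk (by fun_prop)
    (Hist.measurable_snoc.comp (f := fun a : (W × (Hist X t × Hist Y t)) × X t =>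
      (a.1.2.1, a.2)) (by fun_prop))

instance (μ : Measure W) [IsProbabilityMeasure μ] (P : Source X) (Q : Reproduction W X Y) (t : ℕ) :
    IsProbabilityMeasure (pastLaw μ P Q t) :=
  Measure.isProbabilityMeasure_map (measurable_pastLaw_aux t).aemeasurable

/-- `Π_t(dy_t | y^{t-1})`: the regular conditional distribution of `y_t` given
`y^{t-1} = (y^{-1}, y_0, …, y_{t-1})` under the joint law. -/
def outputKernel [∀ t, StandardBorelSpace (Y t)] [∀ t, Nonempty (Y t)]
    (μ : Measure W) [IsProbabilityMeasure μ] (P : Source X) (Q : Reproduction W X Y) (t : ℕ) :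
    Kernel (W × Hist Y t) (Y t) :=
  condDistrib (fun a : W × (Hist X (t + 1) × Hist Y (t + 1)) => a.2.2.last)
    (fun a => (a.1, a.2.2.init)) (jointLaw μ P Q (t + 1))

/-- `d.total (n + 1)` is `d_{0,n}(x^n, y^n) = ∑_{t ≤ n} ρ_t(x^t, y_0^t)`. -/
def Distortion.total (d : Distortion X Y) : ∀ t, Hist X t → Hist Y t → ℝ≥0∞
  | 0, _, _ => 0
  | t + 1, x, y => d.total t x.init y.init + d.rho t x y

/-- The expected total distortion `E d_{0,n}(X^n, Y^n)`. -/
def expectedDistortion (μ : Measure W) (P : Source X) (d : Distortion X Y) (n : ℕ)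
    (Q : Reproduction W X Y) : ℝ≥0∞ :=
  ∫⁻ a, d.total (n + 1) a.2.1 a.2.2 ∂(jointLaw μ P Q (n + 1))

/-- The fidelity constraint `(n + 1)⁻¹ E d_{0,n}(X^n, Y^n) ≤ D`. -/
def Feasible (μ : Measure W) (P : Source X) (d : Distortion X Y) (n : ℕ) (D : ℝ≥0)
    (Q : Reproduction W X Y) : Prop :=
  ((n : ℝ≥0∞) + 1)⁻¹ * expectedDistortion μ P d n Q ≤ D

/-- The nonanticipative rate distortion function `R_{0,n}(D)`. -/
def nrdf (μ : Measure W) (P : Source X) (d : Distortion X Y) (n : ℕ) (D : ℝ≥0) : ℝ≥0∞ :=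
  ⨅ (Q : Reproduction W X Y) (_ : Feasible μ P d n D Q), info μ P (Q.causal (n + 1))

/-- `Q` attains the infimum that defines `R_{0,n}(D)`. -/
def IsOptimal (μ : Measure W) (P : Source X) (d : Distortion X Y) (n : ℕ) (D : ℝ≥0)
    (Q : Reproduction W X Y) : Prop :=
  Feasible μ P d n D Q ∧ info μ P (Q.causal (n + 1)) = nrdf μ P d n D

/-- The kernel `K + ε (L - K) = (1 - ε) K + ε L` (for `0 ≤ ε ≤ 1`). -/
def mix {α : Type*} {β : Type*} [MeasurableSpace α] [MeasurableSpace β] (ε : ℝ)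
    (K L : Kernel α β) : Kernel α β where
  toFun a := ENNReal.ofReal (1 - ε) • K a + ENNReal.ofReal ε • L a
  measurable' := by
    refine Measure.measurable_of_measurable_coe _ fun s hs => ?_
    simp only [Measure.coe_add, Measure.coe_smul, Pi.add_apply, Pi.smul_apply, smul_eq_mul]
    exact ((K.measurable_coe hs).const_mul _).add ((L.measurable_coe hs).const_mul _)

/-- The functional `𝕀_{0,n}(P_{0,n}, ·)` is finite along the beginning of the segment from `K`
to `L` and has a (finite, one-sided) directional derivative at `K` in the direction `L - K`. -/
def HasGateauxDerivToward (μ : Measure W) (P : Source X) {N : ℕ}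
    (K L : Kernel (W × Hist X N) (Hist Y N)) : Prop :=
  (∀ᶠ ε in 𝓝[≥] (0 : ℝ), info μ P (mix ε K L) ≠ ∞) ∧
    ∃ δ : ℝ, Tendsto
      (fun ε : ℝ => ((info μ P (mix ε K L)).toReal - (info μ P K).toReal) / ε)
      (𝓝[>] 0) (𝓝 δ)

/-- The kernel `L(dy_0^n | y^{-1}, x^n)` has a density bounded by a constant with respect to the
output distribution `Π_{0,n}(dy_0^n | y^{-1})` of `K`, for almost all `(y^{-1}, x^n)`. -/
def BoundedDensity (μ : Measure W) (P : Source X) {N : ℕ}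
    (K L : Kernel (W × Hist X N) (Hist Y N)) : Prop :=
  ∃ C : ℝ≥0, ∀ᵐ a ∂(μ.prod (P.law N)), L a ≤ (C : ℝ≥0∞) • outputLaw P K a.1

/-- Gâteaux differentiability of `𝕀_{0,n}(P_{0,n}, ·)` at `Q⃗_{0,n}`: the directional derivative
exists in the direction of every causal reproduction whose density with respect to the output
distribution of `Q` is bounded. (For those the functional is finite. Asking it of all
directions is a stronger requirement, which fails for continuous alphabets, where the functional
is infinite at some causal reproductions.) -/
def GateauxDifferentiableAt (μ : Measure W) (P : Source X) (n : ℕ) (Q : Reproduction W X Y) :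
    Prop :=
  ∀ Q' : Reproduction W X Y,
    BoundedDensity μ P (Q.causal (n + 1)) (Q'.causal (n + 1)) →
      HasGateauxDerivToward μ P (Q.causal (n + 1)) (Q'.causal (n + 1))

/-- `s ≤ 0` is a Lagrange multiplier of the fidelity constraint:
`R_{0,n}(D) ≤ 𝕀_{0,n}(P_{0,n}, Q⃗_{0,n}) - s (E d_{0,n}(X^n, Y^n) - (n + 1) D)`
for every causal reproduction. -/
def IsLagrangeMultiplier (μ : Measure W) (P : Source X) (d : Distortion X Y) (n : ℕ) (D : ℝ≥0)
    (s : ℝ) : Prop :=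
  s ≤ 0 ∧ ∀ Q : Reproduction W X Y,
    nrdf μ P d n D + ENNReal.ofReal (-s) * (((n : ℝ≥0∞) + 1) * D) ≤
      info μ P (Q.causal (n + 1)) + ENNReal.ofReal (-s) * expectedDistortion μ P d n Q

/-- `y^t = (y^{t-1}, y_t)`. -/
def extend {t : ℕ} (y : W × Hist Y t) (yt : Y t) : W × Hist Y (t + 1) := (y.1, y.2.snoc yt)

/-- The weight `exp (s ρ_t(x^t, y_0^t) - g(x^t, y^t)) ∈ [0, ∞]`, with `s · ∞ = -∞` if `s < 0` and
`0 · ∞ = 0`. -/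
def weight (d : Distortion X Y) (s : ℝ) (t : ℕ)
    (g : W × Hist Y (t + 1) → Hist X (t + 1) → ℝ) (y : W × Hist Y (t + 1))
    (x : Hist X (t + 1)) : ℝ≥0∞ :=
  EReal.exp ((s : EReal) * (d.rho t x y.2 : EReal) - (g y x : EReal))

/-- The partition function
`∫ exp (s ρ_t(x^t, y_0^t) - g(x^t, y^t)) Π_t(dy_t | y^{t-1})` at `p = (y^{t-1}, x^t)`. -/
def partition (d : Distortion X Y) (s : ℝ) (t : ℕ)
    (g : W × Hist Y (t + 1) → Hist X (t + 1) → ℝ) (Pi : Kernel (W × Hist Y t) (Y t))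
    (p : (W × Hist Y t) × Hist X (t + 1)) : ℝ≥0∞ :=
  ∫⁻ yt, weight d s t g (extend p.1 yt) p.2 ∂(Pi p.1)

/-- The logarithm of the partition function. -/
def logPartition (d : Distortion X Y) (s : ℝ) (t : ℕ)
    (g : W × Hist Y (t + 1) → Hist X (t + 1) → ℝ) (Pi : Kernel (W × Hist Y t) (Y t))
    (p : (W × Hist Y t) × Hist X (t + 1)) : ℝ :=
  Real.log (partition d s t g Pi p).toReal

/-- The recursion that determines `g_{t,n}(x^t, y^t)`, backwards from `g_{n,n} = 0`. -/
def BackwardRecursion (P : Source X) (d : Distortion X Y) (n : ℕ) (s : ℝ)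
    (Pi : ∀ t, Kernel (W × Hist Y t) (Y t))
    (g : ∀ t, W × Hist Y (t + 1) → Hist X (t + 1) → ℝ) : Prop :=
  (∀ y x, g n y x = 0) ∧
    ∀ t < n, ∀ y x, g t y x =
      -∫ x', logPartition d s (t + 1) (g (t + 1)) (Pi (t + 1)) (y, x.snoc x')
        ∂(P.kernel (t + 1) x)

end NRDF

end

noncomputable section

namespace NRDF

universe u v w

set_option linter.unusedSectionVars false

section structural

variable {W : Type w} {X : ℕ → Type u} {Y : ℕ → Type v} [MeasurableSpace W]
  [∀ t, MeasurableSpace (X t)] [∀ t, MeasurableSpace (Y t)]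

attribute [fun_prop] Hist.measurable_init Hist.measurable_last

@[fun_prop]
theorem _root_.Measurable.hist_snoc {α : Type*} [MeasurableSpace α] {t : ℕ} {f : α → Hist X t}
    {g : α → X t} (hf : Measurable f) (hg : Measurable g) :
    Measurable (fun a => (f a).snoc (g a)) :=
  Hist.measurable_snoc.comp (hf.prodMk hg)

theorem Hist.init_snoc {t : ℕ} (h : Hist X t) (x : X t) : (h.snoc x).init = h := rfl

instance Hist.instStandardBorelSpace [∀ t, StandardBorelSpace (X t)] :
    ∀ t, StandardBorelSpace (Hist X t)
  | 0 => (inferInstance : StandardBorelSpace PUnit)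
  | t + 1 =>
    haveI := Hist.instStandardBorelSpace t
    (inferInstance : StandardBorelSpace (Hist X t × X t))

theorem Source.lintegral_law_succ (P : Source X) (t : ℕ) {f : Hist X (t + 1) → ℝ≥0∞}
    (hf : Measurable f) :
    ∫⁻ x, f x ∂P.law (t + 1) = ∫⁻ x, ∫⁻ x', f (x.snoc x') ∂P.kernel t x ∂P.law t :=
  Measure.lintegral_compProd (μ := P.law t) (κ := P.kernel t) (f := f) hf

theorem Reproduction.lintegral_causal_succ (Q : Reproduction W X Y) (t : ℕ) (w : W)
    (x : Hist X (t + 1)) {f : Hist Y (t + 1) → ℝ≥0∞} (hf : Measurable f) :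
    ∫⁻ y, f y ∂Q.causal (t + 1) (w, x) =
      ∫⁻ y, ∫⁻ y', f (y.snoc y') ∂Q.kernel t ((w, y), x) ∂Q.causal t (w, x.init) := by
  refine (Kernel.lintegral_compProd _ _ (w, x) (f := f) hf).trans ?_
  rfl

theorem lintegral_compProd_jointKernel (μ : Measure W) [IsProbabilityMeasure μ] (P : Source X)
    {N : ℕ} (K : Kernel (W × Hist X N) (Hist Y N)) [IsSFiniteKernel K]
    {f : W × (Hist X N × Hist Y N) → ℝ≥0∞} (hf : Measurable f) :
    ∫⁻ a, f a ∂(μ ⊗ₘ jointKernel P K) =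
      ∫⁻ w, ∫⁻ x, ∫⁻ y, f (w, (x, y)) ∂K (w, x) ∂P.law N ∂μ := by
  unfold jointKernel
  rw [Measure.lintegral_compProd hf]
  refine lintegral_congr fun w => ?_
  rw [Kernel.lintegral_compProd _ _ _ (by fun_prop)]
  rfl

theorem lintegral_jointLaw (μ : Measure W) [IsProbabilityMeasure μ] (P : Source X)
    (Q : Reproduction W X Y) (t : ℕ) {f : W × (Hist X t × Hist Y t) → ℝ≥0∞} (hf : Measurable f) :
    ∫⁻ a, f a ∂jointLaw μ P Q t =
      ∫⁻ w, ∫⁻ x, ∫⁻ y, f (w, (x, y)) ∂Q.causal t (w, x) ∂P.law t ∂μ :=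
  lintegral_compProd_jointKernel μ P _ hf

theorem lintegral_pastLaw (μ : Measure W) [IsProbabilityMeasure μ] (P : Source X)
    (Q : Reproduction W X Y) (t : ℕ) {f : (W × Hist Y t) × Hist X (t + 1) → ℝ≥0∞}
    (hf : Measurable f) :
    ∫⁻ p, f p ∂pastLaw μ P Q t =
      ∫⁻ a, ∫⁻ x', f ((a.1, a.2.2), a.2.1.snoc x') ∂P.kernel t a.2.1 ∂jointLaw μ P Q t := by
  unfold pastLaw
  rw [lintegral_map hf (measurable_pastLaw_aux t)]
  exact Measure.lintegral_compProd (hf.comp (measurable_pastLaw_aux t))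

theorem lintegral_jointLaw_succ (μ : Measure W) [IsProbabilityMeasure μ] (P : Source X)
    (Q : Reproduction W X Y) (t : ℕ) {f : W × (Hist X (t + 1) × Hist Y (t + 1)) → ℝ≥0∞}
    (hf : Measurable f) :
    ∫⁻ a, f a ∂jointLaw μ P Q (t + 1) =
      ∫⁻ p, ∫⁻ y, f (p.1.1, (p.2, p.1.2.snoc y)) ∂Q.kernel t p ∂pastLaw μ P Q t := by
  have h1 : Measurable fun p : (W × Hist Y t) × Hist X (t + 1) =>
      ∫⁻ y, f (p.1.1, (p.2, p.1.2.snoc y)) ∂Q.kernel t p :=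
    Measurable.lintegral_kernel_prod_right' (κ := Q.kernel t)
      (f := fun q => f (q.1.1.1, (q.1.2, q.1.1.2.snoc q.2))) (by fun_prop)
  have h2 : Measurable fun a : W × (Hist X t × Hist Y t) =>
      ∫⁻ x', ∫⁻ y, f (a.1, (a.2.1.snoc x', a.2.2.snoc y))
        ∂Q.kernel t ((a.1, a.2.2), a.2.1.snoc x') ∂P.kernel t a.2.1 :=
    Measurable.lintegral_kernel_prod_right' (κ := (P.kernel t).comap
      (fun a : W × (Hist X t × Hist Y t) => a.2.1) (by fun_prop))
      (f := fun q => ∫⁻ y, f (q.1.1, (q.1.2.1.snoc q.2, q.1.2.2.snoc y))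
        ∂Q.kernel t ((q.1.1, q.1.2.2), q.1.2.1.snoc q.2))
      (h1.comp (g := fun p : (W × Hist Y t) × Hist X (t + 1) =>
      ∫⁻ y, f (p.1.1, (p.2, p.1.2.snoc y)) ∂Q.kernel t p)
      (f := fun q : (W × (Hist X t × Hist Y t)) × X t =>
        ((q.1.1, q.1.2.2), q.1.2.1.snoc q.2)) (by fun_prop))
  rw [lintegral_pastLaw μ P Q t h1, lintegral_jointLaw μ P Q t h2, lintegral_jointLaw μ P Q _ hf]
  refine lintegral_congr fun w => ?_
  have h3 : Measurable fun x : Hist X (t + 1) => ∫⁻ y, f (w, (x, y)) ∂Q.causal (t + 1) (w, x) :=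
    Measurable.lintegral_kernel_prod_right' (κ := (Q.causal (t + 1)).comap
      (fun x => (w, x)) (by fun_prop)) (f := fun q => f (w, (q.1, q.2))) (by fun_prop)
  rw [P.lintegral_law_succ t h3]
  refine lintegral_congr fun x => ?_
  have h4 : ∀ x', ∫⁻ y, f (w, (x.snoc x', y)) ∂Q.causal (t + 1) (w, x.snoc x') =
      ∫⁻ y, ∫⁻ y', f (w, (x.snoc x', y.snoc y')) ∂Q.kernel t ((w, y), x.snoc x')
        ∂Q.causal t (w, x) := fun x' => Q.lintegral_causal_succ t w _ (by fun_prop)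
  simp_rw [h4]
  rw [lintegral_lintegral_swap]
  exact (h1.comp (g := fun p : (W × Hist Y t) × Hist X (t + 1) =>
      ∫⁻ y, f (p.1.1, (p.2, p.1.2.snoc y)) ∂Q.kernel t p)
      (f := fun q : X t × Hist Y t => ((w, q.2), x.snoc q.1)) (by fun_prop)).aemeasurable

/-- The rearrangement `((y^{t-1}, x^t), y_t) ↦ (y^{-1}, x^t, y_0^t)`. -/
def joinEquiv (t : ℕ) : (((W × Hist Y t) × Hist X (t + 1)) × Y t) ≃ᵐ
    (W × (Hist X (t + 1) × Hist Y (t + 1))) where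
  toFun q := (q.1.1.1, (q.1.2, q.1.1.2.snoc q.2))
  invFun a := (((a.1, a.2.2.init), a.2.1), a.2.2.last)
  left_inv _ := rfl
  right_inv _ := rfl
  measurable_toFun := (by fun_prop : Measurable fun q : ((W × Hist Y t) × Hist X (t + 1)) × Y t =>
    (q.1.1.1, (q.1.2, q.1.1.2.snoc q.2)))
  measurable_invFun := (by fun_prop : Measurable fun a : W × (Hist X (t + 1) × Hist Y (t + 1)) =>
    (((a.1, a.2.2.init), a.2.1), a.2.2.last))

/-- The rearrangement `((y^{-1}, x^{t-1}, y_0^{t-1}), x_t) ↦ (y^{t-1}, x^t)`. -/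
def pastEquiv (t : ℕ) : ((W × (Hist X t × Hist Y t)) × X t) ≃ᵐ
    ((W × Hist Y t) × Hist X (t + 1)) where
  toFun a := ((a.1.1, a.1.2.2), a.1.2.1.snoc a.2)
  invFun p := ((p.1.1, (p.2.init, p.1.2)), p.2.last)
  left_inv _ := rfl
  right_inv _ := rfl
  measurable_toFun := measurable_pastLaw_aux t
  measurable_invFun := (by fun_prop : Measurable fun p : (W × Hist Y t) × Hist X (t + 1) =>
    ((p.1.1, (p.2.init, p.1.2)), p.2.last))

theorem jointLaw_succ (μ : Measure W) [IsProbabilityMeasure μ] (P : Source X)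
    (Q : Reproduction W X Y) (t : ℕ) :
    jointLaw μ P Q (t + 1) = (pastLaw μ P Q t ⊗ₘ Q.kernel t).map (joinEquiv t) := by
  refine Measure.ext_of_lintegral _ fun f hf => ?_
  rw [lintegral_jointLaw_succ μ P Q t hf, lintegral_map hf (joinEquiv t).measurable]
  exact (Measure.lintegral_compProd (hf.comp (joinEquiv t).measurable)).symm

theorem pastLaw_eq_map (μ : Measure W) (P : Source X) (Q : Reproduction W X Y) (t : ℕ) :
    pastLaw μ P Q t = (jointLaw μ P Q t ⊗ₘ (P.kernel t).comap (fun a => a.2.1) (by fun_prop)).map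
      (pastEquiv t) := rfl

theorem lintegral_jointLaw_succ_init (μ : Measure W) [IsProbabilityMeasure μ] (P : Source X)
    (Q : Reproduction W X Y) (t : ℕ) {f : W × (Hist X t × Hist Y t) → ℝ≥0∞} (hf : Measurable f) :
    ∫⁻ a, f (a.1, (a.2.1.init, a.2.2.init)) ∂jointLaw μ P Q (t + 1) =
      ∫⁻ a, f a ∂jointLaw μ P Q t := by
  rw [lintegral_jointLaw_succ μ P Q t (by fun_prop)]
  simp only [Hist.init_snoc, lintegral_const, measure_univ, mul_one]
  rw [lintegral_pastLaw μ P Q t (by fun_prop)]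
  simp [Hist.init_snoc]

end structural

section divergence

open InformationTheory

variable {α β : Type*} [MeasurableSpace α] [MeasurableSpace β]

theorem klDiv_map_measurableEquiv (M N : Measure α) [IsFiniteMeasure M] [IsFiniteMeasure N]
    (e : α ≃ᵐ β) : klDiv (M.map e) (N.map e) = klDiv M N := by
  refine le_antisymm (klDiv_map_le _ _ e.measurable) ?_
  have h := klDiv_map_le (M.map e) (N.map e) e.symm.measurable
  rwa [Measure.map_map e.symm.measurable e.measurable, Measure.map_map e.symm.measurable
    e.measurable, e.symm_comp_self, Measure.map_id, Measure.map_id] at h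

theorem klDiv_fst_compProd_le [StandardBorelSpace β] [Nonempty β] (M : Measure (α × β))
    [IsFiniteMeasure M] (ν : Measure α) [IsFiniteMeasure ν] (κ : Kernel α β) [IsMarkovKernel κ] :
    klDiv M (M.fst ⊗ₘ κ) ≤ klDiv M (ν ⊗ₘ κ) := by
  have h := klDiv_compProd_eq_add M.fst ν M.condKernel κ
  rw [M.disintegrate M.condKernel] at h
  rw [h]
  exact le_add_self

theorem klFun_convex_combination {a b x y : ℝ} (ha : 0 ≤ a) (hb : 0 ≤ b) (hab : a + b = 1)
    (hx : 0 ≤ x) (hy : 0 ≤ y) :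
    klFun (a * x + b * y) ≤ a * klFun x + b * klFun y :=
  convexOn_klFun.2 hx hy ha hb hab

/-- The relative entropy is subadditive in the pair of its arguments. -/
theorem klDiv_add_le (M₁ M₂ N₁ N₂ : Measure α) [IsFiniteMeasure M₁] [IsFiniteMeasure M₂]
    [IsFiniteMeasure N₁] [IsFiniteMeasure N₂] :
    klDiv (M₁ + M₂) (N₁ + N₂) ≤ klDiv M₁ N₁ + klDiv M₂ N₂ := by
  by_cases h₁ : M₁ ≪ N₁
  swap; · simp [klDiv_of_not_ac h₁]
  by_cases h₂ : M₂ ≪ N₂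
  swap; · simp [klDiv_of_not_ac h₂]
  set N := N₁ + N₂ with hN
  have hN₁ : N₁ ≪ N := Measure.absolutelyContinuous_of_le (Measure.le_add_right le_rfl)
  have hN₂ : N₂ ≪ N := Measure.absolutelyContinuous_of_le (Measure.le_add_left le_rfl)
  have hac : M₁ + M₂ ≪ N := (h₁.trans hN₁).add_left (h₂.trans hN₂)
  rw [klDiv_eq_lintegral_klFun_of_ac hac, klDiv_eq_lintegral_klFun_of_ac h₁,
    klDiv_eq_lintegral_klFun_of_ac h₂, ← lintegral_rnDeriv_mul hN₁ (by fun_prop),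
    ← lintegral_rnDeriv_mul hN₂ (by fun_prop), ← lintegral_add_left (by fun_prop)]
  refine lintegral_mono_ae ?_
  have hsum : N₁.rnDeriv N + N₂.rnDeriv N =ᵐ[N] fun _ => 1 := by
    filter_upwards [Measure.rnDeriv_add N₁ N₂ N, Measure.rnDeriv_self N] with a h1 h2
    rw [← h1, ← hN, h2]
  filter_upwards [Measure.rnDeriv_add M₁ M₂ N, Measure.rnDeriv_mul_rnDeriv (κ := N) h₁,
    Measure.rnDeriv_mul_rnDeriv (κ := N) h₂, hsum, Measure.rnDeriv_ne_top M₁ N,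
    Measure.rnDeriv_ne_top M₂ N, Measure.rnDeriv_ne_top N₁ N, Measure.rnDeriv_ne_top N₂ N]
    with a e1 e2 e3 e4 e5 e6 e7 e8
  rw [Pi.add_apply] at e1 e4
  rw [Pi.mul_apply] at e2 e3
  have hr : (N₁.rnDeriv N a).toReal + (N₂.rnDeriv N a).toReal = 1 := by
    rw [← ENNReal.toReal_add e7 e8, e4, ENNReal.toReal_one]
  rw [e1, ENNReal.toReal_add e5 e6, ← e2, ← e3, ENNReal.toReal_mul, ENNReal.toReal_mul]
  have key := klFun_convex_combination ENNReal.toReal_nonneg ENNReal.toReal_nonneg hr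
    (x := (M₁.rnDeriv N₁ a).toReal) (y := (M₂.rnDeriv N₂ a).toReal)
    ENNReal.toReal_nonneg ENNReal.toReal_nonneg
  rw [mul_comm (M₁.rnDeriv N₁ a).toReal, mul_comm (M₂.rnDeriv N₂ a).toReal]
  refine (ENNReal.ofReal_le_ofReal key).trans ?_
  rw [ENNReal.ofReal_add (mul_nonneg ENNReal.toReal_nonneg (klFun_nonneg ENNReal.toReal_nonneg))
    (mul_nonneg ENNReal.toReal_nonneg (klFun_nonneg ENNReal.toReal_nonneg)),
    ENNReal.ofReal_mul ENNReal.toReal_nonneg, ENNReal.ofReal_mul ENNReal.toReal_nonneg,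
    ENNReal.ofReal_toReal e7, ENNReal.ofReal_toReal e8]

theorem rnDeriv_le_rnDeriv_of_le {M M' N : Measure α} [IsFiniteMeasure M] [IsFiniteMeasure M']
    [IsFiniteMeasure N] (h : M' ≤ M) (hac : M ≪ N) : M'.rnDeriv N ≤ᵐ[N] M.rnDeriv N := by
  refine ae_le_of_forall_setLIntegral_le_of_sigmaFinite (Measure.measurable_rnDeriv _ _)
    fun s hs _ => ?_
  rw [Measure.setLIntegral_rnDeriv hac]
  exact (Measure.setLIntegral_rnDeriv_le s).trans (h s)

theorem klFun_le_of_le_two_mul {x y : ℝ} (hx : 0 ≤ x) (hxy : x ≤ 2 * y) :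
    klFun x ≤ 2 + 2 * klFun y + 2 * y := by
  have hy : 0 ≤ y := by linarith
  have h2 : klFun (2 * y) ≤ 2 * klFun y + 2 * y := by
    rcases hy.eq_or_lt with rfl | hy
    · simp [klFun_zero]
    · have hl : Real.log 2 ≤ 1 := by linarith [Real.log_two_lt_d9]
      rw [klFun_apply, klFun_apply, Real.log_mul (by norm_num) hy.ne']
      nlinarith [mul_le_mul_of_nonneg_left hl hy.le]
  rcases hxy.eq_or_lt with rfl | hlt
  · linarith
  have hy' : 0 < y := by linarith
  have key := klFun_convex_combination (a := 1 - x / (2 * y)) (b := x / (2 * y)) (x := 0)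
    (y := 2 * y) (by rw [sub_nonneg, div_le_one (by positivity)]; exact hxy) (by positivity)
    (by ring) le_rfl (by positivity)
  have e : (1 - x / (2 * y)) * 0 + x / (2 * y) * (2 * y) = x := by field_simp; ring
  rw [e, klFun_zero] at key
  have hb : x / (2 * y) ≤ 1 := by rw [div_le_one (by positivity)]; exact hxy
  have hb0 : 0 ≤ x / (2 * y) := by positivity
  have := mul_le_of_le_one_left (klFun_nonneg (x := 2 * y) (by positivity)) hb
  linarith

theorem klDiv_ne_top_of_le_two_smul {M M' N : Measure α} [IsFiniteMeasure M] [IsFiniteMeasure M']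
    [IsFiniteMeasure N] (h : M' ≤ (2 : ℝ≥0∞) • M) (hkl : klDiv M N ≠ ∞) : klDiv M' N ≠ ∞ := by
  have hac : M ≪ N := (klDiv_ne_top_iff.mp hkl).1
  have hac2 : (2 : ℝ≥0∞) • M ≪ N := hac.smul_left 2
  have hac' : M' ≪ N := (Measure.absolutelyContinuous_of_le h).trans hac2
  have : IsFiniteMeasure ((2 : ℝ≥0∞) • M) := Measure.smul_finite _ (by simp)
  rw [klDiv_eq_lintegral_klFun_of_ac hac] at hkl
  rw [klDiv_eq_lintegral_klFun_of_ac hac']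
  refine ne_top_of_le_ne_top (b := ∫⁻ a, (2 + 2 * ENNReal.ofReal (klFun (M.rnDeriv N a).toReal)
    + 2 * M.rnDeriv N a) ∂N) ?_ (lintegral_mono_ae ?_)
  · rw [lintegral_add_left (by fun_prop), lintegral_add_left (by fun_prop),
      lintegral_const_mul _ (by fun_prop), lintegral_const_mul _ (by fun_prop), lintegral_const]
    have := (Measure.lintegral_rnDeriv_lt_top M N).ne
    finiteness
  · filter_upwards [rnDeriv_le_rnDeriv_of_le h hac2, Measure.rnDeriv_ne_top M N,
      Measure.rnDeriv_smul_left_of_ne_top M N (r := 2) (by simp)] with a h1 h2 h3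
    rw [h3, Pi.smul_apply, smul_eq_mul] at h1
    have h4 := klFun_le_of_le_two_mul (x := (M'.rnDeriv N a).toReal) (y := (M.rnDeriv N a).toReal)
      ENNReal.toReal_nonneg (by
        have := ENNReal.toReal_mono (by finiteness) h1
        simpa [ENNReal.toReal_mul] using this)
    refine (ENNReal.ofReal_le_ofReal h4).trans ?_
    have h5 := klFun_nonneg (x := (M.rnDeriv N a).toReal) ENNReal.toReal_nonneg
    rw [ENNReal.ofReal_add (by positivity) (by positivity), ENNReal.ofReal_add (by positivity)
      (by positivity), ENNReal.ofReal_mul (by positivity), ENNReal.ofReal_mul (by positivity),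
      ENNReal.ofReal_toReal h2]
    simp

theorem klFun_tilt {x c l : ℝ} (hx : 0 ≤ x) :
    klFun x + c * x + Real.exp (l - c) =
      Real.exp (l - c) * klFun (x * Real.exp (c - l)) + l * x + 1 := by
  rcases hx.eq_or_lt with rfl | hx
  · simp [klFun_zero]; ring
  · rw [klFun_apply, klFun_apply, Real.log_mul hx.ne' (Real.exp_ne_zero _), Real.log_exp]
    have : Real.exp (l - c) * Real.exp (c - l) = 1 := by rw [← Real.exp_add]; simp
    linear_combination (-x * (Real.log x + (c - l)) + x) * this

/-- The Gibbs variational identity: tilting the reference measure `N` by the density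
`exp (L - c)`. -/
theorem klDiv_add_lintegral_eq (M N : Measure α) [IsProbabilityMeasure M] [IsProbabilityMeasure N]
    (hMN : M ≪ N) {c L u : α → ℝ≥0∞} (hc : Measurable c) (hL : Measurable L) (hu : Measurable u)
    (hcM : ∀ᵐ a ∂M, c a ≠ ∞)
    (hLN : ∀ᵐ a ∂N, L a ≠ ∞)
    (hu_top : ∀ᵐ a ∂N, c a = ∞ → u a = 0)
    (hu_exp : ∀ᵐ a ∂N, c a ≠ ∞ → u a = ENNReal.ofReal (Real.exp ((L a).toReal - (c a).toReal)))
    (hu_int : ∫⁻ a, u a ∂N = 1) :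
    klDiv M N + ∫⁻ a, c a ∂M = klDiv M (N.withDensity u) + ∫⁻ a, L a ∂M := by
  set f := M.rnDeriv N with hf
  have hfm : Measurable f := Measure.measurable_rnDeriv _ _
  have hM : N.withDensity f = M := Measure.withDensity_rnDeriv_eq M N hMN
  have hf0 : ∀ᵐ a ∂N, c a = ∞ → f a = 0 := by
    have h1 : ∀ᵐ a ∂N, f a ≠ 0 → c a ≠ ∞ := by
      rw [← ae_withDensity_iff hfm, hM]; exact hcM
    filter_upwards [h1] with a ha h
    by_contra h'
    exact ha h' h
  set h := fun a => f a * (u a)⁻¹ with hh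
  have hhm : Measurable h := hfm.mul hu.inv
  have huh : ∀ᵐ a ∂N, u a * h a = f a := by
    filter_upwards [hf0, hu_top, hu_exp] with a h1 h2 h3
    by_cases hca : c a = ∞
    · simp [hh, h1 hca, h2 hca]
    · have hpos : u a ≠ 0 := by rw [h3 hca]; simp [Real.exp_pos]
      have hfin : u a ≠ ∞ := by rw [h3 hca]; simp
      rw [hh]; dsimp only
      rw [mul_comm (f a), ← mul_assoc, ENNReal.mul_inv_cancel hpos hfin, one_mul]
  have hMt : M = (N.withDensity u).withDensity h := by
    rw [← withDensity_mul _ hu hhm, ← hM]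
    exact (withDensity_congr_ae huh).symm
  have : IsProbabilityMeasure (N.withDensity u) :=
    ⟨by rw [withDensity_apply _ MeasurableSet.univ, Measure.restrict_univ, hu_int]⟩
  have hMac : M ≪ N.withDensity u := by
    rw [hMt]; exact withDensity_absolutelyContinuous _ _
  have hrn : M.rnDeriv (N.withDensity u) =ᵐ[N.withDensity u] h := by
    conv_lhs => rw [hMt]
    exact Measure.rnDeriv_withDensity _ hhm
  have hkl : klDiv M (N.withDensity u) =
      ∫⁻ a, u a * ENNReal.ofReal (klFun (h a).toReal) ∂N := by
    rw [klDiv_eq_lintegral_klFun_of_ac hMac]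
    have : (fun a => ENNReal.ofReal (klFun (M.rnDeriv (N.withDensity u) a).toReal))
        =ᵐ[N.withDensity u] fun a => ENNReal.ofReal (klFun (h a).toReal) := by
      filter_upwards [hrn] with a ha using by rw [ha]
    rw [lintegral_congr_ae this, lintegral_withDensity_eq_lintegral_mul _ hu (by fun_prop)]
    rfl
  have hcf : ∫⁻ a, c a ∂M = ∫⁻ a, f a * c a ∂N :=
    (lintegral_rnDeriv_mul hMN hc.aemeasurable).symm
  have hLf : ∫⁻ a, L a ∂M = ∫⁻ a, f a * L a ∂N :=
    (lintegral_rnDeriv_mul hMN hL.aemeasurable).symm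
  have hpt : ∀ᵐ a ∂N, ENNReal.ofReal (klFun (f a).toReal) + f a * c a + u a =
      u a * ENNReal.ofReal (klFun (h a).toReal) + f a * L a + 1 := by
    filter_upwards [hf0, hu_top, hu_exp, hLN, Measure.rnDeriv_ne_top M N] with a h1 h2 h3 h4 h5
    by_cases hca : c a = ∞
    · simp [h1 hca, h2 hca, klFun_zero]
    · have key := klFun_tilt (x := (f a).toReal) (c := (c a).toReal) (l := (L a).toReal)
        ENNReal.toReal_nonneg
      have hha : (h a).toReal = (f a).toReal * Real.exp ((c a).toReal - (L a).toReal) := by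
        rw [hh]; dsimp only
        rw [ENNReal.toReal_mul, ENNReal.toReal_inv, h3 hca, ENNReal.toReal_ofReal
          (Real.exp_nonneg _), ← Real.exp_neg, neg_sub]
      rw [hha, h3 hca]
      have k1 := klFun_nonneg (x := (f a).toReal) ENNReal.toReal_nonneg
      have k2 := klFun_nonneg (x := (f a).toReal * Real.exp ((c a).toReal - (L a).toReal))
        (by positivity)
      have := congrArg ENNReal.ofReal key
      rw [ENNReal.ofReal_add (by positivity) (by positivity), ENNReal.ofReal_add (by positivity)
        (by positivity), ENNReal.ofReal_add (by positivity) (by positivity),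
        ENNReal.ofReal_add (by positivity) (by positivity), ENNReal.ofReal_mul (by positivity),
        ENNReal.ofReal_mul (by positivity), ENNReal.ofReal_mul (by positivity),
        ENNReal.ofReal_toReal hca, ENNReal.ofReal_toReal h4, ENNReal.ofReal_toReal h5,
        ENNReal.ofReal_one] at this
      rw [mul_comm (f a), mul_comm (f a)]
      exact this
  have h_integral := lintegral_congr_ae hpt
  rw [lintegral_add_right _ hu, lintegral_add_left (by fun_prop), lintegral_add_right _ (by fun_prop),
    lintegral_add_left (by fun_prop), hu_int, lintegral_one, measure_univ] at h_integral
  rw [hkl, hcf, hLf, klDiv_eq_lintegral_klFun_of_ac hMN]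
  exact (ENNReal.add_left_inj ENNReal.one_ne_top).mp h_integral

/-- If the relative entropy of `(1 - ε) J + ε m` with respect to `m` has a finite right derivative
at `ε = 0`, then `m` is absolutely continuous with respect to `J`. -/
theorem absolutelyContinuous_of_klDiv_segment {J m : Measure α} [IsProbabilityMeasure J]
    [IsProbabilityMeasure m] (hkl : klDiv J m ≠ ∞) {δ : ℝ}
    (hδ : Tendsto (fun ε : ℝ => ((klDiv (ENNReal.ofReal (1 - ε) • J + ENNReal.ofReal ε • m)
      m).toReal - (klDiv J m).toReal) / ε) (𝓝[>] 0) (𝓝 δ)) : m ≪ J := by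
  have hJm : J ≪ m := (klDiv_ne_top_iff.mp hkl).1
  set f := J.rnDeriv m with hf
  have hfm : Measurable f := Measure.measurable_rnDeriv _ _
  set A := {a | f a = 0} with hA
  have hAm : MeasurableSet A := hfm (measurableSet_singleton 0)
  suffices hmA : m A = 0 by
    refine Measure.AbsolutelyContinuous.mk fun s hs hs0 => ?_
    rw [← Measure.withDensity_rnDeriv_eq J m hJm, withDensity_apply _ hs,
      setLIntegral_eq_zero_iff hs hfm] at hs0
    refine measure_mono_null_ae ?_ hmA
    filter_upwards [hs0] with a ha h using ha h
  by_contra hmA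
  have hpos : 0 < m.real A := by
    rw [measureReal_def]; exact ENNReal.toReal_pos hmA (measure_ne_top _ _)
  have h_integral : Integrable (fun a => klFun (f a).toReal) m :=
    (integrable_klFun_rnDeriv_iff hJm).mpr (klDiv_ne_top_iff.mp hkl).2
  have hbound : ∀ᶠ ε in 𝓝[>] (0 : ℝ), ((klDiv (ENNReal.ofReal (1 - ε) • J + ENNReal.ofReal ε • m)
      m).toReal - (klDiv J m).toReal) / ε ≤ m.real A * (Real.log ε - 1) := by
    have : Set.Ioo (0 : ℝ) 1 ∈ 𝓝[>] (0 : ℝ) := Ioo_mem_nhdsGT one_pos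
    filter_upwards [this] with ε hε
    have hac : ENNReal.ofReal (1 - ε) • J + ENNReal.ofReal ε • m ≪ m :=
      (hJm.smul_left _).add_left (Measure.AbsolutelyContinuous.rfl.smul_left _)
    have i1 : IsFiniteMeasure (ENNReal.ofReal (1 - ε) • J) := Measure.smul_finite _ (by simp)
    have i2 : IsFiniteMeasure (ENNReal.ofReal ε • m) := Measure.smul_finite _ (by simp)
    rw [div_le_iff₀ hε.1, toReal_klDiv_eq_integral_klFun hac, toReal_klDiv_eq_integral_klFun hJm,
      sub_le_iff_le_add]
    have hg : Integrable (fun a => klFun (f a).toReal - A.indicator (fun _ => 1 - klFun ε) a) m :=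
      h_integral.sub ((integrable_const _).indicator hAm)
    refine (integral_mono_of_nonneg (g := fun a => klFun (f a).toReal -
      A.indicator (fun _ => 1 - klFun ε) a) (ae_of_all _ fun a => klFun_nonneg
        ENNReal.toReal_nonneg) hg ?_).trans_eq ?_
    · filter_upwards [Measure.rnDeriv_add (ENNReal.ofReal (1 - ε) • J) (ENNReal.ofReal ε • m) m,
        Measure.rnDeriv_smul_left_of_ne_top J m (r := ENNReal.ofReal (1 - ε)) (by simp),
        Measure.rnDeriv_smul_left_of_ne_top m m (r := ENNReal.ofReal ε) (by simp),
        Measure.rnDeriv_self m, Measure.rnDeriv_ne_top J m] with a h1 h2 h3 h4 h5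
      rw [h1, Pi.add_apply, h2, h3, Pi.smul_apply, Pi.smul_apply, h4, smul_eq_mul, smul_eq_mul,
        mul_one, ENNReal.toReal_add (by finiteness) (by finiteness), ENNReal.toReal_mul,
        ENNReal.toReal_ofReal (by linarith [hε.2]), ENNReal.toReal_ofReal hε.1.le]
      by_cases ha : a ∈ A
      · have : f a = 0 := ha
        rw [Set.indicator_of_mem ha, ← hf, this]
        simp [klFun_zero]
      · rw [Set.indicator_of_notMem ha, sub_zero]
        have key := klFun_convex_combination (a := 1 - ε) (b := ε) (x := (f a).toReal) (y := 1)
          (by linarith [hε.2]) hε.1.le (by ring) ENNReal.toReal_nonneg zero_le_one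
        rw [klFun_one, mul_one, mul_zero, add_zero] at key
        refine key.trans ?_
        nlinarith [klFun_nonneg (x := (f a).toReal) ENNReal.toReal_nonneg, hε.1]
    · rw [integral_sub h_integral ((integrable_const _).indicator hAm), integral_indicator_const _ hAm,
        klFun_apply, smul_eq_mul]
      ring
  have hbot : Tendsto (fun ε : ℝ => m.real A * (Real.log ε - 1)) (𝓝[>] 0) atBot := by
    refine Tendsto.const_mul_atBot hpos ?_
    exact tendsto_atBot_add_const_right _ _ Real.tendsto_log_nhdsGT_zero
  exact not_tendsto_nhds_of_tendsto_atBot (tendsto_atBot_mono' _ hbound hbot) δ hδ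

end divergence

section laws

open InformationTheory

variable {W : Type w} {X : ℕ → Type u} {Y : ℕ → Type v} [MeasurableSpace W]
  [∀ t, MeasurableSpace (X t)] [∀ t, MeasurableSpace (Y t)]

theorem jointLaw_zero_eq (μ : Measure W) [IsProbabilityMeasure μ] (P : Source X)
    (Q Q' : Reproduction W X Y) : jointLaw μ P Q 0 = jointLaw μ P Q' 0 := rfl

theorem pastLaw_congr {μ : Measure W} {P : Source X} {Q Q' : Reproduction W X Y} {t : ℕ}
    (h : jointLaw μ P Q t = jointLaw μ P Q' t) : pastLaw μ P Q t = pastLaw μ P Q' t := by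
  unfold pastLaw; rw [h]

theorem jointLaw_succ_map_init (μ : Measure W) [IsProbabilityMeasure μ] (P : Source X)
    (Q : Reproduction W X Y) (t : ℕ) :
    (jointLaw μ P Q (t + 1)).map (fun a => (a.1, (a.2.1.init, a.2.2.init))) =
      jointLaw μ P Q t := by
  refine Measure.ext_of_lintegral _ fun f hf => ?_
  rw [lintegral_map hf (by fun_prop), lintegral_jointLaw_succ_init μ P Q t hf]

/-- Chain rule for the relative entropy between two joint laws. -/
theorem klDiv_jointLaw_succ (μ : Measure W) [IsProbabilityMeasure μ] (P : Source X)
    (Q Q' : Reproduction W X Y) (t : ℕ) :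
    klDiv (jointLaw μ P Q (t + 1)) (jointLaw μ P Q' (t + 1)) =
      klDiv (jointLaw μ P Q t) (jointLaw μ P Q' t) +
        klDiv (pastLaw μ P Q t ⊗ₘ Q.kernel t) (pastLaw μ P Q t ⊗ₘ Q'.kernel t) := by
  rw [jointLaw_succ, jointLaw_succ, klDiv_map_measurableEquiv, klDiv_compProd_eq_add,
    pastLaw_eq_map μ P Q, pastLaw_eq_map μ P Q', klDiv_map_measurableEquiv, klDiv_compProd_left]

theorem pastLaw_absolutelyContinuous {μ : Measure W} [IsProbabilityMeasure μ] {P : Source X}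
    {Q Q' : Reproduction W X Y} {t : ℕ} (h : jointLaw μ P Q t ≪ jointLaw μ P Q' t) :
    pastLaw μ P Q t ≪ pastLaw μ P Q' t := by
  rw [pastLaw_eq_map, pastLaw_eq_map]
  exact (h.compProd_left _).map (pastEquiv t).measurable

theorem jointLaw_absolutelyContinuous_of_le {μ : Measure W} [IsProbabilityMeasure μ]
    {P : Source X} {Q Q' : Reproduction W X Y} {t N : ℕ} (htN : t ≤ N)
    (h : jointLaw μ P Q N ≪ jointLaw μ P Q' N) : jointLaw μ P Q t ≪ jointLaw μ P Q' t := by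
  induction N, htN using Nat.le_induction with
  | base => exact h
  | succ N _ ih =>
    refine ih ?_
    rw [← jointLaw_succ_map_init μ P Q N, ← jointLaw_succ_map_init μ P Q' N]
    exact h.map (by fun_prop)

instance (P : Source X) {N : ℕ} (K : Kernel (W × Hist X N) (Hist Y N)) [IsMarkovKernel K] :
    IsMarkovKernel (jointKernel P K) := by unfold jointKernel; infer_instance

instance (P : Source X) {N : ℕ} (K : Kernel (W × Hist X N) (Hist Y N)) [IsMarkovKernel K] :
    IsMarkovKernel (outputLaw P K) := by unfold outputLaw; infer_instance

instance (P : Source X) {N : ℕ} (K : Kernel (W × Hist X N) (Hist Y N)) [IsMarkovKernel K] :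
    IsMarkovKernel (productKernel P K) := by unfold productKernel; infer_instance

theorem compProd_outputLaw_eq_map (μ : Measure W) [IsProbabilityMeasure μ] (P : Source X)
    {N : ℕ} (K : Kernel (W × Hist X N) (Hist Y N)) [IsMarkovKernel K] :
    μ ⊗ₘ outputLaw P K = (μ ⊗ₘ jointKernel P K).map (fun a => (a.1, a.2.2)) := by
  refine Measure.ext_of_lintegral _ fun f hf => ?_
  rw [lintegral_map hf (by fun_prop), Measure.lintegral_compProd hf,
    Measure.lintegral_compProd (by fun_prop)]
  refine lintegral_congr fun w => ?_
  unfold outputLaw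
  rw [Kernel.lintegral_snd _ _ (by fun_prop)]

theorem lintegral_compProd_productKernel (μ : Measure W) [IsProbabilityMeasure μ] (P : Source X)
    {N : ℕ} (K : Kernel (W × Hist X N) (Hist Y N)) [IsMarkovKernel K]
    {f : W × (Hist X N × Hist Y N) → ℝ≥0∞} (hf : Measurable f) :
    ∫⁻ a, f a ∂(μ ⊗ₘ productKernel P K) =
      ∫⁻ x, ∫⁻ q, f (q.1, (x, q.2)) ∂(μ ⊗ₘ jointKernel P K).map (fun a => (a.1, a.2.2))
        ∂P.law N := by
  rw [← compProd_outputLaw_eq_map, Measure.lintegral_compProd hf]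
  have h1 : ∀ x, ∫⁻ q, f (q.1, (x, q.2)) ∂(μ ⊗ₘ outputLaw P K) =
      ∫⁻ w, ∫⁻ y, f (w, (x, y)) ∂outputLaw P K w ∂μ := fun x =>
    Measure.lintegral_compProd (by fun_prop)
  simp_rw [h1]
  rw [lintegral_lintegral_swap]
  · refine lintegral_congr fun w => ?_
    unfold productKernel
    rw [Kernel.prod_apply, lintegral_prod _ (by fun_prop), Kernel.const_apply]
  · exact (Measurable.lintegral_kernel_prod_right' (κ := (outputLaw P K).comap
      (fun p : Hist X N × W => p.2) measurable_snd) (f := fun q => f (q.1.2, (q.1.1, q.2)))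
      (by fun_prop)).aemeasurable

/-- The product law depends only on the law of the outputs. -/
theorem compProd_productKernel_congr (μ : Measure W) [IsProbabilityMeasure μ] (P : Source X)
    {N : ℕ} (K K' : Kernel (W × Hist X N) (Hist Y N)) [IsMarkovKernel K] [IsMarkovKernel K']
    (h : (μ ⊗ₘ jointKernel P K).map (fun a => (a.1, a.2.2)) =
      (μ ⊗ₘ jointKernel P K').map (fun a => (a.1, a.2.2))) :
    μ ⊗ₘ productKernel P K = μ ⊗ₘ productKernel P K' := by
  refine Measure.ext_of_lintegral _ fun f hf => ?_
  rw [lintegral_compProd_productKernel μ P K hf, lintegral_compProd_productKernel μ P K' hf, h]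

theorem jointLaw_map_output_succ_init (μ : Measure W) [IsProbabilityMeasure μ] (P : Source X)
    (Q : Reproduction W X Y) (t : ℕ) :
    (jointLaw μ P Q (t + 1)).map (fun a => (a.1, a.2.2.init)) =
      (jointLaw μ P Q t).map (fun a => (a.1, a.2.2)) := by
  rw [← jointLaw_succ_map_init μ P Q t, Measure.map_map (by fun_prop) (by fun_prop)]
  rfl

theorem Source.nonempty_hist (P : Source X) (t : ℕ) : Nonempty (Hist X t) :=
  nonempty_of_isProbabilityMeasure (P.law t)

/-- `info` is the smallest relative entropy with respect to a product law. -/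
theorem info_le_klDiv [∀ t, StandardBorelSpace (X t)] (μ : Measure W) [IsProbabilityMeasure μ]
    (P : Source X) {N : ℕ} (K K' : Kernel (W × Hist X N) (Hist Y N)) [IsMarkovKernel K]
    [IsMarkovKernel K'] :
    info μ P K ≤ klDiv (μ ⊗ₘ jointKernel P K) (μ ⊗ₘ productKernel P K') := by
  have := P.nonempty_hist N
  let e : (W × (Hist X N × Hist Y N)) ≃ᵐ ((W × Hist Y N) × Hist X N) :=
    { toFun := fun a => ((a.1, a.2.2), a.2.1)
      invFun := fun b => (b.1.1, (b.2, b.1.2))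
      left_inv := fun _ => rfl
      right_inv := fun _ => rfl
      measurable_toFun := (by fun_prop : Measurable fun a : W × (Hist X N × Hist Y N) =>
        ((a.1, a.2.2), a.2.1))
      measurable_invFun := (by fun_prop : Measurable fun b : (W × Hist Y N) × Hist X N =>
        (b.1.1, (b.2, b.1.2))) }
  have hprod : ∀ K : Kernel (W × Hist X N) (Hist Y N), ∀ [IsMarkovKernel K],
      (μ ⊗ₘ productKernel P K).map e =
        (μ ⊗ₘ jointKernel P K).map (fun a => (a.1, a.2.2)) ⊗ₘ Kernel.const _ (P.law N) := by
    intro K _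
    refine Measure.ext_of_lintegral _ fun f hf => ?_
    have : IsProbabilityMeasure ((μ ⊗ₘ jointKernel P K).map (fun a => (a.1, a.2.2))) :=
      Measure.isProbabilityMeasure_map (by fun_prop)
    rw [lintegral_map hf e.measurable, lintegral_compProd_productKernel μ P K
      (f := fun a => f (e a)) (hf.comp e.measurable), Measure.lintegral_compProd hf,
      lintegral_lintegral_swap]
    · rfl
    · exact (hf.comp (by fun_prop : Measurable fun q : Hist X N × (W × Hist Y N) =>
        (q.2, q.1))).aemeasurable
  have hfst : ((μ ⊗ₘ jointKernel P K).map e).fst =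
      (μ ⊗ₘ jointKernel P K).map (fun a => (a.1, a.2.2)) := by
    rw [Measure.fst, Measure.map_map measurable_fst e.measurable]
    rfl
  have : IsProbabilityMeasure ((μ ⊗ₘ jointKernel P K').map (fun a => (a.1, a.2.2))) :=
      Measure.isProbabilityMeasure_map (by fun_prop)
  have : IsProbabilityMeasure ((μ ⊗ₘ jointKernel P K).map e) :=
      Measure.isProbabilityMeasure_map (by fun_prop)
  unfold info
  rw [← klDiv_map_measurableEquiv _ _ e, ← klDiv_map_measurableEquiv _
    (μ ⊗ₘ productKernel P K') e, hprod K, hprod K', ← hfst]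
  exact klDiv_fst_compProd_le _ _ _

section output

variable [∀ t, StandardBorelSpace (Y t)] [∀ t, Nonempty (Y t)]

instance (μ : Measure W) [IsProbabilityMeasure μ] (P : Source X) (Q : Reproduction W X Y)
    (t : ℕ) : IsMarkovKernel (outputKernel μ P Q t) := by
  unfold outputKernel; infer_instance

/-- The reproduction that ignores the source and uses the output kernels of `Q`. -/
def outputRep (μ : Measure W) [IsProbabilityMeasure μ] (P : Source X)
    (Q : Reproduction W X Y) : Reproduction W X Y where
  kernel t := (outputKernel μ P Q t).comap Prod.fst measurable_fst
  markov _ := inferInstance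

theorem outputRep_kernel_apply (μ : Measure W) [IsProbabilityMeasure μ] (P : Source X)
    (Q : Reproduction W X Y) (t : ℕ) (p : (W × Hist Y t) × Hist X (t + 1)) :
    (outputRep μ P Q).kernel t p = outputKernel μ P Q t p.1 := rfl

theorem jointLaw_map_output_succ (μ : Measure W) [IsProbabilityMeasure μ] (P : Source X)
    (Q : Reproduction W X Y) (t : ℕ) :
    (jointLaw μ P Q (t + 1)).map (fun a => ((a.1, a.2.2.init), a.2.2.last)) =
      (jointLaw μ P Q t).map (fun a => (a.1, a.2.2)) ⊗ₘ outputKernel μ P Q t := by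
  rw [← jointLaw_map_output_succ_init]
  exact (compProd_map_condDistrib (by fun_prop)).symm

theorem lintegral_jointLaw_outputRep (μ : Measure W) [IsProbabilityMeasure μ] (P : Source X)
    (Q : Reproduction W X Y) (t : ℕ) {f : W × (Hist X t × Hist Y t) → ℝ≥0∞} (hf : Measurable f) :
    ∫⁻ a, f a ∂jointLaw μ P (outputRep μ P Q) t =
      ∫⁻ x, ∫⁻ q, f (q.1, (x, q.2)) ∂(jointLaw μ P Q t).map (fun a => (a.1, a.2.2)) ∂P.law t := by
  induction t with
  | zero =>
    have hx : ∀ x, ∫⁻ q, f (q.1, (x, q.2)) ∂(jointLaw μ P Q 0).map (fun a => (a.1, a.2.2)) =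
        ∫⁻ w, ∫⁻ x', ∫⁻ y, f (w, (x, y)) ∂Q.causal 0 (w, x') ∂P.law 0 ∂μ := fun x => by
      rw [lintegral_map (by fun_prop) (by fun_prop), lintegral_jointLaw μ P Q 0 (by fun_prop)]
    simp_rw [hx, lintegral_jointLaw μ P _ 0 hf]
    change ∫⁻ w, ∫⁻ x, ∫⁻ y, f (w, (x, y)) ∂(Measure.dirac PUnit.unit : Measure PUnit)
      ∂(Measure.dirac PUnit.unit : Measure PUnit) ∂μ = ∫⁻ x, ∫⁻ w, ∫⁻ x',
        ∫⁻ y, f (w, (x, y)) ∂(Measure.dirac PUnit.unit : Measure PUnit)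
      ∂(Measure.dirac PUnit.unit : Measure PUnit) ∂μ ∂(Measure.dirac PUnit.unit : Measure PUnit)
    simp only [lintegral_dirac]
  | succ t ih =>
    have hO : ∀ x, ∫⁻ q, f (q.1, (x, q.2)) ∂(jointLaw μ P Q (t + 1)).map (fun a => (a.1, a.2.2)) =
        ∫⁻ q, ∫⁻ y, f (q.1, (x, q.2.snoc y)) ∂outputKernel μ P Q t q
          ∂(jointLaw μ P Q t).map (fun a => (a.1, a.2.2)) := fun x => by
      have := congrArg (fun m => ∫⁻ r, f (r.1.1, (x, r.1.2.snoc r.2)) ∂m)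
        (jointLaw_map_output_succ μ P Q t)
      rw [lintegral_map (by fun_prop) (by fun_prop), Measure.lintegral_compProd (by fun_prop)]
        at this
      rw [lintegral_map (by fun_prop) (by fun_prop), ← this]
      rfl
    have h1 : Measurable fun r : Hist X (t + 1) × (W × Hist Y t) =>
        ∫⁻ y, f (r.2.1, (r.1, r.2.2.snoc y)) ∂outputKernel μ P Q t r.2 :=
      Measurable.lintegral_kernel_prod_right' (κ := (outputKernel μ P Q t).comap
        (fun r : Hist X (t + 1) × (W × Hist Y t) => r.2) measurable_snd)
        (f := fun r => f (r.1.2.1, (r.1.1, r.1.2.2.snoc r.2))) (by fun_prop)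
    have h2 : Measurable fun p : (W × Hist Y t) × Hist X (t + 1) =>
        ∫⁻ y, f (p.1.1, (p.2, p.1.2.snoc y)) ∂outputKernel μ P Q t p.1 :=
      h1.comp measurable_swap
    have h3 : Measurable fun a : W × (Hist X t × Hist Y t) => ∫⁻ x', ∫⁻ y,
        f (a.1, (a.2.1.snoc x', a.2.2.snoc y)) ∂outputKernel μ P Q t (a.1, a.2.2)
          ∂P.kernel t a.2.1 :=
      Measurable.lintegral_kernel_prod_right' (κ := (P.kernel t).comap
        (fun a : W × (Hist X t × Hist Y t) => a.2.1) (by fun_prop))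
        (f := fun q => ∫⁻ y, f (q.1.1, (q.1.2.1.snoc q.2, q.1.2.2.snoc y))
          ∂outputKernel μ P Q t (q.1.1, q.1.2.2))
        (h2.comp (pastEquiv t).measurable)
    have h4 : Measurable fun x : Hist X (t + 1) => ∫⁻ q, ∫⁻ y, f (q.1, (x, q.2.snoc y))
        ∂outputKernel μ P Q t q ∂(jointLaw μ P Q t).map (fun a => (a.1, a.2.2)) :=
      h1.lintegral_prod_right'
    rw [lintegral_jointLaw_succ μ P _ t hf]
    simp_rw [outputRep_kernel_apply]
    rw [lintegral_pastLaw μ P _ t h2, ih h3]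
    simp_rw [hO]
    rw [P.lintegral_law_succ t h4]
    refine lintegral_congr fun x => ?_
    rw [lintegral_lintegral_swap]
    exact (h1.comp (by fun_prop : Measurable fun r : (W × Hist Y t) × X t =>
      (x.snoc r.2, r.1))).aemeasurable

theorem jointLaw_outputRep (μ : Measure W) [IsProbabilityMeasure μ] (P : Source X)
    (Q : Reproduction W X Y) (t : ℕ) :
    jointLaw μ P (outputRep μ P Q) t = μ ⊗ₘ productKernel P (Q.causal t) := by
  refine Measure.ext_of_lintegral _ fun f hf => ?_
  rw [lintegral_jointLaw_outputRep μ P Q t hf, lintegral_compProd_productKernel μ P _ hf]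
  rfl

theorem info_eq_klDiv_jointLaw (μ : Measure W) [IsProbabilityMeasure μ] (P : Source X)
    (Q : Reproduction W X Y) (t : ℕ) :
    info μ P (Q.causal t) = klDiv (jointLaw μ P Q t) (jointLaw μ P (outputRep μ P Q) t) := by
  rw [jointLaw_outputRep]; rfl

theorem info_le_klDiv_jointLaw [∀ t, StandardBorelSpace (X t)] (μ : Measure W)
    [IsProbabilityMeasure μ] (P : Source X) (Q Q' : Reproduction W X Y) (t : ℕ) :
    info μ P (Q'.causal t) ≤
      klDiv (jointLaw μ P Q' t) (jointLaw μ P (outputRep μ P Q) t) := by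
  rw [jointLaw_outputRep]
  exact info_le_klDiv μ P _ _

theorem jointLaw_outputRep_map_output (μ : Measure W) [IsProbabilityMeasure μ] (P : Source X)
    (Q : Reproduction W X Y) (t : ℕ) :
    (jointLaw μ P (outputRep μ P Q) t).map (fun a => (a.1, a.2.2)) =
      (jointLaw μ P Q t).map (fun a => (a.1, a.2.2)) := by
  refine Measure.ext_of_lintegral _ fun f hf => ?_
  rw [lintegral_map hf (by fun_prop), lintegral_jointLaw_outputRep μ P Q t (by fun_prop)]
  simp

theorem info_outputRep [∀ t, StandardBorelSpace (X t)] (μ : Measure W)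
    [IsProbabilityMeasure μ] (P : Source X) (Q : Reproduction W X Y) (t : ℕ) :
    info μ P ((outputRep μ P Q).causal t) = 0 := by
  have h := info_le_klDiv_jointLaw μ P Q (outputRep μ P Q) t
  rwa [klDiv_self, nonpos_iff_eq_zero] at h

end output

end laws

section mixtures

open InformationTheory

variable {W : Type w} {X : ℕ → Type u} {Y : ℕ → Type v} [MeasurableSpace W]
  [∀ t, MeasurableSpace (X t)] [∀ t, MeasurableSpace (Y t)]

theorem mix_apply {α β : Type*} [MeasurableSpace α] [MeasurableSpace β] (ε : ℝ)
    (K L : Kernel α β) (a : α) :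
    mix ε K L a = ENNReal.ofReal (1 - ε) • K a + ENNReal.ofReal ε • L a := rfl

theorem mix_zero {α β : Type*} [MeasurableSpace α] [MeasurableSpace β] (K L : Kernel α β) :
    mix 0 K L = K := by
  ext a : 1
  simp [mix_apply]

theorem isMarkovKernel_mix {α β : Type*} [MeasurableSpace α] [MeasurableSpace β] {ε : ℝ}
    (h0 : 0 ≤ ε) (h1 : ε ≤ 1) (K L : Kernel α β) [IsMarkovKernel K] [IsMarkovKernel L] :
    IsMarkovKernel (mix ε K L) := by
  refine ⟨fun a => ⟨?_⟩⟩
  simp only [mix_apply, Measure.coe_add, Measure.coe_smul, Pi.add_apply, Pi.smul_apply,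
    measure_univ, smul_eq_mul, mul_one]
  rw [← ENNReal.ofReal_add (by linarith) h0]
  simp

theorem compProd_jointKernel_mix (μ : Measure W) [IsProbabilityMeasure μ] (P : Source X) {N : ℕ}
    {ε : ℝ} (h0 : 0 ≤ ε) (h1 : ε ≤ 1) (K L : Kernel (W × Hist X N) (Hist Y N))
    [IsMarkovKernel K] [IsMarkovKernel L] :
    μ ⊗ₘ jointKernel P (mix ε K L) = ENNReal.ofReal (1 - ε) • (μ ⊗ₘ jointKernel P K) +
      ENNReal.ofReal ε • (μ ⊗ₘ jointKernel P L) := by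
  have := isMarkovKernel_mix h0 h1 K L
  refine Measure.ext_of_lintegral _ fun f hf => ?_
  have hm : ∀ K : Kernel (W × Hist X N) (Hist Y N), ∀ [IsMarkovKernel K],
      Measurable fun a : W × Hist X N => ∫⁻ y, f (a.1, (a.2, y)) ∂K a := fun K _ =>
    Measurable.lintegral_kernel_prod_right' (κ := K) (f := fun q => f (q.1.1, (q.1.2, q.2)))
      (by fun_prop)
  rw [lintegral_add_measure, lintegral_smul_measure, lintegral_smul_measure,
    lintegral_compProd_jointKernel μ P _ hf, lintegral_compProd_jointKernel μ P _ hf,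
    lintegral_compProd_jointKernel μ P _ hf, smul_eq_mul, smul_eq_mul,
    ← lintegral_const_mul _ (hm K).lintegral_prod_right',
    ← lintegral_const_mul _ (hm L).lintegral_prod_right',
    ← lintegral_add_left ((hm K).lintegral_prod_right'.const_mul _)]
  refine lintegral_congr fun w => ?_
  have hw : ∀ K : Kernel (W × Hist X N) (Hist Y N), ∀ [IsMarkovKernel K],
      Measurable fun x : Hist X N => ∫⁻ y, f (w, (x, y)) ∂K (w, x) := fun K _ =>
    (hm K).comp measurable_prodMk_left
  rw [← lintegral_const_mul _ (hw K), ← lintegral_const_mul _ (hw L),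
    ← lintegral_add_left ((hw K).const_mul _)]
  refine lintegral_congr fun x => ?_
  simp only [mix_apply]
  rw [lintegral_add_measure, lintegral_smul_measure, lintegral_smul_measure, smul_eq_mul,
    smul_eq_mul]

/-- A family of Markov kernels that is consistent under forgetting the last coordinate is the
family of causal kernels of a reproduction. -/
theorem exists_reproduction_of_consistent [∀ t, StandardBorelSpace (Y t)] [∀ t, Nonempty (Y t)]
    (K : ∀ t, Kernel (W × Hist X t) (Hist Y t)) [∀ t, IsMarkovKernel (K t)]
    (hK : ∀ t (w : W) (x : Hist X (t + 1)),
      (K (t + 1) (w, x)).map Hist.init = K t (w, x.init)) :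
    ∃ Q : Reproduction W X Y, ∀ t, Q.causal t = K t := by
  let K' : ∀ t, Kernel (W × Hist X (t + 1)) (Hist Y t × Y t) := fun t => K (t + 1)
  have hK' : ∀ t, IsMarkovKernel (K' t) := fun t => inferInstanceAs (IsMarkovKernel (K (t + 1)))
  let Q : Reproduction W X Y :=
    { kernel := fun t => (K' t).condKernel.comap
        (fun p : (W × Hist Y t) × Hist X (t + 1) => ((p.1.1, p.2), p.1.2)) (by fun_prop)
      markov := fun t => inferInstance }
  refine ⟨Q, fun t => ?_⟩
  induction t with
  | zero =>
    ext a : 1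
    have h : ∀ M N : Measure PUnit.{v + 1}, ∀ [IsProbabilityMeasure M] [IsProbabilityMeasure N],
        M = N := fun M N _ _ => by
      refine Measure.ext fun s _ => ?_
      rcases s.eq_empty_or_nonempty with rfl | hs
      · simp
      · rw [hs.eq_univ]; simp
    exact @h (Q.causal 0 a) (K 0 a) (inferInstance : IsProbabilityMeasure (Q.causal 0 a))
      (inferInstance : IsProbabilityMeasure (K 0 a))
  | succ t ih =>
    have hd : (K' t).fst ⊗ₖ (K' t).condKernel = K' t := (K' t).disintegrate _
    have hf : (K' t).fst = (Q.causal t).comap (fun a : W × Hist X (t + 1) => (a.1, a.2.init))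
        (measurable_fst.prodMk (Hist.measurable_init.comp measurable_snd)) := by
      ext a : 1
      rw [ih, Kernel.fst_apply, Kernel.comap_apply]
      exact hK t a.1 a.2
    refine Eq.trans ?_ hd
    rw [hf]
    rfl

theorem Reproduction.causal_succ_map_init (Q : Reproduction W X Y) (t : ℕ) (w : W)
    (x : Hist X (t + 1)) : (Q.causal (t + 1) (w, x)).map Hist.init = Q.causal t (w, x.init) := by
  refine Measure.ext_of_lintegral _ fun f hf => ?_
  rw [lintegral_map hf (by fun_prop), Q.lintegral_causal_succ t w x (by fun_prop)]
  simp [Hist.init_snoc]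

theorem exists_reproduction_mix [∀ t, StandardBorelSpace (Y t)] [∀ t, Nonempty (Y t)]
    {ε : ℝ} (h0 : 0 ≤ ε) (h1 : ε ≤ 1) (Q₁ Q₂ : Reproduction W X Y) :
    ∃ Q : Reproduction W X Y, ∀ t, Q.causal t = mix ε (Q₁.causal t) (Q₂.causal t) := by
  have : ∀ t, IsMarkovKernel (mix ε (Q₁.causal t) (Q₂.causal t)) := fun t =>
    isMarkovKernel_mix h0 h1 _ _
  refine exists_reproduction_of_consistent _ fun t w x => ?_
  rw [mix_apply, mix_apply, Measure.map_add _ _ (by fun_prop), Measure.map_smul, Measure.map_smul,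
    Q₁.causal_succ_map_init, Q₂.causal_succ_map_init]

theorem klDiv_smul_same' {α : Type*} [MeasurableSpace α] (M N : Measure α) [IsFiniteMeasure M]
    [IsFiniteMeasure N] {c : ℝ} (hc : 0 ≤ c) :
    klDiv (ENNReal.ofReal c • M) (ENNReal.ofReal c • N) = ENNReal.ofReal c * klDiv M N := by
  lift c to ℝ≥0 using hc
  simpa using klDiv_smul_same (μ := M) (ν := N) c

/-- Convexity of `info`. -/
theorem info_mix_le (μ : Measure W) [IsProbabilityMeasure μ] (P : Source X) {N : ℕ}
    {ε : ℝ} (h0 : 0 ≤ ε) (h1 : ε ≤ 1) (K L : Kernel (W × Hist X N) (Hist Y N))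
    [IsMarkovKernel K] [IsMarkovKernel L] :
    info μ P (mix ε K L) ≤ ENNReal.ofReal (1 - ε) * info μ P K + ENNReal.ofReal ε * info μ P L := by
  have := isMarkovKernel_mix h0 h1 K L
  have hprod : μ ⊗ₘ productKernel P (mix ε K L) = ENNReal.ofReal (1 - ε) •
      (μ ⊗ₘ productKernel P K) + ENNReal.ofReal ε • (μ ⊗ₘ productKernel P L) := by
    refine Measure.ext_of_lintegral _ fun f hf => ?_
    have hm : ∀ M : Measure (W × Hist Y N), ∀ [SFinite M],
        Measurable fun x : Hist X N => ∫⁻ q, f (q.1, (x, q.2)) ∂M := fun M _ =>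
      Measurable.lintegral_prod_right' (f := fun r : Hist X N × (W × Hist Y N) =>
        f (r.2.1, (r.1, r.2.2))) (by fun_prop)
    rw [lintegral_add_measure, lintegral_smul_measure, lintegral_smul_measure,
      lintegral_compProd_productKernel μ P _ hf, lintegral_compProd_productKernel μ P _ hf,
      lintegral_compProd_productKernel μ P _ hf, compProd_jointKernel_mix μ P h0 h1,
      Measure.map_add _ _ (by fun_prop), Measure.map_smul, Measure.map_smul]
    simp only [lintegral_add_measure, lintegral_smul_measure, smul_eq_mul]
    rw [lintegral_add_left ((hm _).const_mul _), lintegral_const_mul _ (hm _),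
      lintegral_const_mul _ (hm _)]
  have i : ∀ (c : ℝ) (M : Measure (W × (Hist X N × Hist Y N))), ∀ [IsFiniteMeasure M],
    IsFiniteMeasure (ENNReal.ofReal c • M) := fun c M _ => Measure.smul_finite _ (by simp)
  have i1 := i (1 - ε) (μ ⊗ₘ jointKernel P K)
  have i2 := i ε (μ ⊗ₘ jointKernel P L)
  have i3 := i (1 - ε) (μ ⊗ₘ productKernel P K)
  have i4 := i ε (μ ⊗ₘ productKernel P L)
  unfold info
  rw [compProd_jointKernel_mix μ P h0 h1, hprod]
  refine (klDiv_add_le _ _ _ _).trans_eq ?_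
  rw [klDiv_smul_same' _ _ (by linarith), klDiv_smul_same' _ _ h0]

theorem outputRep_boundedDensity [∀ t, StandardBorelSpace (Y t)] [∀ t, Nonempty (Y t)]
    (μ : Measure W) [IsProbabilityMeasure μ] (P : Source X) (Q : Reproduction W X Y) (N : ℕ) :
    BoundedDensity μ P (Q.causal N) ((outputRep μ P Q).causal N) := by
  refine ⟨1, ?_⟩
  have key : (μ.prod (P.law N)) ⊗ₘ (outputRep μ P Q).causal N =
      (μ.prod (P.law N)) ⊗ₘ (outputLaw P (Q.causal N)).comap Prod.fst measurable_fst := by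
    refine Measure.ext_of_lintegral _ fun f hf => ?_
    have hm : ∀ K : Kernel (W × Hist X N) (Hist Y N), ∀ [IsMarkovKernel K],
        ∫⁻ q, f q ∂((μ.prod (P.law N)) ⊗ₘ K) =
          ∫⁻ w, ∫⁻ x, ∫⁻ y, f ((w, x), y) ∂K (w, x) ∂P.law N ∂μ := fun K _ => by
      rw [Measure.lintegral_compProd hf, lintegral_prod]
      exact (Measurable.lintegral_kernel_prod_right' (κ := K) hf).aemeasurable
    have h1 := congrArg (fun m => ∫⁻ a, f ((a.1, a.2.1), a.2.2) ∂m) (jointLaw_outputRep μ P Q N)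
    rw [hm, hm]
    rw [lintegral_jointLaw μ P _ N (by fun_prop), Measure.lintegral_compProd (by fun_prop)] at h1
    refine h1.trans (lintegral_congr fun w => ?_)
    unfold productKernel
    rw [Kernel.prod_apply, lintegral_prod _ (by fun_prop), Kernel.const_apply]
    rfl
  filter_upwards [Kernel.ae_eq_of_compProd_eq key] with a ha
  rw [ha]
  simp

/-- Gâteaux differentiability at `Q` makes `info` finite at `Q`, and the product law absolutely
continuous with respect to the joint law. -/
theorem GateauxDifferentiableAt.info_ne_top_and_absolutelyContinuous
    [∀ t, StandardBorelSpace (Y t)] [∀ t, Nonempty (Y t)] {μ : Measure W} [IsProbabilityMeasure μ]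
    {P : Source X} {n : ℕ} {Q : Reproduction W X Y} (h : GateauxDifferentiableAt μ P n Q) :
    info μ P (Q.causal (n + 1)) ≠ ∞ ∧
      jointLaw μ P (outputRep μ P Q) (n + 1) ≪ jointLaw μ P Q (n + 1) := by
  obtain ⟨hfin, δ, hδ⟩ := h _ (outputRep_boundedDensity μ P Q (n + 1))
  have hI : info μ P (Q.causal (n + 1)) ≠ ∞ := by
    have := hfin.self_of_nhdsWithin (Set.mem_Ici.mpr le_rfl)
    rwa [mix_zero] at this
  refine ⟨hI, absolutelyContinuous_of_klDiv_segment (δ := δ) ?_ ?_⟩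
  · rwa [← info_eq_klDiv_jointLaw]
  · refine hδ.congr' ?_
    filter_upwards [Ioo_mem_nhdsGT (one_pos : (0 : ℝ) < 1)] with ε hε
    have i := isMarkovKernel_mix hε.1.le hε.2.le (Q.causal (n + 1))
      ((outputRep μ P Q).causal (n + 1))
    have hmap : (μ ⊗ₘ jointKernel P (mix ε (Q.causal (n + 1))
        ((outputRep μ P Q).causal (n + 1)))).map (fun a => (a.1, a.2.2)) =
        (μ ⊗ₘ jointKernel P (Q.causal (n + 1))).map (fun a => (a.1, a.2.2)) := by
      rw [compProd_jointKernel_mix μ P hε.1.le hε.2.le, Measure.map_add _ _ (by fun_prop),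
        Measure.map_smul, Measure.map_smul]
      have := jointLaw_outputRep_map_output μ P Q (n + 1)
      unfold jointLaw at this
      rw [this, ← add_smul, ← ENNReal.ofReal_add (by linarith [hε.2]) hε.1.le]
      simp
    rw [info_eq_klDiv_jointLaw]
    unfold info
    rw [compProd_productKernel_congr μ P _ _ hmap, ← jointLaw_outputRep,
      compProd_jointKernel_mix μ P hε.1.le hε.2.le]
    rfl

end mixtures

section multiplier

variable {W : Type w} {X : ℕ → Type u} {Y : ℕ → Type v} [MeasurableSpace W]
  [∀ t, MeasurableSpace (X t)] [∀ t, MeasurableSpace (Y t)]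

@[fun_prop]
theorem Distortion.measurable_total (d : Distortion X Y) (t : ℕ) :
    Measurable fun q : Hist X t × Hist Y t => d.total t q.1 q.2 := by
  induction t with
  | zero => exact measurable_const
  | succ t ih =>
    exact (ih.comp (by fun_prop : Measurable fun q : Hist X (t + 1) × Hist Y (t + 1) =>
      (q.1.init, q.2.init))).add (d.measurable t)

theorem feasible_iff {μ : Measure W} {P : Source X} {d : Distortion X Y} {n : ℕ} {D : ℝ≥0}
    {Q : Reproduction W X Y} :
    Feasible μ P d n D Q ↔ expectedDistortion μ P d n Q ≤ ((n : ℝ≥0∞) + 1) * D := by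
  unfold Feasible
  rw [mul_comm, ← div_eq_mul_inv, ENNReal.div_le_iff' (by simp) (by simp)]

theorem nrdf_le_info {μ : Measure W} {P : Source X} {d : Distortion X Y} {n : ℕ} {D : ℝ≥0}
    {Q : Reproduction W X Y} (h : expectedDistortion μ P d n Q ≤ ((n : ℝ≥0∞) + 1) * D) :
    nrdf μ P d n D ≤ info μ P (Q.causal (n + 1)) :=
  iInf₂_le Q (feasible_iff.mpr h)

theorem expectedDistortion_mix {μ : Measure W} [IsProbabilityMeasure μ] {P : Source X}
    {d : Distortion X Y} {n : ℕ} {ε : ℝ} (h0 : 0 ≤ ε) (h1 : ε ≤ 1) {Q Q₁ Q₂ : Reproduction W X Y}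
    (h : Q.causal (n + 1) = mix ε (Q₁.causal (n + 1)) (Q₂.causal (n + 1))) :
    expectedDistortion μ P d n Q = ENNReal.ofReal (1 - ε) * expectedDistortion μ P d n Q₁ +
      ENNReal.ofReal ε * expectedDistortion μ P d n Q₂ := by
  unfold expectedDistortion jointLaw
  rw [h, compProd_jointKernel_mix μ P h0 h1, lintegral_add_measure, lintegral_smul_measure,
    lintegral_smul_measure, smul_eq_mul, smul_eq_mul]

/-- A point that strictly satisfies the constraint, together with a point of finite distortion
whose information is below the optimum, yields a Lagrange multiplier. -/
theorem exists_isLagrangeMultiplier [∀ t, StandardBorelSpace (Y t)] [∀ t, Nonempty (Y t)]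
    (μ : Measure W) [IsProbabilityMeasure μ] (P : Source X) (d : Distortion X Y) (n : ℕ)
    (D : ℝ≥0) (hR : nrdf (W := W) μ P d n D ≠ ∞) {Q₀ Q₁ : Reproduction W X Y}
    (h₀ : expectedDistortion μ P d n Q₀ < ((n : ℝ≥0∞) + 1) * D)
    (hI₀ : info μ P (Q₀.causal (n + 1)) ≠ ∞)
    (h₁ : expectedDistortion μ P d n Q₁ ≠ ∞)
    (hI₁ : info μ P (Q₁.causal (n + 1)) < nrdf (W := W) μ P d n D) :
    ∃ s, IsLagrangeMultiplier (W := W) (X := X) (Y := Y) μ P d n D s := by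
  set B : ℝ := ((n : ℝ) + 1) * D with hB
  have hBE : ((n : ℝ≥0∞) + 1) * D = ENNReal.ofReal B := by
    rw [hB, ENNReal.ofReal_mul (by positivity), ENNReal.ofReal_add (by positivity) (by positivity)]
    simp
  have hB0 : 0 ≤ B := by positivity
  rw [hBE] at h₀
  set R := (nrdf (W := W) μ P d n D).toReal with hRdef
  set E : Reproduction W X Y → ℝ := fun Q => (expectedDistortion μ P d n Q).toReal with hE
  set I : Reproduction W X Y → ℝ := fun Q => (info μ P (Q.causal (n + 1))).toReal with hI
  have hfeas : ∀ Q, expectedDistortion μ P d n Q ≠ ∞ → info μ P (Q.causal (n + 1)) ≠ ∞ →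
      E Q ≤ B → R ≤ I Q := fun Q h1 h2 h3 => by
    refine ENNReal.toReal_mono h2 (nrdf_le_info ?_)
    rw [hBE]
    exact (ENNReal.le_ofReal_iff_toReal_le h1 hB0).mpr h3
  have hcross : ∀ Qa Qb, expectedDistortion μ P d n Qa ≠ ∞ →
      info μ P (Qa.causal (n + 1)) ≠ ∞ → expectedDistortion μ P d n Qb ≠ ∞ →
      info μ P (Qb.causal (n + 1)) ≠ ∞ → E Qa < B → B < E Qb →
      (R - I Qb) / (E Qb - B) ≤ (I Qa - R) / (B - E Qa) := by
    intro Qa Qb ha ha' hb hb' hab hbb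
    set ε := (B - E Qa) / (E Qb - E Qa) with hε
    have hpos : 0 < E Qb - E Qa := by linarith
    have hε0 : 0 ≤ ε := div_nonneg (by linarith) hpos.le
    have hε1 : ε ≤ 1 := by rw [hε, div_le_one hpos]; linarith
    have hεm : ε * (E Qb - E Qa) = B - E Qa := div_mul_cancel₀ _ hpos.ne'
    obtain ⟨Q, hQ⟩ := exists_reproduction_mix hε0 hε1 Qa Qb
    have hd := expectedDistortion_mix (μ := μ) (P := P) (d := d) hε0 hε1 (hQ (n + 1))
    have hi := info_mix_le μ P hε0 hε1 (Qa.causal (n + 1)) (Qb.causal (n + 1))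
    rw [← hQ] at hi
    have hdne : expectedDistortion μ P d n Q ≠ ∞ := by rw [hd]; finiteness
    have hine : info μ P (Q.causal (n + 1)) ≠ ∞ := ne_top_of_le_ne_top (by finiteness) hi
    have hd' : E Q = (1 - ε) * E Qa + ε * E Qb := by
      simp only [hE]
      rw [hd, ENNReal.toReal_add (by finiteness) (by finiteness), ENNReal.toReal_mul,
        ENNReal.toReal_mul, ENNReal.toReal_ofReal (by linarith), ENNReal.toReal_ofReal hε0]
    have hi' : I Q ≤ (1 - ε) * I Qa + ε * I Qb := by
      have := ENNReal.toReal_mono (by finiteness) hi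
      rwa [ENNReal.toReal_add (by finiteness) (by finiteness), ENNReal.toReal_mul,
        ENNReal.toReal_mul, ENNReal.toReal_ofReal (by linarith), ENNReal.toReal_ofReal hε0] at this
    have hRQ := (hfeas Q hdne hine (by rw [hd']; linarith)).trans hi'
    rw [div_le_div_iff₀ (by linarith) (by linarith)]
    have := mul_le_mul_of_nonneg_right hRQ hpos.le
    have e1 : ((1 - ε) * I Qa + ε * I Qb) * (E Qb - E Qa) =
        (E Qb - B) * I Qa + (B - E Qa) * I Qb := by
      linear_combination (I Qb - I Qa) * hεm
    rw [e1] at this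
    linarith
  have hE₀ : expectedDistortion μ P d n Q₀ ≠ ∞ := (h₀.trans_le le_top).ne
  have hE₀B : E Q₀ < B := by
    rw [hE]; exact (ENNReal.lt_ofReal_iff_toReal_lt hE₀).mp h₀
  have hI₁' : info μ P (Q₁.causal (n + 1)) ≠ ∞ := (hI₁.trans_le le_top).ne
  have hI₁R : I Q₁ < R := (ENNReal.toReal_lt_toReal hI₁' hR).mpr hI₁
  have hE₁B : B < E Q₁ := by
    by_contra hcon
    exact absurd (hfeas Q₁ h₁ hI₁' (not_lt.mp hcon)) (not_le.mpr hI₁R)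
  set U : Set ℝ := {r | ∃ Q, expectedDistortion μ P d n Q ≠ ∞ ∧
    info μ P (Q.causal (n + 1)) ≠ ∞ ∧ E Q < B ∧ r = (I Q - R) / (B - E Q)} with hU
  have hUne : U.Nonempty := ⟨_, Q₀, hE₀, hI₀, hE₀B, rfl⟩
  have hUbdd : BddBelow U := by
    refine ⟨0, ?_⟩
    rintro r ⟨Q, h1, h2, h3, rfl⟩
    exact div_nonneg (sub_nonneg.mpr (hfeas Q h1 h2 h3.le)) (by linarith)
  have hlow : ∀ Q, expectedDistortion μ P d n Q ≠ ∞ → info μ P (Q.causal (n + 1)) ≠ ∞ →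
      B < E Q → (R - I Q) / (E Q - B) ≤ sInf U := fun Q h1 h2 h3 => by
    refine le_csInf hUne ?_
    rintro r ⟨Q', h1', h2', h3', rfl⟩
    exact hcross Q' Q h1' h2' h1 h2 h3' h3
  have hpos : 0 < sInf U := lt_of_lt_of_le (div_pos (by linarith) (by linarith))
    (hlow Q₁ h₁ hI₁' hE₁B)
  refine ⟨-sInf U, by linarith, fun Q => ?_⟩
  rw [neg_neg, hBE]
  by_cases hi : info μ P (Q.causal (n + 1)) = ∞
  · rw [hi, top_add]; exact le_top
  by_cases he : expectedDistortion μ P d n Q = ∞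
  · rw [he, ENNReal.mul_top (by simpa using hpos), add_top]; exact le_top
  have key : R + sInf U * B ≤ I Q + sInf U * E Q := by
    rcases lt_trichotomy (E Q) B with h | h | h
    · have := csInf_le hUbdd ⟨Q, he, hi, h, rfl⟩
      rw [le_div_iff₀ (by linarith)] at this
      linarith
    · have := hfeas Q he hi h.le
      rw [h]; linarith
    · have := hlow Q he hi h
      rw [div_le_iff₀ (by linarith)] at this
      linarith
  rw [← ENNReal.ofReal_toReal hR, ← ENNReal.ofReal_toReal hi, ← ENNReal.ofReal_toReal he,
    ← ENNReal.ofReal_mul hpos.le, ← ENNReal.ofReal_mul hpos.le, ← ENNReal.ofReal_add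
    ENNReal.toReal_nonneg (by positivity), ← ENNReal.ofReal_add ENNReal.toReal_nonneg
    (by positivity)]
  exact ENNReal.ofReal_le_ofReal key

end multiplier

section slater

open InformationTheory

variable {W : Type w} {X : ℕ → Type u} {Y : ℕ → Type v} [MeasurableSpace W]
  [∀ t, MeasurableSpace (X t)] [∀ t, MeasurableSpace (Y t)]

/-- Replace the kernel of a reproduction at one time. -/
def Reproduction.update (Q : Reproduction W X Y) (t : ℕ)
    (κ : Kernel ((W × Hist Y t) × Hist X (t + 1)) (Y t)) [IsMarkovKernel κ] :
    Reproduction W X Y where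
  kernel := Function.update Q.kernel t κ
  markov s := by
    rcases eq_or_ne s t with rfl | h
    · rwa [Function.update_self]
    · rw [Function.update_of_ne h]; infer_instance

theorem Reproduction.update_kernel_self (Q : Reproduction W X Y) (t : ℕ)
    (κ : Kernel ((W × Hist Y t) × Hist X (t + 1)) (Y t)) [IsMarkovKernel κ] :
    (Q.update t κ).kernel t = κ := Function.update_self ..

theorem Reproduction.update_kernel_of_ne (Q : Reproduction W X Y) {s t : ℕ} (h : s ≠ t)
    (κ : Kernel ((W × Hist Y t) × Hist X (t + 1)) (Y t)) [IsMarkovKernel κ] :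
    (Q.update t κ).kernel s = Q.kernel s := Function.update_of_ne h ..

theorem jointLaw_congr_of_kernel_eq (μ : Measure W) [IsProbabilityMeasure μ] (P : Source X)
    {Q Q' : Reproduction W X Y} {t : ℕ} (h : ∀ s < t, Q.kernel s = Q'.kernel s) :
    jointLaw μ P Q t = jointLaw μ P Q' t := by
  induction t with
  | zero => exact jointLaw_zero_eq μ P Q Q'
  | succ t ih =>
    rw [jointLaw_succ, jointLaw_succ, h t t.lt_succ_self,
      pastLaw_congr (ih fun s hs => h s (hs.trans t.lt_succ_self))]

/-- A one-step modification with density at most `2` at most doubles the joint law. -/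
theorem jointLaw_update_le (μ : Measure W) [IsProbabilityMeasure μ] (P : Source X)
    (Q : Reproduction W X Y) (t : ℕ)
    (κ : Kernel ((W × Hist Y t) × Hist X (t + 1)) (Y t)) [IsMarkovKernel κ]
    (hκ : ∀ p, κ p ≤ (2 : ℝ≥0∞) • Q.kernel t p) (s : ℕ) :
    jointLaw μ P (Q.update t κ) s ≤ (2 : ℝ≥0∞) • jointLaw μ P Q s := by
  have hle : ∀ s ≤ t, jointLaw μ P (Q.update t κ) s = jointLaw μ P Q s := fun s hs =>
    jointLaw_congr_of_kernel_eq μ P fun r hr =>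
      Q.update_kernel_of_ne (hr.trans_le hs).ne κ
  have key : ∀ s, ∀ f : W × (Hist X s × Hist Y s) → ℝ≥0∞, Measurable f →
      ∫⁻ a, f a ∂jointLaw μ P (Q.update t κ) s ≤ 2 * ∫⁻ a, f a ∂jointLaw μ P Q s := by
    intro s
    induction s with
    | zero =>
      intro f _
      rw [hle 0 t.zero_le]
      exact le_mul_of_one_le_left' (by norm_num)
    | succ s ih =>
      intro f hf
      have hm : ∀ Q : Reproduction W X Y, Measurable fun p : (W × Hist Y s) × Hist X (s + 1) =>
          ∫⁻ y, f (p.1.1, (p.2, p.1.2.snoc y)) ∂Q.kernel s p := fun Q =>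
        Measurable.lintegral_kernel_prod_right' (κ := Q.kernel s)
          (f := fun q => f (q.1.1.1, (q.1.2, q.1.1.2.snoc q.2))) (by fun_prop)
      rcases lt_trichotomy s t with h | rfl | h
      · rw [hle (s + 1) h]
        exact le_mul_of_one_le_left' (by norm_num)
      · rw [lintegral_jointLaw_succ μ P _ s hf, lintegral_jointLaw_succ μ P _ s hf,
          pastLaw_congr (hle s le_rfl), ← lintegral_const_mul _ (hm Q), Q.update_kernel_self]
        refine lintegral_mono fun p => ?_
        refine (lintegral_mono' (hκ p) le_rfl).trans_eq ?_
        rw [lintegral_smul_measure, smul_eq_mul]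
      · rw [lintegral_jointLaw_succ μ P _ s hf, lintegral_jointLaw_succ μ P _ s hf,
          Q.update_kernel_of_ne h.ne', lintegral_pastLaw μ P _ s (hm Q),
          lintegral_pastLaw μ P _ s (hm Q)]
        refine ih _ ?_
        exact Measurable.lintegral_kernel_prod_right' (κ := (P.kernel s).comap
          (fun a : W × (Hist X s × Hist Y s) => a.2.1) (by fun_prop))
          (f := fun q => ∫⁻ y, f (q.1.1, (q.1.2.1.snoc q.2, q.1.2.2.snoc y))
            ∂Q.kernel s ((q.1.1, q.1.2.2), q.1.2.1.snoc q.2))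
          ((hm Q).comp (pastEquiv s).measurable)
  refine Measure.le_iff.mpr fun A hA => ?_
  have := key s (A.indicator 1) (measurable_one.indicator hA)
  rwa [lintegral_indicator_one hA, lintegral_indicator_one hA] at this

/-- The conditional expectation of the total distortion up to time `t + k` given the history
before time `t`. -/
def costToGo (P : Source X) (d : Distortion X Y) (Q : Reproduction W X Y) :
    ∀ _k t : ℕ, W × (Hist X t × Hist Y t) → ℝ≥0∞
  | 0, t => fun a => d.total t a.2.1 a.2.2
  | k + 1, t => fun a => ∫⁻ x', ∫⁻ y, costToGo P d Q k (t + 1) (a.1, (a.2.1.snoc x', a.2.2.snoc y))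
      ∂Q.kernel t ((a.1, a.2.2), a.2.1.snoc x') ∂P.kernel t a.2.1

/-- The conditional expectation of the total distortion given the history before `y_t` is drawn. -/
def costAfterSource (P : Source X) (d : Distortion X Y) (Q : Reproduction W X Y) (k t : ℕ)
    (p : (W × Hist Y t) × Hist X (t + 1)) : ℝ≥0∞ :=
  ∫⁻ y, costToGo P d Q k (t + 1) (p.1.1, (p.2, p.1.2.snoc y)) ∂Q.kernel t p

theorem measurable_costToGo (P : Source X) (d : Distortion X Y) (Q : Reproduction W X Y)
    (k t : ℕ) : Measurable (costToGo P d Q k t) := by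
  induction k generalizing t with
  | zero => exact (d.measurable_total t).comp measurable_snd
  | succ k ih =>
    have hm : Measurable fun p : (W × Hist Y t) × Hist X (t + 1) =>
        ∫⁻ y, costToGo P d Q k (t + 1) (p.1.1, (p.2, p.1.2.snoc y)) ∂Q.kernel t p :=
      Measurable.lintegral_kernel_prod_right' (κ := Q.kernel t)
        (f := fun q => costToGo P d Q k (t + 1) (q.1.1.1, (q.1.2, q.1.1.2.snoc q.2)))
        ((ih (t + 1)).comp (joinEquiv t).measurable)
    exact Measurable.lintegral_kernel_prod_right' (κ := (P.kernel t).comap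
      (fun a : W × (Hist X t × Hist Y t) => a.2.1) (by fun_prop))
      (f := fun q => ∫⁻ y, costToGo P d Q k (t + 1) (q.1.1, (q.1.2.1.snoc q.2, q.1.2.2.snoc y))
        ∂Q.kernel t ((q.1.1, q.1.2.2), q.1.2.1.snoc q.2))
      (hm.comp (pastEquiv t).measurable)

theorem measurable_costAfterSource (P : Source X) (d : Distortion X Y) (Q : Reproduction W X Y)
    (k t : ℕ) : Measurable (costAfterSource P d Q k t) :=
  Measurable.lintegral_kernel_prod_right' (κ := Q.kernel t)
    (f := fun q => costToGo P d Q k (t + 1) (q.1.1.1, (q.1.2, q.1.1.2.snoc q.2)))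
    ((measurable_costToGo P d Q k (t + 1)).comp (joinEquiv t).measurable)

theorem lintegral_costAfterSource (μ : Measure W) [IsProbabilityMeasure μ] (P : Source X)
    (d : Distortion X Y) (Q Q' : Reproduction W X Y) (k t : ℕ) :
    ∫⁻ p, costAfterSource P d Q k t p ∂pastLaw μ P Q' t =
      ∫⁻ a, costToGo P d Q (k + 1) t a ∂jointLaw μ P Q' t :=
  lintegral_pastLaw μ P Q' t (measurable_costAfterSource P d Q k t)

theorem lintegral_costToGo_succ (μ : Measure W) [IsProbabilityMeasure μ] (P : Source X)
    (d : Distortion X Y) (Q : Reproduction W X Y) (k t : ℕ) :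
    ∫⁻ a, costToGo P d Q (k + 1) t a ∂jointLaw μ P Q t =
      ∫⁻ a, costToGo P d Q k (t + 1) a ∂jointLaw μ P Q (t + 1) := by
  rw [lintegral_jointLaw_succ μ P Q t (measurable_costToGo P d Q k (t + 1)),
    ← lintegral_costAfterSource]
  rfl

theorem lintegral_costToGo (μ : Measure W) [IsProbabilityMeasure μ] (P : Source X)
    (d : Distortion X Y) (Q : Reproduction W X Y) (k t : ℕ) :
    ∫⁻ a, costToGo P d Q k t a ∂jointLaw μ P Q t =
      ∫⁻ a, d.total (t + k) a.2.1 a.2.2 ∂jointLaw μ P Q (t + k) := by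
  induction k generalizing t with
  | zero => rfl
  | succ k ih =>
    rw [lintegral_costToGo_succ, ih, show t + 1 + k = t + (k + 1) by omega]

theorem costToGo_congr (P : Source X) (d : Distortion X Y) {Q Q' : Reproduction W X Y} (k t : ℕ)
    (h : ∀ s, t ≤ s → Q.kernel s = Q'.kernel s) : costToGo P d Q k t = costToGo P d Q' k t := by
  induction k generalizing t with
  | zero => rfl
  | succ k ih =>
    funext a
    simp only [costToGo]
    rw [ih (t + 1) (fun s hs => h s (by omega)), h t le_rfl]

/-- If no one-step modification decreases the expected distortion, then the conditional expected
distortion does not depend on the letter drawn. -/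
theorem costToGo_eq_costAfterSource (μ : Measure W) [IsProbabilityMeasure μ] (P : Source X)
    (d : Distortion X Y) (Q : Reproduction W X Y) (k t : ℕ)
    (hfin : ∫⁻ a, d.total (t + 1 + k) a.2.1 a.2.2 ∂jointLaw μ P Q (t + 1 + k) ≠ ∞)
    (hmin : ∀ (κ : Kernel ((W × Hist Y t) × Hist X (t + 1)) (Y t)) [IsMarkovKernel κ],
      (∀ p, κ p ≤ (2 : ℝ≥0∞) • Q.kernel t p) →
      ∫⁻ a, d.total (t + 1 + k) a.2.1 a.2.2 ∂jointLaw μ P Q (t + 1 + k) ≤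
        ∫⁻ a, d.total (t + 1 + k) a.2.1 a.2.2 ∂jointLaw μ P (Q.update t κ) (t + 1 + k)) :
    ∀ᵐ a ∂jointLaw μ P Q (t + 1), costToGo P d Q k (t + 1) a =
      costAfterSource P d Q k t ((a.1, a.2.2.init), a.2.1) := by
  set κ₀ := Q.kernel t with hκ₀
  set v : (W × Hist Y t) × Hist X (t + 1) → Y t → ℝ≥0∞ := fun p y =>
    costToGo P d Q k (t + 1) (p.1.1, (p.2, p.1.2.snoc y)) with hv
  have hvm : Measurable (Function.uncurry v) :=
    (measurable_costToGo P d Q k (t + 1)).comp (joinEquiv t).measurable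
  have hvp : ∀ p, Measurable (v p) := fun p => hvm.comp measurable_prodMk_left
  set c := costAfterSource P d Q k t with hc
  have hcm : Measurable c := measurable_costAfterSource P d Q k t
  have hcv : ∀ p, c p = ∫⁻ y, v p y ∂κ₀ p := fun p => rfl
  set A : Set (((W × Hist Y t) × Hist X (t + 1)) × Y t) := {q | v q.1 q.2 < c q.1} with hA
  have hAm : MeasurableSet A := measurableSet_lt hvm (hcm.comp measurable_fst)
  set A' : (W × Hist Y t) × Hist X (t + 1) → Set (Y t) := fun p => Prod.mk p ⁻¹' A with hA'
  have hA'm : ∀ p, MeasurableSet (A' p) := fun p => measurable_prodMk_left hAm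
  have hqm : Measurable fun p => κ₀ p (A' p) := Kernel.measurable_kernel_prodMk_left hAm
  set D : (W × Hist Y t) × Hist X (t + 1) → Y t → ℝ≥0∞ := fun p y =>
    (A' p).indicator 1 y + (1 - κ₀ p (A' p)) with hD
  have hDm : Measurable (Function.uncurry D) := by
    have h1 : Measurable (A.indicator fun _ => (1 : ℝ≥0∞)) := measurable_one.indicator hAm
    exact h1.add ((measurable_const.sub hqm).comp measurable_fst)
  have hind : ∀ p, Measurable ((A' p).indicator (1 : Y t → ℝ≥0∞)) := fun p =>
    measurable_one.indicator (hA'm p)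
  set κ := κ₀.withDensity D with hκ
  have hκp : ∀ p, κ p = (κ₀ p).withDensity (D p) := fun p => Kernel.withDensity_apply _ hDm p
  have hκmarkov : IsMarkovKernel κ := by
    refine ⟨fun p => ⟨?_⟩⟩
    rw [hκp, withDensity_apply _ MeasurableSet.univ, Measure.restrict_univ]
    simp only [hD]
    rw [lintegral_add_left (hind p), lintegral_indicator_one (hA'm p), lintegral_const,
      measure_univ, mul_one, add_tsub_cancel_of_le prob_le_one]
  have hκle : ∀ p, κ p ≤ (2 : ℝ≥0∞) • κ₀ p := fun p => by
    rw [hκp, ← withDensity_const]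
    refine withDensity_mono (ae_of_all _ fun y => ?_)
    refine (add_le_add (Set.indicator_le_self' (f := 1) (fun _ _ => zero_le) y)
      (tsub_le_self : 1 - κ₀ p (A' p) ≤ 1)).trans_eq ?_
    rw [Pi.one_apply, one_add_one_eq_two]
  have hold : ∫⁻ a, d.total (t + 1 + k) a.2.1 a.2.2 ∂jointLaw μ P Q (t + 1 + k) =
      ∫⁻ p, c p ∂pastLaw μ P Q t := by
    rw [← lintegral_costToGo, ← lintegral_costToGo_succ, ← lintegral_costAfterSource]
  set G : (W × Hist Y t) × Hist X (t + 1) → ℝ≥0∞ := fun p =>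
    (∫⁻ y in A' p, v p y ∂κ₀ p) + (1 - κ₀ p (A' p)) * c p with hG
  have hκv : ∀ p, ∫⁻ y, v p y ∂κ p = G p := fun p => by
    have hDp : Measurable (D p) := hDm.comp measurable_prodMk_left
    rw [hκp, lintegral_withDensity_eq_lintegral_mul _ hDp (hvp p)]
    simp only [hD, Pi.mul_apply, add_mul]
    rw [lintegral_add_right _ ((hvp p).const_mul _), lintegral_const_mul _ (hvp p), ← hcv]
    congr 1
    rw [← lintegral_indicator (hA'm p)]
    refine lintegral_congr fun y => ?_
    by_cases hy : y ∈ A' p <;> simp [hy]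
  have hnew : ∫⁻ a, d.total (t + 1 + k) a.2.1 a.2.2
      ∂jointLaw μ P (Q.update t κ) (t + 1 + k) = ∫⁻ p, G p ∂pastLaw μ P Q t := by
    have e1 : costToGo P d (Q.update t κ) k (t + 1) = costToGo P d Q k (t + 1) :=
      costToGo_congr P d k (t + 1) fun s hs => Q.update_kernel_of_ne (by omega) κ
    have e2 : jointLaw μ P (Q.update t κ) t = jointLaw μ P Q t :=
      jointLaw_congr_of_kernel_eq μ P fun s hs => Q.update_kernel_of_ne hs.ne κ
    rw [← lintegral_costToGo, e1, lintegral_jointLaw_succ μ P _ t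
      (measurable_costToGo P d Q k (t + 1)), pastLaw_congr e2, Q.update_kernel_self]
    exact lintegral_congr hκv
  have hmin' := hmin κ hκle
  rw [hold, hnew] at hmin'
  rw [hold] at hfin
  have hAle : ∀ p, ∫⁻ y in A' p, v p y ∂κ₀ p ≤ ∫⁻ _ in A' p, c p ∂κ₀ p := fun p =>
    setLIntegral_mono measurable_const fun y hy => le_of_lt hy
  have hsum : ∀ p, κ₀ p (A' p) * c p + (1 - κ₀ p (A' p)) * c p = c p := fun p => by
    rw [← add_mul, add_tsub_cancel_of_le prob_le_one, one_mul]
  have hconst : ∀ p, ∫⁻ _ in A' p, c p ∂κ₀ p = κ₀ p (A' p) * c p := fun p => by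
    rw [setLIntegral_const, mul_comm]
  have hGle : ∀ p, G p ≤ c p := fun p => by
    rw [← hsum p, ← hconst]
    exact add_le_add (hAle p) le_rfl
  have hGeq : G =ᵐ[pastLaw μ P Q t] c :=
    ae_eq_of_ae_le_of_lintegral_le (ae_of_all _ hGle)
      (ne_top_of_le_ne_top hfin (lintegral_mono hGle)) hcm.aemeasurable hmin'
  have hcfin : ∀ᵐ p ∂pastLaw μ P Q t, c p < ∞ := ae_lt_top hcm hfin
  have hmain : ∀ᵐ p ∂pastLaw μ P Q t, ∀ᵐ y ∂κ₀ p, v p y = c p := by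
    filter_upwards [hGeq, hcfin] with p h1 h2
    have h3 : ∫⁻ y in A' p, v p y ∂κ₀ p = κ₀ p (A' p) * c p := by
      have : ∫⁻ y in A' p, v p y ∂κ₀ p + (1 - κ₀ p (A' p)) * c p =
        κ₀ p (A' p) * c p + (1 - κ₀ p (A' p)) * c p := h1.trans (hsum p).symm
      exact (ENNReal.add_left_inj (ENNReal.mul_ne_top (by finiteness) h2.ne)).mp this
    have h4 : v p =ᵐ[(κ₀ p).restrict (A' p)] fun _ => c p := by
      refine ae_eq_of_ae_le_of_lintegral_le ?_ ?_ aemeasurable_const ?_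
      · exact (ae_restrict_iff' (hA'm p)).mpr (ae_of_all _ fun y hy => le_of_lt hy)
      · rw [h3]; finiteness
      · rw [h3, hconst]
    have h5 : ∀ᵐ y ∂κ₀ p, c p ≤ v p y := by
      filter_upwards [(ae_restrict_iff' (hA'm p)).mp h4] with y hy
      by_contra hcon
      have hyA : y ∈ A' p := not_le.mp hcon
      exact hcon (hy hyA).ge
    have h6 : (fun _ => c p) =ᵐ[κ₀ p] v p := by
      refine ae_eq_of_ae_le_of_lintegral_le h5 ?_ (hvp p).aemeasurable ?_
      · simpa using h2.ne
      · rw [← hcv]; simp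
    filter_upwards [h6] with y hy using hy.symm
  rw [jointLaw_succ]
  refine (ae_map_iff (joinEquiv t).measurable.aemeasurable (measurableSet_eq_fun
    (measurable_costToGo P d Q k (t + 1)) (hcm.comp (by fun_prop :
      Measurable fun a : W × (Hist X (t + 1) × Hist Y (t + 1)) =>
        ((a.1, a.2.2.init), a.2.1))))).mpr ?_
  refine (Measure.ae_compProd_iff ?_).mpr hmain
  exact measurableSet_eq_fun hvm (hcm.comp measurable_fst)

/-- If every causal reproduction of finite information has at least the expected distortion of
`Q`, and the product law is absolutely continuous with respect to the joint law of `Q`, then the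
output reproduction has the same expected distortion as `Q`. -/
theorem expectedDistortion_outputRep_eq [∀ t, StandardBorelSpace (X t)]
    [∀ t, StandardBorelSpace (Y t)] [∀ t, Nonempty (Y t)]
    (μ : Measure W) [IsProbabilityMeasure μ] (P : Source X) (d : Distortion X Y) (n : ℕ)
    (Q : Reproduction W X Y) (hI : info μ P (Q.causal (n + 1)) ≠ ∞)
    (hac : jointLaw μ P (outputRep μ P Q) (n + 1) ≪ jointLaw μ P Q (n + 1))
    (hfin : expectedDistortion μ P d n Q ≠ ∞)
    (hmin : ∀ Q' : Reproduction W X Y, info μ P (Q'.causal (n + 1)) ≠ ∞ →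
      expectedDistortion μ P d n Q ≤ expectedDistortion μ P d n Q') :
    expectedDistortion μ P d n (outputRep μ P Q) = expectedDistortion μ P d n Q := by
  have key : ∀ k t, t + k = n + 1 →
      ∫⁻ a, costToGo P d Q k t a ∂jointLaw μ P (outputRep μ P Q) t =
        expectedDistortion μ P d n (outputRep μ P Q) := by
    intro k
    induction k with
    | zero =>
      intro t ht
      obtain rfl : t = n + 1 := ht
      rfl
    | succ k ih =>
      intro t ht
      rw [← ih (t + 1) (by omega), ← lintegral_costAfterSource, lintegral_jointLaw_succ μ P _ t
        (measurable_costToGo P d Q k (t + 1))]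
      have hN : t + 1 + k = n + 1 := by omega
      have hae := costToGo_eq_costAfterSource μ P d Q k t (by rw [hN]; exact hfin)
        (fun κ _ hκ => by
          rw [hN]
          refine hmin _ (ne_top_of_le_ne_top ?_ (info_le_klDiv_jointLaw μ P Q _ (n + 1)))
          exact klDiv_ne_top_of_le_two_smul (jointLaw_update_le μ P Q t κ hκ (n + 1))
            (by rwa [← info_eq_klDiv_jointLaw]))
      have hae' := (jointLaw_absolutelyContinuous_of_le (by omega : t + 1 ≤ n + 1) hac).ae_le hae
      rw [jointLaw_succ] at hae'
      have hae'' := Measure.ae_ae_of_ae_compProd (ae_of_ae_map (joinEquiv t).measurable.aemeasurable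
        hae')
      refine lintegral_congr_ae ?_
      filter_upwards [hae''] with p hp
      have : ∫⁻ y, costToGo P d Q k (t + 1) (p.1.1, (p.2, p.1.2.snoc y))
          ∂(outputRep μ P Q).kernel t p =
          ∫⁻ _, costAfterSource P d Q k t p ∂(outputRep μ P Q).kernel t p :=
        lintegral_congr_ae hp
      rw [this]
      simp
  rw [← key (n + 1) 0 (by omega), jointLaw_zero_eq μ P _ Q, lintegral_costToGo, zero_add]
  rfl

end slater

section gibbsStep

open InformationTheory

/-- `exp (-c)` for `c ∈ [0, ∞]`. -/
def expNeg (c : ℝ≥0∞) : ℝ≥0∞ := EReal.exp (-(c : EReal))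

/-- `-log z` for `z ∈ [0, 1]`, with values in `[0, ∞]`. -/
def negLog (z : ℝ≥0∞) : ℝ≥0∞ := (-ENNReal.log z).toENNReal

@[fun_prop]
theorem measurable_expNeg : Measurable expNeg :=
  EReal.measurable_exp.comp (by fun_prop)

@[fun_prop]
theorem measurable_negLog : Measurable negLog :=
  measurable_ereal_toENNReal.comp (by fun_prop)

theorem expNeg_top : expNeg ∞ = 0 := by simp [expNeg]

theorem expNeg_zero : expNeg 0 = 1 := by simp [expNeg]

theorem expNeg_of_ne_top {c : ℝ≥0∞} (hc : c ≠ ∞) :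
    expNeg c = ENNReal.ofReal (Real.exp (-c.toReal)) := by
  lift c to ℝ≥0 using hc
  rw [expNeg, ENNReal.coe_toReal, ← EReal.exp_coe]
  rfl

theorem expNeg_antitone : Antitone expNeg := fun a b h => by
  exact EReal.exp_monotone (EReal.neg_le_neg_iff.mpr (EReal.coe_ennreal_le_coe_ennreal_iff.mpr h))

theorem expNeg_le_one (c : ℝ≥0∞) : expNeg c ≤ 1 := by
  rw [← expNeg_zero]; exact expNeg_antitone zero_le

theorem expNeg_eq_zero_iff {c : ℝ≥0∞} : expNeg c = 0 ↔ c = ∞ := by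
  simp [expNeg]

theorem negLog_antitone : Antitone negLog := fun a b h => by
  exact EReal.toENNReal_le_toENNReal (EReal.neg_le_neg_iff.mpr (ENNReal.log_monotone h))

theorem negLog_one : negLog 1 = 0 := by simp [negLog]

theorem negLog_eq_top_iff {z : ℝ≥0∞} : negLog z = ∞ ↔ z = 0 := by
  simp [negLog]

theorem negLog_of_ne_zero {z : ℝ≥0∞} (h0 : z ≠ 0) (h1 : z ≤ 1) :
    (negLog z).toReal = -Real.log z.toReal := by
  have ht : z ≠ ∞ := ne_top_of_le_ne_top ENNReal.one_ne_top h1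
  have hz : z.toReal ≤ 1 := by
    simpa using ENNReal.toReal_mono ENNReal.one_ne_top h1
  rw [negLog, ENNReal.log_pos_real h0 ht, ← EReal.coe_neg, EReal.real_coe_toENNReal,
    ENNReal.toReal_ofReal]
  linarith [Real.log_nonpos ENNReal.toReal_nonneg hz]

theorem expNeg_negLog {z : ℝ≥0∞} (h1 : z ≤ 1) : expNeg (negLog z) = z := by
  unfold expNeg negLog
  rw [EReal.coe_toENNReal]
  · simp
  · rw [EReal.neg_nonneg]
    exact ENNReal.log_le_zero_iff.mpr h1

variable {α β : Type*} [MeasurableSpace α] [MeasurableSpace β]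

/-- The partition function of the cost `c` for the reference kernel `η`. -/
def stepPartition (η : Kernel α β) (c : α → β → ℝ≥0∞) (a : α) : ℝ≥0∞ :=
  ∫⁻ b, expNeg (c a b) ∂η a

/-- The density of the Gibbs kernel. -/
def stepDensity (η : Kernel α β) (c : α → β → ℝ≥0∞) (a : α) (b : β) : ℝ≥0∞ :=
  if stepPartition η c a = 0 then 1 else expNeg (c a b) / stepPartition η c a

/-- The Gibbs kernel of the cost `c` for the reference kernel `η` (and `η` itself where the
partition function vanishes). -/
def stepGibbs (η : Kernel α β) [IsMarkovKernel η] (c : α → β → ℝ≥0∞) : Kernel α β :=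
  η.withDensity (stepDensity η c)

theorem stepPartition_le_one (η : Kernel α β) [IsMarkovKernel η] (c : α → β → ℝ≥0∞) (a : α) :
    stepPartition η c a ≤ 1 :=
  (lintegral_mono fun _ => expNeg_le_one _).trans (by simp)

theorem measurable_stepPartition (η : Kernel α β) [IsMarkovKernel η] {c : α → β → ℝ≥0∞}
    (hc : Measurable (Function.uncurry c)) : Measurable (stepPartition η c) :=
  Measurable.lintegral_kernel_prod_right' (κ := η)
    (f := fun q => expNeg (Function.uncurry c q)) (by fun_prop)

theorem measurable_stepDensity (η : Kernel α β) [IsMarkovKernel η] {c : α → β → ℝ≥0∞}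
    (hc : Measurable (Function.uncurry c)) : Measurable (Function.uncurry (stepDensity η c)) := by
  have hZ : Measurable fun q : α × β => stepPartition η c q.1 :=
    (measurable_stepPartition η hc).comp measurable_fst
  exact Measurable.ite (hZ (measurableSet_singleton 0)) measurable_const
    ((measurable_expNeg.comp hc).div hZ)

theorem lintegral_stepDensity (η : Kernel α β) [IsMarkovKernel η] {c : α → β → ℝ≥0∞}
    (hc : Measurable (Function.uncurry c)) (a : α) : ∫⁻ b, stepDensity η c a b ∂η a = 1 := by
  unfold stepDensity
  split_ifs with h
  · simp
  · simp_rw [div_eq_mul_inv]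
    have hm : Measurable fun b => expNeg (c a b) :=
      measurable_expNeg.comp (hc.comp measurable_prodMk_left)
    rw [lintegral_mul_const _ hm]
    exact ENNReal.mul_inv_cancel h
      (ne_top_of_le_ne_top ENNReal.one_ne_top (stepPartition_le_one η c a))

theorem isMarkovKernel_stepGibbs (η : Kernel α β) [IsMarkovKernel η] {c : α → β → ℝ≥0∞}
    (hc : Measurable (Function.uncurry c)) : IsMarkovKernel (stepGibbs η c) := by
  refine ⟨fun a => ⟨?_⟩⟩
  rw [stepGibbs, Kernel.withDensity_apply _ (measurable_stepDensity η hc),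
    withDensity_apply _ MeasurableSet.univ, Measure.restrict_univ, lintegral_stepDensity η hc]

theorem klDiv_stepGibbs_aux (ν : Measure α) [IsProbabilityMeasure ν] (κ η : Kernel α β)
    [IsMarkovKernel κ] [IsMarkovKernel η] {c : α → β → ℝ≥0∞}
    (hc : Measurable (Function.uncurry c)) (hac : ν ⊗ₘ κ ≪ ν ⊗ₘ η)
    (hctop : ∀ᵐ q ∂(ν ⊗ₘ κ), c q.1 q.2 ≠ ∞) (hZ : ∀ᵐ a ∂ν, stepPartition η c a ≠ 0) :
    klDiv (ν ⊗ₘ κ) (ν ⊗ₘ η) + ∫⁻ q, c q.1 q.2 ∂(ν ⊗ₘ κ) =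
      klDiv (ν ⊗ₘ κ) (ν ⊗ₘ stepGibbs η c) + ∫⁻ a, negLog (stepPartition η c a) ∂ν := by
  have := isMarkovKernel_stepGibbs η hc
  have hZm := measurable_stepPartition η hc
  have hum := measurable_stepDensity η hc
  have hLfst : ∫⁻ q, negLog (stepPartition η c q.1) ∂(ν ⊗ₘ κ) =
      ∫⁻ a, negLog (stepPartition η c a) ∂ν := by
    rw [Measure.lintegral_compProd (by fun_prop)]
    simp
  have hZN : ∀ᵐ q ∂(ν ⊗ₘ η), stepPartition η c q.1 ≠ 0 := by
    refine (Measure.ae_compProd_iff ?_).mpr ?_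
    · exact (hZm.comp measurable_fst) (measurableSet_singleton 0).compl
    · filter_upwards [hZ] with a ha using ae_of_all _ fun _ => ha
  have hG : ν ⊗ₘ stepGibbs η c = (ν ⊗ₘ η).withDensity (fun p => stepDensity η c p.1 p.2) := by
    have : IsSFiniteKernel (η.withDensity (stepDensity η c)) :=
      inferInstanceAs (IsSFiniteKernel (stepGibbs η c))
    exact Measure.compProd_withDensity hum
  rw [hG, ← hLfst]
  refine klDiv_add_lintegral_eq (ν ⊗ₘ κ) (ν ⊗ₘ η) hac (c := fun q => c q.1 q.2) hc
    (by fun_prop) hum hctop ?_ ?_ ?_ ?_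
  · filter_upwards [hZN] with q hq
    rwa [ne_eq, negLog_eq_top_iff]
  · filter_upwards [hZN] with q hq h
    rw [stepDensity, if_neg hq, h, expNeg_top, ENNReal.zero_div]
  · filter_upwards [hZN] with q hq h
    have hZ1 := stepPartition_le_one η c q.1
    have hLne : negLog (stepPartition η c q.1) ≠ ∞ := by rwa [ne_eq, negLog_eq_top_iff]
    rw [stepDensity, if_neg hq, expNeg_of_ne_top h]
    nth_rw 1 [← expNeg_negLog hZ1]
    rw [expNeg_of_ne_top hLne, ← ENNReal.ofReal_div_of_pos (Real.exp_pos _), ← Real.exp_sub]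
    congr 2
    ring
  · refine (Measure.lintegral_compProd hum).trans ?_
    simp [lintegral_stepDensity η hc]

/-- The Gibbs variational principle for one step: the excess over the optimum is a relative
entropy. -/
theorem klDiv_add_lintegral_eq_stepGibbs (ν : Measure α) [IsProbabilityMeasure ν]
    (κ η : Kernel α β) [IsMarkovKernel κ] [IsMarkovKernel η] {c : α → β → ℝ≥0∞}
    (hc : Measurable (Function.uncurry c)) (hkl : klDiv (ν ⊗ₘ κ) (ν ⊗ₘ η) ≠ ∞)
    (hcint : ∫⁻ q, c q.1 q.2 ∂(ν ⊗ₘ κ) ≠ ∞) :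
    klDiv (ν ⊗ₘ κ) (ν ⊗ₘ η) + ∫⁻ q, c q.1 q.2 ∂(ν ⊗ₘ κ) =
      klDiv (ν ⊗ₘ κ) (ν ⊗ₘ stepGibbs η c) + ∫⁻ a, negLog (stepPartition η c a) ∂ν := by
  have hac := (klDiv_ne_top_iff.mp hkl).1
  have hctop : ∀ᵐ q ∂(ν ⊗ₘ κ), c q.1 q.2 ≠ ∞ := by
    filter_upwards [ae_lt_top hc hcint] with q hq using hq.ne
  refine klDiv_stepGibbs_aux ν κ η hc hac hctop ?_
  have hN : ∀ᵐ q ∂(ν ⊗ₘ η), stepPartition η c q.1 = 0 → c q.1 q.2 = ∞ := by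
    refine (Measure.ae_compProd_iff ?_).mpr (ae_of_all _ fun a => ?_)
    · have h1 : MeasurableSet {q : α × β | stepPartition η c q.1 = 0} :=
        ((measurable_stepPartition η hc).comp measurable_fst) (measurableSet_singleton 0)
      have h2 : MeasurableSet {q : α × β | c q.1 q.2 = ∞} := hc (measurableSet_singleton ∞)
      exact h1.imp h2
    · by_cases ha : stepPartition η c a = 0
      · have := (lintegral_eq_zero_iff (measurable_expNeg.comp
          (hc.comp measurable_prodMk_left))).mp ha
        filter_upwards [this] with b hb _
        exact expNeg_eq_zero_iff.mp hb
      · exact ae_of_all _ fun b h => absurd h ha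
  have hM : ∀ᵐ q ∂(ν ⊗ₘ κ), stepPartition η c q.1 ≠ 0 := by
    filter_upwards [hac.ae_le hN, hctop] with q h1 h2 h3 using h2 (h1 h3)
  filter_upwards [Measure.ae_ae_of_ae_compProd hM] with a ha
  exact ha.exists.choose_spec

theorem klDiv_stepGibbs_le (ν : Measure α) [IsProbabilityMeasure ν]
    (η : Kernel α β) [IsMarkovKernel η] {c : α → β → ℝ≥0∞}
    (hc : Measurable (Function.uncurry c)) :
    klDiv (ν ⊗ₘ stepGibbs η c) (ν ⊗ₘ η) + ∫⁻ q, c q.1 q.2 ∂(ν ⊗ₘ stepGibbs η c) ≤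
      ∫⁻ a, negLog (stepPartition η c a) ∂ν := by
  have := isMarkovKernel_stepGibbs η hc
  have hum := measurable_stepDensity η hc
  by_cases hL : ∫⁻ a, negLog (stepPartition η c a) ∂ν = ∞
  · rw [hL]; exact le_top
  have hZm := measurable_stepPartition η hc
  have hZ : ∀ᵐ a ∂ν, stepPartition η c a ≠ 0 := by
    filter_upwards [ae_lt_top (by fun_prop) hL] with a ha h
    exact ha.ne (negLog_eq_top_iff.mpr h)
  have hG : ν ⊗ₘ stepGibbs η c = (ν ⊗ₘ η).withDensity (fun p => stepDensity η c p.1 p.2) := by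
    have : IsSFiniteKernel (η.withDensity (stepDensity η c)) :=
      inferInstanceAs (IsSFiniteKernel (stepGibbs η c))
    exact Measure.compProd_withDensity hum
  have hac : ν ⊗ₘ stepGibbs η c ≪ ν ⊗ₘ η := by
    rw [hG]; exact withDensity_absolutelyContinuous _ _
  have hctop : ∀ᵐ q ∂(ν ⊗ₘ stepGibbs η c), c q.1 q.2 ≠ ∞ := by
    have hZN : ∀ᵐ q ∂(ν ⊗ₘ η), stepPartition η c q.1 ≠ 0 := by
      refine (Measure.ae_compProd_iff ?_).mpr ?_
      · exact (hZm.comp measurable_fst) (measurableSet_singleton 0).compl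
      · filter_upwards [hZ] with a ha using ae_of_all _ fun _ => ha
    rw [hG]
    refine (ae_withDensity_iff hum).mpr ?_
    filter_upwards [hZN] with q hq h1 h2
    refine h1 ?_
    change stepDensity η c q.1 q.2 = 0
    rw [stepDensity, if_neg hq, h2, expNeg_top, ENNReal.zero_div]
  rw [klDiv_stepGibbs_aux ν _ η hc hac hctop hZ, klDiv_self, zero_add]

end gibbsStep

section gibbs

open InformationTheory

variable {W : Type w} {X : ℕ → Type u} {Y : ℕ → Type v} [MeasurableSpace W]
  [∀ t, MeasurableSpace (X t)] [∀ t, MeasurableSpace (Y t)]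

@[fun_prop]
theorem _root_.Measurable.nrdf_extend {α : Type*} [MeasurableSpace α] {t : ℕ}
    {f : α → W × Hist Y t} {g : α → Y t} (hf : Measurable f) (hg : Measurable g) :
    Measurable fun a => extend (f a) (g a) := by
  unfold extend; fun_prop

/-- The function `g_{t,n}` with values in `[0, ∞]`, where `k = n - t`, for the reference
reproduction `R`. -/
def gibbsCost (P : Source X) (d : Distortion X Y) (R : Reproduction W X Y) (l : ℝ≥0∞) :
    ∀ _k t : ℕ, W × Hist Y (t + 1) → Hist X (t + 1) → ℝ≥0∞
  | 0, _ => fun _ _ => 0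
  | k + 1, t => fun y x => ∫⁻ x', negLog (stepPartition (R.kernel (t + 1))
      (fun p yt => l * d.rho (t + 1) p.2 (extend p.1 yt).2 +
        gibbsCost P d R l k (t + 1) (extend p.1 yt) p.2) (y, x.snoc x')) ∂P.kernel (t + 1) x

/-- The exponent `-s ρ_t + g_{t,n}`. -/
def stepCost (P : Source X) (d : Distortion X Y) (R : Reproduction W X Y) (l : ℝ≥0∞) (k t : ℕ)
    (p : (W × Hist Y t) × Hist X (t + 1)) (yt : Y t) : ℝ≥0∞ :=
  l * d.rho t p.2 (extend p.1 yt).2 + gibbsCost P d R l k t (extend p.1 yt) p.2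

/-- `-log` of the partition function at time `t`. -/
def gibbsLoss (P : Source X) (d : Distortion X Y) (R : Reproduction W X Y) (l : ℝ≥0∞) (k t : ℕ)
    (p : (W × Hist Y t) × Hist X (t + 1)) : ℝ≥0∞ :=
  negLog (stepPartition (R.kernel t) (stepCost P d R l k t) p)

theorem gibbsCost_succ (P : Source X) (d : Distortion X Y) (R : Reproduction W X Y) (l : ℝ≥0∞)
    (k t : ℕ) (y : W × Hist Y (t + 1)) (x : Hist X (t + 1)) :
    gibbsCost P d R l (k + 1) t y x =
      ∫⁻ x', gibbsLoss P d R l k (t + 1) (y, x.snoc x') ∂P.kernel (t + 1) x := rfl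

theorem measurable_stepCost_of_gibbsCost (P : Source X) (d : Distortion X Y)
    (R : Reproduction W X Y) (l : ℝ≥0∞) (k t : ℕ)
    (h : Measurable (Function.uncurry (gibbsCost P d R l k t))) :
    Measurable (Function.uncurry (stepCost P d R l k t)) := by
  refine Measurable.add (Measurable.const_mul ?_ _) ?_
  · exact (d.measurable t).comp (by fun_prop :
      Measurable fun q : ((W × Hist Y t) × Hist X (t + 1)) × Y t =>
        (q.1.2, (extend q.1.1 q.2).2))
  · exact h.comp (by fun_prop :
      Measurable fun q : ((W × Hist Y t) × Hist X (t + 1)) × Y t => (extend q.1.1 q.2, q.1.2))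

theorem measurable_gibbsCost (P : Source X) (d : Distortion X Y) (R : Reproduction W X Y)
    (l : ℝ≥0∞) (k t : ℕ) : Measurable (Function.uncurry (gibbsCost P d R l k t)) := by
  induction k generalizing t with
  | zero => exact measurable_const
  | succ k ih =>
    have h1 := measurable_stepPartition (R.kernel (t + 1))
      (measurable_stepCost_of_gibbsCost P d R l k (t + 1) (ih (t + 1)))
    exact Measurable.lintegral_kernel_prod_right' (κ := (P.kernel (t + 1)).comap
      (fun q : (W × Hist Y (t + 1)) × Hist X (t + 1) => q.2) measurable_snd)
      (f := fun r => gibbsLoss P d R l k (t + 1) (r.1.1, r.1.2.snoc r.2))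
      ((measurable_negLog.comp h1).comp (by fun_prop : Measurable
        fun r : ((W × Hist Y (t + 1)) × Hist X (t + 1)) × X (t + 1) => (r.1.1, r.1.2.snoc r.2)))

theorem measurable_stepCost (P : Source X) (d : Distortion X Y) (R : Reproduction W X Y)
    (l : ℝ≥0∞) (k t : ℕ) : Measurable (Function.uncurry (stepCost P d R l k t)) :=
  measurable_stepCost_of_gibbsCost P d R l k t (measurable_gibbsCost P d R l k t)

theorem measurable_gibbsLoss (P : Source X) (d : Distortion X Y) (R : Reproduction W X Y)
    (l : ℝ≥0∞) (k t : ℕ) : Measurable (gibbsLoss P d R l k t) :=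
  measurable_negLog.comp (measurable_stepPartition _ (measurable_stepCost P d R l k t))

/-- The reproduction that consists of the Gibbs kernels. -/
def gibbsRep (P : Source X) (d : Distortion X Y) (R : Reproduction W X Y) (l : ℝ≥0∞) (n : ℕ) :
    Reproduction W X Y where
  kernel t := stepGibbs (R.kernel t) (stepCost P d R l (n - t) t)
  markov t := isMarkovKernel_stepGibbs _ (measurable_stepCost P d R l (n - t) t)

/-- The optimal cost-to-go functional before `y_t` is drawn. -/
def energyBefore (μ : Measure W) (P : Source X) (d : Distortion X Y) (R : Reproduction W X Y)
    (l : ℝ≥0∞) (Q : Reproduction W X Y) (k t : ℕ) : ℝ≥0∞ :=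
  klDiv (jointLaw μ P Q t) (jointLaw μ P R t) +
    l * ∫⁻ a, d.total t a.2.1 a.2.2 ∂jointLaw μ P Q t +
    ∫⁻ p, gibbsLoss P d R l k t p ∂pastLaw μ P Q t

/-- The optimal cost-to-go functional after `y_t` is drawn. -/
def energyAfter (μ : Measure W) (P : Source X) (d : Distortion X Y) (R : Reproduction W X Y)
    (l : ℝ≥0∞) (Q : Reproduction W X Y) (k t : ℕ) : ℝ≥0∞ :=
  klDiv (jointLaw μ P Q (t + 1)) (jointLaw μ P R (t + 1)) +
    l * ∫⁻ a, d.total (t + 1) a.2.1 a.2.2 ∂jointLaw μ P Q (t + 1) +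
    ∫⁻ a, gibbsCost P d R l k t (a.1, a.2.2) a.2.1 ∂jointLaw μ P Q (t + 1)

variable (μ : Measure W) [IsProbabilityMeasure μ] (P : Source X) (d : Distortion X Y)
  (R : Reproduction W X Y) (l : ℝ≥0∞) (Q : Reproduction W X Y)

theorem lintegral_gibbsLoss_pastLaw (k t : ℕ) :
    ∫⁻ p, gibbsLoss P d R l k (t + 1) p ∂pastLaw μ P Q (t + 1) =
      ∫⁻ a, gibbsCost P d R l (k + 1) t (a.1, a.2.2) a.2.1 ∂jointLaw μ P Q (t + 1) :=
  lintegral_pastLaw μ P Q (t + 1) (measurable_gibbsLoss P d R l k (t + 1))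

theorem energyAfter_succ (k t : ℕ) :
    energyAfter μ P d R l Q (k + 1) t = energyBefore μ P d R l Q k (t + 1) := by
  unfold energyAfter energyBefore
  rw [lintegral_gibbsLoss_pastLaw]

theorem energyAfter_zero (n : ℕ) : energyAfter μ P d R l Q 0 n =
    klDiv (jointLaw μ P Q (n + 1)) (jointLaw μ P R (n + 1)) +
      l * expectedDistortion μ P d n Q := by
  simp [energyAfter, gibbsCost, expectedDistortion]

theorem energyBefore_zero (k : ℕ) : energyBefore μ P d R l Q k 0 =
    ∫⁻ p, gibbsLoss P d R l k 0 p ∂pastLaw μ P R 0 := by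
  unfold energyBefore
  rw [pastLaw_congr (jointLaw_zero_eq μ P Q R), jointLaw_zero_eq μ P Q R, klDiv_self]
  simp [Distortion.total]

theorem lintegral_total_succ (t : ℕ) :
    ∫⁻ a, d.total (t + 1) a.2.1 a.2.2 ∂jointLaw μ P Q (t + 1) =
      ∫⁻ a, d.total t a.2.1 a.2.2 ∂jointLaw μ P Q t +
        ∫⁻ a, d.rho t a.2.1 a.2.2 ∂jointLaw μ P Q (t + 1) := by
  have h : Measurable fun a : W × (Hist X t × Hist Y t) => d.total t a.2.1 a.2.2 :=
    (d.measurable_total t).comp measurable_snd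
  rw [← lintegral_jointLaw_succ_init μ P Q t h, ← lintegral_add_left]
  · rfl
  · exact h.comp (by fun_prop : Measurable fun a : W × (Hist X (t + 1) × Hist Y (t + 1)) =>
      (a.1, (a.2.1.init, a.2.2.init)))

theorem lintegral_stepCost (k t : ℕ) :
    ∫⁻ q, stepCost P d R l k t q.1 q.2 ∂(pastLaw μ P Q t ⊗ₘ Q.kernel t) =
      l * ∫⁻ a, d.rho t a.2.1 a.2.2 ∂jointLaw μ P Q (t + 1) +
        ∫⁻ a, gibbsCost P d R l k t (a.1, a.2.2) a.2.1 ∂jointLaw μ P Q (t + 1) := by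
  have h1 : Measurable fun a : W × (Hist X (t + 1) × Hist Y (t + 1)) => d.rho t a.2.1 a.2.2 :=
    (d.measurable t).comp measurable_snd
  have h2 : Measurable fun a : W × (Hist X (t + 1) × Hist Y (t + 1)) =>
      gibbsCost P d R l k t (a.1, a.2.2) a.2.1 :=
    (measurable_gibbsCost P d R l k t).comp (by fun_prop : Measurable
      fun a : W × (Hist X (t + 1) × Hist Y (t + 1)) => ((a.1, a.2.2), a.2.1))
  rw [← lintegral_const_mul _ h1, ← lintegral_add_left (h1.const_mul _), jointLaw_succ]
  exact (lintegral_map ((h1.const_mul l).add h2) (joinEquiv t).measurable).symm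

theorem energyAfter_eq (k t : ℕ) : energyAfter μ P d R l Q k t =
    klDiv (jointLaw μ P Q t) (jointLaw μ P R t) +
      l * ∫⁻ a, d.total t a.2.1 a.2.2 ∂jointLaw μ P Q t +
      (klDiv (pastLaw μ P Q t ⊗ₘ Q.kernel t) (pastLaw μ P Q t ⊗ₘ R.kernel t) +
        ∫⁻ q, stepCost P d R l k t q.1 q.2 ∂(pastLaw μ P Q t ⊗ₘ Q.kernel t)) := by
  unfold energyAfter
  rw [klDiv_jointLaw_succ, lintegral_total_succ, lintegral_stepCost, mul_add]
  ring

theorem energyAfter_eq_add_of_ne_top (k t : ℕ) (h : energyAfter μ P d R l Q k t ≠ ∞) :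
    energyAfter μ P d R l Q k t = energyBefore μ P d R l Q k t +
      klDiv (pastLaw μ P Q t ⊗ₘ Q.kernel t)
        (pastLaw μ P Q t ⊗ₘ stepGibbs (R.kernel t) (stepCost P d R l k t)) := by
  rw [energyAfter_eq] at h ⊢
  have h' : klDiv (pastLaw μ P Q t ⊗ₘ Q.kernel t) (pastLaw μ P Q t ⊗ₘ R.kernel t) +
    ∫⁻ q, stepCost P d R l k t q.1 q.2 ∂(pastLaw μ P Q t ⊗ₘ Q.kernel t) ≠ ∞ :=
    (ENNReal.add_ne_top.mp h).2
  rw [klDiv_add_lintegral_eq_stepGibbs _ _ _ (measurable_stepCost P d R l k t)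
    (ENNReal.add_ne_top.mp h').1 (ENNReal.add_ne_top.mp h').2]
  unfold energyBefore gibbsLoss
  ring

theorem energyAfter_gibbsRep_le (n t : ℕ) :
    energyAfter μ P d R l (gibbsRep P d R l n) (n - t) t ≤
      energyBefore μ P d R l (gibbsRep P d R l n) (n - t) t := by
  rw [energyAfter_eq]
  exact add_le_add le_rfl (klDiv_stepGibbs_le _ _ (measurable_stepCost P d R l (n - t) t))

/-- The value of the Gibbs reproduction. -/
theorem klDiv_gibbsRep_add_le (n : ℕ) :
    klDiv (jointLaw μ P (gibbsRep P d R l n) (n + 1)) (jointLaw μ P R (n + 1)) +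
      l * expectedDistortion μ P d n (gibbsRep P d R l n) ≤
      ∫⁻ p, gibbsLoss P d R l n 0 p ∂pastLaw μ P R 0 := by
  rw [← energyAfter_zero, ← energyBefore_zero μ P d R l (gibbsRep P d R l n)]
  have key : ∀ t ≤ n, energyBefore μ P d R l (gibbsRep P d R l n) (n - t) t ≤
      energyBefore μ P d R l (gibbsRep P d R l n) n 0 := by
    intro t
    induction t with
    | zero => intro _; exact le_rfl
    | succ t ih =>
      intro ht
      rw [← energyAfter_succ, show n - (t + 1) + 1 = n - t by omega]
      exact (energyAfter_gibbsRep_le μ P d R l n t).trans (ih (by omega))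
  have h := energyAfter_gibbsRep_le μ P d R l n n
  rw [Nat.sub_self] at h
  exact h.trans (by simpa using key n le_rfl)

variable {μ P d R l Q}

theorem energyAfter_le_of_optimal {n : ℕ}
    (hfin : klDiv (jointLaw μ P Q (n + 1)) (jointLaw μ P R (n + 1)) +
      l * expectedDistortion μ P d n Q ≠ ∞) {t : ℕ} (ht : t ≤ n) :
    energyAfter μ P d R l Q (n - t) t ≤ klDiv (jointLaw μ P Q (n + 1)) (jointLaw μ P R (n + 1)) +
      l * expectedDistortion μ P d n Q := by
  rw [← energyAfter_zero] at hfin ⊢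
  induction ht using Nat.decreasingInduction with
  | self => simp
  | of_succ t ht ih =>
    refine le_trans ?_ ih
    rw [energyAfter_eq_add_of_ne_top μ P d R l Q _ (t + 1) (ne_top_of_le_ne_top hfin ih),
      ← energyAfter_succ, show n - (t + 1) + 1 = n - t by omega]
    exact le_self_add

theorem le_energyBefore {n : ℕ}
    (hfin : klDiv (jointLaw μ P Q (n + 1)) (jointLaw μ P R (n + 1)) +
      l * expectedDistortion μ P d n Q ≠ ∞) {t : ℕ} (ht : t ≤ n) :
    ∫⁻ p, gibbsLoss P d R l n 0 p ∂pastLaw μ P R 0 ≤ energyBefore μ P d R l Q (n - t) t := by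
  induction t with
  | zero => rw [Nat.sub_zero, energyBefore_zero]
  | succ t ih =>
    refine (ih (by omega)).trans ?_
    rw [← energyAfter_succ, show n - (t + 1) + 1 = n - t by omega,
      energyAfter_eq_add_of_ne_top μ P d R l Q _ t (ne_top_of_le_ne_top hfin
        (energyAfter_le_of_optimal hfin (by omega)))]
    exact le_self_add

/-- A reproduction of finite energy dominates the optimal value. -/
theorem lintegral_gibbsLoss_le {n : ℕ}
    (hfin : klDiv (jointLaw μ P Q (n + 1)) (jointLaw μ P R (n + 1)) +
      l * expectedDistortion μ P d n Q ≠ ∞) :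
    ∫⁻ p, gibbsLoss P d R l n 0 p ∂pastLaw μ P R 0 ≤
      klDiv (jointLaw μ P Q (n + 1)) (jointLaw μ P R (n + 1)) +
        l * expectedDistortion μ P d n Q := by
  refine (le_energyBefore hfin le_rfl).trans (le_trans ?_ (energyAfter_le_of_optimal hfin le_rfl))
  rw [energyAfter_eq_add_of_ne_top μ P d R l Q _ n (ne_top_of_le_ne_top hfin
    (energyAfter_le_of_optimal hfin le_rfl))]
  exact le_self_add

/-- A minimizer of the energy consists of the Gibbs kernels. -/
theorem kernel_eq_stepGibbs_of_optimal [∀ t, StandardBorelSpace (Y t)] {n : ℕ}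
    (hfin : klDiv (jointLaw μ P Q (n + 1)) (jointLaw μ P R (n + 1)) +
      l * expectedDistortion μ P d n Q ≠ ∞)
    (hopt : klDiv (jointLaw μ P Q (n + 1)) (jointLaw μ P R (n + 1)) +
      l * expectedDistortion μ P d n Q ≤ ∫⁻ p, gibbsLoss P d R l n 0 p ∂pastLaw μ P R 0)
    {t : ℕ} (ht : t ≤ n) :
    ∀ᵐ p ∂pastLaw μ P Q t,
      Q.kernel t p = stepGibbs (R.kernel t) (stepCost P d R l (n - t) t) p := by
  have h1 := energyAfter_le_of_optimal hfin ht
  have h2 := le_energyBefore hfin ht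
  have h3 := ne_top_of_le_ne_top hfin h1
  have h4 := energyAfter_eq_add_of_ne_top μ P d R l Q (n - t) t h3
  have h5 := (h1.trans hopt).trans h2
  rw [h4] at h5
  have h6 : energyBefore μ P d R l Q (n - t) t ≠ ∞ :=
    ne_top_of_le_ne_top h3 (h4 ▸ le_self_add)
  have := isMarkovKernel_stepGibbs (R.kernel t) (measurable_stepCost P d R l (n - t) t)
  have h7 : klDiv (pastLaw μ P Q t ⊗ₘ Q.kernel t) (pastLaw μ P Q t ⊗ₘ stepGibbs (R.kernel t)
      (stepCost P d R l (n - t) t)) = 0 := by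
    have : energyBefore μ P d R l Q (n - t) t + klDiv (pastLaw μ P Q t ⊗ₘ Q.kernel t)
      (pastLaw μ P Q t ⊗ₘ stepGibbs (R.kernel t) (stepCost P d R l (n - t) t)) ≤
      energyBefore μ P d R l Q (n - t) t + 0 := by rwa [add_zero]
    exact nonpos_iff_eq_zero.mp ((ENNReal.add_le_add_iff_left h6).mp this)
  exact Kernel.ae_eq_of_compProd_eq (klDiv_eq_zero_iff.mp h7)

end gibbs

section smallMultiplier

open InformationTheory

variable {W : Type w} {X : ℕ → Type u} {Y : ℕ → Type v} [MeasurableSpace W]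
  [∀ t, MeasurableSpace (X t)] [∀ t, MeasurableSpace (Y t)]
  {μ : Measure W} [IsProbabilityMeasure μ] {P : Source X} {d : Distortion X Y}
  {R : Reproduction W X Y} {l : ℝ≥0∞} {Q : Reproduction W X Y}

theorem ae_compProd_of_ae_jointLaw {t : ℕ} {p : W × (Hist X (t + 1) × Hist Y (t + 1)) → Prop}
    (h : ∀ᵐ a ∂jointLaw μ P Q (t + 1), p a) :
    ∀ᵐ q ∂(pastLaw μ P Q t ⊗ₘ Q.kernel t), p (joinEquiv t q) := by
  rw [jointLaw_succ] at h
  exact ae_of_ae_map (joinEquiv t).measurable.aemeasurable h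

theorem ae_ae_of_ae_pastLaw {t : ℕ} {p : (W × Hist Y t) × Hist X (t + 1) → Prop}
    (h : ∀ᵐ q ∂pastLaw μ P Q t, p q) :
    ∀ᵐ a ∂jointLaw μ P Q t, ∀ᵐ x' ∂P.kernel t a.2.1, p ((a.1, a.2.2), a.2.1.snoc x') := by
  have h' : ∀ᵐ b ∂(jointLaw μ P Q t ⊗ₘ (P.kernel t).comap (fun a => a.2.1) (by fun_prop)),
      p ((b.1.1, b.1.2.2), b.1.2.1.snoc b.2) :=
    ae_of_ae_map (measurable_pastLaw_aux t).aemeasurable h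
  filter_upwards [Measure.ae_ae_of_ae_compProd h'] with a ha
  exact ha

/-- If the joint laws are equivalent, then so are the kernels. -/
theorem compProd_kernel_absolutelyContinuous {t N : ℕ} (htN : t < N)
    (hQR : jointLaw μ P Q N ≪ jointLaw μ P R N) (hRQ : jointLaw μ P R N ≪ jointLaw μ P Q N) :
    pastLaw μ P Q t ⊗ₘ R.kernel t ≪ pastLaw μ P Q t ⊗ₘ Q.kernel t := by
  have h1 : pastLaw μ P Q t ⊗ₘ R.kernel t ≪ pastLaw μ P R t ⊗ₘ R.kernel t :=
    (pastLaw_absolutelyContinuous (jointLaw_absolutelyContinuous_of_le htN.le hQR)).compProd_left _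
  have h2 : jointLaw μ P R (t + 1) ≪ jointLaw μ P Q (t + 1) :=
    jointLaw_absolutelyContinuous_of_le htN hRQ
  rw [jointLaw_succ, jointLaw_succ] at h2
  have h3 := h2.map (joinEquiv (W := W) (X := X) (Y := Y) t).symm.measurable
  rw [MeasurableEquiv.map_symm_map, MeasurableEquiv.map_symm_map] at h3
  exact h1.trans h3

theorem lintegral_gibbsLoss_ne_top {n : ℕ}
    (hfin : klDiv (jointLaw μ P Q (n + 1)) (jointLaw μ P R (n + 1)) +
      l * expectedDistortion μ P d n Q ≠ ∞) {t : ℕ} (ht : t ≤ n) :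
    ∫⁻ p, gibbsLoss P d R l (n - t) t p ∂pastLaw μ P Q t ≠ ∞ := by
  have h1 := ne_top_of_le_ne_top hfin (energyAfter_le_of_optimal hfin ht)
  rw [energyAfter_eq_add_of_ne_top μ P d R l Q _ t h1] at h1
  exact (ENNReal.add_ne_top.mp (ENNReal.add_ne_top.mp h1).1).2

theorem lintegral_gibbsCost_ne_top {n : ℕ}
    (hfin : klDiv (jointLaw μ P Q (n + 1)) (jointLaw μ P R (n + 1)) +
      l * expectedDistortion μ P d n Q ≠ ∞) {t : ℕ} (ht : t ≤ n) :
    ∫⁻ a, gibbsCost P d R l (n - t) t (a.1, a.2.2) a.2.1 ∂jointLaw μ P Q (t + 1) ≠ ∞ :=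
  (ENNReal.add_ne_top.mp (ne_top_of_le_ne_top hfin (energyAfter_le_of_optimal hfin ht))).2

theorem measurable_gibbsCost_jointLaw (P : Source X) (d : Distortion X Y)
    (R : Reproduction W X Y) (l : ℝ≥0∞) (k t : ℕ) :
    Measurable fun a : W × (Hist X (t + 1) × Hist Y (t + 1)) =>
      gibbsCost P d R l k t (a.1, a.2.2) a.2.1 :=
  (measurable_gibbsCost P d R l k t).comp (by fun_prop : Measurable
    fun a : W × (Hist X (t + 1) × Hist Y (t + 1)) => ((a.1, a.2.2), a.2.1))

theorem stepPartition_anti {α β : Type*} [MeasurableSpace α] [MeasurableSpace β]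
    (η : Kernel α β) {c c' : α → β → ℝ≥0∞} {a : α} (h : ∀ b, c a b ≤ c' a b) :
    stepPartition η c' a ≤ stepPartition η c a :=
  lintegral_mono fun b => expNeg_antitone (h b)

theorem gibbsCost_mono (P : Source X) (d : Distortion X Y) (R : Reproduction W X Y)
    {l l' : ℝ≥0∞} (hl : l ≤ l') (k t : ℕ) (y : W × Hist Y (t + 1)) (x : Hist X (t + 1)) :
    gibbsCost P d R l k t y x ≤ gibbsCost P d R l' k t y x := by
  induction k generalizing t with
  | zero => exact le_rfl
  | succ k ih =>
    refine lintegral_mono fun x' => negLog_antitone (stepPartition_anti _ fun yt => ?_)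
    exact add_le_add (mul_le_mul_left hl _) (ih _ _ _)

theorem gibbsLoss_mono (P : Source X) (d : Distortion X Y) (R : Reproduction W X Y)
    {l l' : ℝ≥0∞} (hl : l ≤ l') (k t : ℕ) (p : (W × Hist Y t) × Hist X (t + 1)) :
    gibbsLoss P d R l k t p ≤ gibbsLoss P d R l' k t p :=
  negLog_antitone (stepPartition_anti _ fun _ =>
    add_le_add (mul_le_mul_left hl _) (gibbsCost_mono P d R hl k t _ _))

theorem continuous_expNeg : Continuous expNeg :=
  ENNReal.continuous_exp.comp (continuous_neg.comp continuous_coe_ennreal_ereal)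

theorem continuous_negLog : Continuous negLog :=
  EReal.continuous_toENNReal.comp (continuous_neg.comp ENNReal.continuous_log)

theorem ae_rho_ne_top {n : ℕ} (hd : expectedDistortion μ P d n Q ≠ ∞) {t : ℕ} (ht : t ≤ n) :
    ∀ᵐ a ∂jointLaw μ P Q (t + 1), d.rho t a.2.1 a.2.2 ≠ ∞ := by
  have key : ∀ N, t + 1 ≤ N → ∫⁻ a, d.total N a.2.1 a.2.2 ∂jointLaw μ P Q N ≠ ∞ →
      ∫⁻ a, d.rho t a.2.1 a.2.2 ∂jointLaw μ P Q (t + 1) ≠ ∞ := by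
    intro N hN
    induction N, hN using Nat.le_induction with
    | base => intro h; rw [lintegral_total_succ] at h; exact (ENNReal.add_ne_top.mp h).2
    | succ N _ ih =>
      intro h; rw [lintegral_total_succ] at h; exact ih (ENNReal.add_ne_top.mp h).1
  filter_upwards [ae_lt_top ((d.measurable t).comp measurable_snd) (key (n + 1) (by omega) hd)]
    with a ha using ha.ne

theorem tendsto_gibbsLoss_of_gibbsCost {k t : ℕ} {l : ℕ → ℝ≥0∞} (hl : Tendsto l atTop (𝓝 0))
    (hac : pastLaw μ P Q t ⊗ₘ R.kernel t ≪ pastLaw μ P Q t ⊗ₘ Q.kernel t)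
    (hrho : ∀ᵐ a ∂jointLaw μ P Q (t + 1), d.rho t a.2.1 a.2.2 ≠ ∞)
    (hcost : ∀ᵐ a ∂jointLaw μ P Q (t + 1),
      Tendsto (fun m => gibbsCost P d R (l m) k t (a.1, a.2.2) a.2.1) atTop (𝓝 0)) :
    ∀ᵐ p ∂pastLaw μ P Q t, Tendsto (fun m => gibbsLoss P d R (l m) k t p) atTop (𝓝 0) := by
  have h1 := hac.ae_le (ae_compProd_of_ae_jointLaw (hrho.and hcost))
  filter_upwards [Measure.ae_ae_of_ae_compProd h1] with p hp
  have hZ : Tendsto (fun m => stepPartition (R.kernel t) (stepCost P d R (l m) k t) p) atTop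
      (𝓝 (∫⁻ _, (1 : ℝ≥0∞) ∂(R.kernel t p))) := by
    refine tendsto_lintegral_of_dominated_convergence (fun _ => 1) (fun m => ?_)
      (fun m => ae_of_all _ fun _ => expNeg_le_one _) (by simp) ?_
    · exact measurable_expNeg.comp ((measurable_stepCost P d R (l m) k t).comp
        measurable_prodMk_left)
    · filter_upwards [hp] with y hy
      have h2 : Tendsto (fun m => l m * d.rho t p.2 (p.1.2.snoc y)) atTop (𝓝 0) := by
        have := ENNReal.Tendsto.mul_const (b := d.rho t p.2 (p.1.2.snoc y)) hl (Or.inr hy.1)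
        rwa [zero_mul] at this
      have h3 := h2.add hy.2
      rw [add_zero] at h3
      have h4 := (continuous_expNeg.tendsto 0).comp h3
      rwa [expNeg_zero] at h4
  rw [lintegral_one, measure_univ] at hZ
  have h5 := (continuous_negLog.tendsto 1).comp hZ
  rwa [negLog_one] at h5

/-- The Gibbs value tends to zero with the multiplier. -/
theorem tendsto_lintegral_gibbsLoss {n : ℕ} {l : ℕ → ℝ≥0∞} (hl : Tendsto l atTop (𝓝 0))
    (hl1 : ∀ m, l m ≤ 1)
    (hkl : klDiv (jointLaw μ P Q (n + 1)) (jointLaw μ P R (n + 1)) ≠ ∞)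
    (hRQ : jointLaw μ P R (n + 1) ≪ jointLaw μ P Q (n + 1))
    (hd : expectedDistortion μ P d n Q ≠ ∞) :
    Tendsto (fun m => ∫⁻ p, gibbsLoss P d R (l m) n 0 p ∂pastLaw μ P R 0) atTop (𝓝 0) := by
  have hQR := (klDiv_ne_top_iff.mp hkl).1
  have hfin : klDiv (jointLaw μ P Q (n + 1)) (jointLaw μ P R (n + 1)) +
      1 * expectedDistortion μ P d n Q ≠ ∞ := by rw [one_mul]; exact ENNReal.add_ne_top.mpr ⟨hkl, hd⟩
  have hac : ∀ t ≤ n, pastLaw μ P Q t ⊗ₘ R.kernel t ≪ pastLaw μ P Q t ⊗ₘ Q.kernel t :=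
    fun t ht => compProd_kernel_absolutelyContinuous (Nat.lt_succ_of_le ht) hQR hRQ
  have hloss : ∀ k t, t + k = n →
      ∀ᵐ p ∂pastLaw μ P Q t, Tendsto (fun m => gibbsLoss P d R (l m) k t p) atTop (𝓝 0) := by
    intro k
    induction k with
    | zero =>
      intro t ht
      refine tendsto_gibbsLoss_of_gibbsCost hl (hac t (by omega)) (ae_rho_ne_top hd (by omega)) ?_
      exact ae_of_all _ fun a => tendsto_const_nhds
    | succ k ih =>
      intro t ht
      refine tendsto_gibbsLoss_of_gibbsCost hl (hac t (by omega)) (ae_rho_ne_top hd (by omega)) ?_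
      have hg := lintegral_gibbsCost_ne_top hfin (t := t) (by omega)
      rw [show n - t = k + 1 by omega] at hg
      filter_upwards [ae_ae_of_ae_pastLaw (ih (t + 1) (by omega)),
        ae_lt_top (measurable_gibbsCost_jointLaw P d R 1 (k + 1) t) hg] with a h1 h2
      have hm : ∀ l : ℝ≥0∞, Measurable fun x' =>
          gibbsLoss P d R l k (t + 1) ((a.1, a.2.2), a.2.1.snoc x') := fun l =>
        (measurable_gibbsLoss P d R l k (t + 1)).comp (by fun_prop)
      have := tendsto_lintegral_of_dominated_convergence (fun x' =>
        gibbsLoss P d R 1 k (t + 1) ((a.1, a.2.2), a.2.1.snoc x')) (fun m => hm (l m))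
        (fun m => ae_of_all _ fun x' => gibbsLoss_mono P d R (hl1 m) k (t + 1) _) h2.ne h1
      rwa [lintegral_zero] at this
  rw [pastLaw_congr (jointLaw_zero_eq μ P R Q)]
  have hg := lintegral_gibbsLoss_ne_top hfin (t := 0) (by omega)
  have := tendsto_lintegral_of_dominated_convergence (fun p => gibbsLoss P d R 1 n 0 p)
    (fun m => measurable_gibbsLoss P d R (l m) n 0)
    (fun m => ae_of_all _ fun p => gibbsLoss_mono P d R (hl1 m) n 0 p) hg (hloss n 0 (by omega))
  rwa [lintegral_zero] at this

/-- Below any positive level of information there is a reproduction of finite distortion. -/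
theorem exists_info_lt [∀ t, StandardBorelSpace (X t)] [∀ t, StandardBorelSpace (Y t)]
    [∀ t, Nonempty (Y t)] {n : ℕ} (hI : info μ P (Q.causal (n + 1)) ≠ ∞)
    (hac : jointLaw μ P (outputRep μ P Q) (n + 1) ≪ jointLaw μ P Q (n + 1))
    (hd : expectedDistortion μ P d n Q ≠ ∞) {r : ℝ≥0∞} (hr : 0 < r) :
    ∃ Q' : Reproduction W X Y, expectedDistortion μ P d n Q' ≠ ∞ ∧
      info μ P (Q'.causal (n + 1)) < r := by
  have hl : Tendsto (fun m : ℕ => ((m : ℝ≥0∞) + 1)⁻¹) atTop (𝓝 0) := by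
    have := (tendsto_add_atTop_iff_nat 1).mpr ENNReal.tendsto_inv_nat_nhds_zero
    simpa using this
  have hlim := tendsto_lintegral_gibbsLoss (d := d) hl
    (fun m => ENNReal.inv_le_one.mpr le_add_self) (by rwa [← info_eq_klDiv_jointLaw]) hac hd
  obtain ⟨m, hm⟩ := (hlim.eventually (gt_mem_nhds (lt_min hr ENNReal.zero_lt_top :
    0 < min r ∞))).exists
  have hle := klDiv_gibbsRep_add_le μ P d (outputRep μ P Q) ((m : ℝ≥0∞) + 1)⁻¹ n
  have hlt := hle.trans_lt hm
  refine ⟨gibbsRep P d (outputRep μ P Q) ((m : ℝ≥0∞) + 1)⁻¹ n, ?_, ?_⟩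
  · intro htop
    rw [htop, ENNReal.mul_top (by simp), add_top] at hlt
    exact not_top_lt hlt
  · exact ((info_le_klDiv_jointLaw μ P Q _ (n + 1)).trans le_self_add).trans_lt
      (hlt.trans_le (min_le_left _ _))

end smallMultiplier

section optimum

open InformationTheory

variable {W : Type w} {X : ℕ → Type u} {Y : ℕ → Type v} [MeasurableSpace W]
  [∀ t, MeasurableSpace (X t)] [∀ t, MeasurableSpace (Y t)]
  {μ : Measure W} [IsProbabilityMeasure μ] {P : Source X} {d : Distortion X Y}
  {R : Reproduction W X Y} {l : ℝ≥0∞} {Q : Reproduction W X Y} {n : ℕ} {D : ℝ≥0}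

theorem IsOptimal.expectedDistortion_le (hopt : IsOptimal μ P d n D Q) :
    expectedDistortion μ P d n Q ≤ ((n : ℝ≥0∞) + 1) * D :=
  feasible_iff.mp hopt.1

theorem IsOptimal.expectedDistortion_ne_top (hopt : IsOptimal μ P d n D Q) :
    expectedDistortion μ P d n Q ≠ ∞ :=
  ne_top_of_le_ne_top (by finiteness) hopt.expectedDistortion_le

theorem IsOptimal.exists_isLagrangeMultiplier [∀ t, StandardBorelSpace (X t)]
    [∀ t, StandardBorelSpace (Y t)] [∀ t, Nonempty (Y t)] (hopt : IsOptimal μ P d n D Q)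
    (hdiff : GateauxDifferentiableAt μ P n Q) :
    ∃ s, IsLagrangeMultiplier (W := W) (X := X) (Y := Y) μ P d n D s := by
  obtain ⟨hI, hac⟩ := hdiff.info_ne_top_and_absolutelyContinuous
  have hR : nrdf (W := W) μ P d n D ≠ ∞ := hopt.2 ▸ hI
  rcases eq_or_ne (nrdf (W := W) μ P d n D) 0 with h0 | h0
  · exact ⟨0, le_rfl, fun Q' => by simp [h0]⟩
  have hd := hopt.expectedDistortion_ne_top
  obtain ⟨Q₁, hd₁, hI₁⟩ := exists_info_lt (d := d) hI hac hd (pos_iff_ne_zero.mpr h0)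
  by_cases hsl : ∃ Q₀ : Reproduction W X Y, info μ P (Q₀.causal (n + 1)) ≠ ∞ ∧
      expectedDistortion μ P d n Q₀ < ((n : ℝ≥0∞) + 1) * D
  · obtain ⟨Q₀, hI₀, hd₀⟩ := hsl
    exact NRDF.exists_isLagrangeMultiplier μ P d n D hR hd₀ hI₀ hd₁ hI₁
  · push Not at hsl
    have heq := expectedDistortion_outputRep_eq μ P d n Q hI hac hd
      fun Q' hQ' => hopt.expectedDistortion_le.trans (hsl Q' hQ')
    have hle := nrdf_le_info (heq.le.trans hopt.expectedDistortion_le)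
    rw [info_outputRep] at hle
    exact absurd (nonpos_iff_eq_zero.mp hle) h0

theorem IsLagrangeMultiplier.mul_expectedDistortion_eq {s : ℝ} (hopt : IsOptimal μ P d n D Q)
    (hI : info μ P (Q.causal (n + 1)) ≠ ∞)
    (hs : IsLagrangeMultiplier (W := W) (X := X) (Y := Y) μ P d n D s) :
    ENNReal.ofReal (-s) * expectedDistortion μ P d n Q =
      ENNReal.ofReal (-s) * (((n : ℝ≥0∞) + 1) * D) := by
  refine le_antisymm (by gcongr; exact hopt.expectedDistortion_le) ?_
  have h := hs.2 Q
  rw [hopt.2] at h hI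
  exact (ENNReal.add_le_add_iff_left hI).mp h

/-- An optimal reproduction minimizes the energy. -/
theorem IsLagrangeMultiplier.klDiv_add_le [∀ t, StandardBorelSpace (X t)]
    [∀ t, StandardBorelSpace (Y t)] [∀ t, Nonempty (Y t)] {s : ℝ}
    (hopt : IsOptimal μ P d n D Q)
    (hs : IsLagrangeMultiplier (W := W) (X := X) (Y := Y) μ P d n D s) :
    klDiv (jointLaw μ P Q (n + 1)) (jointLaw μ P (outputRep μ P Q) (n + 1)) +
      ENNReal.ofReal (-s) * expectedDistortion μ P d n Q ≤
        ∫⁻ p, gibbsLoss P d (outputRep μ P Q) (ENNReal.ofReal (-s)) n 0 p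
          ∂pastLaw μ P (outputRep μ P Q) 0 := by
  refine le_trans ?_ (klDiv_gibbsRep_add_le μ P d (outputRep μ P Q) (ENNReal.ofReal (-s)) n)
  rw [← info_eq_klDiv_jointLaw, hopt.2]
  have h1 : nrdf μ P d n D + ENNReal.ofReal (-s) * expectedDistortion μ P d n Q ≤
      nrdf μ P d n D + ENNReal.ofReal (-s) * (((n : ℝ≥0∞) + 1) * D) := by
    gcongr; exact hopt.expectedDistortion_le
  exact (h1.trans (hs.2 _)).trans (add_le_add (info_le_klDiv_jointLaw μ P Q _ (n + 1)) le_rfl)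

/-- The real-valued function `g_{t,n}`, where `k = n - t`. -/
def realCost (P : Source X) (d : Distortion X Y) (s : ℝ) (Pi : ∀ t, Kernel (W × Hist Y t) (Y t)) :
    ∀ _k t : ℕ, W × Hist Y (t + 1) → Hist X (t + 1) → ℝ
  | 0, _ => fun _ _ => 0
  | k + 1, t => fun y x => -∫ x', logPartition d s (t + 1) (realCost P d s Pi k (t + 1))
      (Pi (t + 1)) (y, x.snoc x') ∂P.kernel (t + 1) x

theorem backwardRecursion_realCost (P : Source X) (d : Distortion X Y) (n : ℕ) (s : ℝ)
    (Pi : ∀ t, Kernel (W × Hist Y t) (Y t)) :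
    BackwardRecursion P d n s Pi (fun t => realCost P d s Pi (n - t) t) := by
  refine ⟨fun y x => ?_, fun t ht y x => ?_⟩
  · dsimp only
    rw [Nat.sub_self]
    rfl
  · dsimp only
    rw [show n - t = n - (t + 1) + 1 by omega]
    rfl

theorem weight_eq_expNeg {s : ℝ} (hs : s ≤ 0) {t : ℕ}
    {g : W × Hist Y (t + 1) → Hist X (t + 1) → ℝ} {y : W × Hist Y (t + 1)} {x : Hist X (t + 1)}
    {c : ℝ≥0∞} (hc : c ≠ ∞) (hg : g y x = c.toReal) :
    weight d s t g y x = expNeg (ENNReal.ofReal (-s) * d.rho t x y.2 + c) := by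
  unfold weight expNeg
  congr 1
  lift c to ℝ≥0 using hc
  have hcoe : ((ENNReal.ofReal (-s) : ℝ≥0∞) : EReal) = ((-s : ℝ) : EReal) := by
    rw [EReal.coe_ennreal_ofReal, max_eq_left (by linarith)]
  rw [hg, EReal.coe_ennreal_add, EReal.coe_ennreal_mul, hcoe, EReal.coe_neg, EReal.neg_mul,
    EReal.neg_add (Or.inr (by simp)) (Or.inr (by simp)), neg_neg]
  rfl

variable {s : ℝ} [∀ t, StandardBorelSpace (Y t)] [∀ t, Nonempty (Y t)]

/-- The real-valued and the extended-valued quantities agree almost everywhere. -/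
theorem partition_eq_stepPartition (hs : s ≤ 0) {k t : ℕ}
    (hac : pastLaw μ P Q t ⊗ₘ (outputRep μ P Q).kernel t ≪ pastLaw μ P Q t ⊗ₘ Q.kernel t)
    (hcost : ∀ᵐ a ∂jointLaw μ P Q (t + 1),
      gibbsCost P d (outputRep μ P Q) (ENNReal.ofReal (-s)) k t (a.1, a.2.2) a.2.1 ≠ ∞ ∧
      realCost P d s (outputKernel μ P Q) k t (a.1, a.2.2) a.2.1 =
        (gibbsCost P d (outputRep μ P Q) (ENNReal.ofReal (-s)) k t (a.1, a.2.2) a.2.1).toReal) :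
    ∀ᵐ p ∂pastLaw μ P Q t,
      (∀ᵐ yt ∂outputKernel μ P Q t p.1,
        weight d s t (realCost P d s (outputKernel μ P Q) k t) (extend p.1 yt) p.2 =
          expNeg (stepCost P d (outputRep μ P Q) (ENNReal.ofReal (-s)) k t p yt)) ∧
      partition d s t (realCost P d s (outputKernel μ P Q) k t) (outputKernel μ P Q t) p =
        stepPartition ((outputRep μ P Q).kernel t)
          (stepCost P d (outputRep μ P Q) (ENNReal.ofReal (-s)) k t) p := by
  have h1 := hac.ae_le (ae_compProd_of_ae_jointLaw hcost)
  filter_upwards [Measure.ae_ae_of_ae_compProd h1] with p hp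
  have hw : ∀ᵐ yt ∂outputKernel μ P Q t p.1,
      weight d s t (realCost P d s (outputKernel μ P Q) k t) (extend p.1 yt) p.2 =
        expNeg (stepCost P d (outputRep μ P Q) (ENNReal.ofReal (-s)) k t p yt) := by
    filter_upwards [hp] with yt hy
    exact weight_eq_expNeg hs hy.1 hy.2
  exact ⟨hw, lintegral_congr_ae hw⟩

theorem logPartition_eq_of_partition_eq {k t : ℕ}
    {p : (W × Hist Y t) × Hist X (t + 1)}
    (hp : partition d s t (realCost P d s (outputKernel μ P Q) k t) (outputKernel μ P Q t) p =
        stepPartition ((outputRep μ P Q).kernel t)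
          (stepCost P d (outputRep μ P Q) (ENNReal.ofReal (-s)) k t) p)
    (hfin : gibbsLoss P d (outputRep μ P Q) (ENNReal.ofReal (-s)) k t p ≠ ∞) :
    logPartition d s t (realCost P d s (outputKernel μ P Q) k t) (outputKernel μ P Q t) p =
      -(gibbsLoss P d (outputRep μ P Q) (ENNReal.ofReal (-s)) k t p).toReal := by
  have h0 := negLog_eq_top_iff.not.mp hfin
  unfold logPartition gibbsLoss
  rw [hp, negLog_of_ne_zero h0 (stepPartition_le_one _ _ _), neg_neg]

/-- The integral of the real part of an extended-valued function of finite integral. -/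
theorem integrable_and_integral_of_ae_eq_toReal {α : Type*} [MeasurableSpace α] {ν : Measure α}
    {f : α → ℝ} {F : α → ℝ≥0∞} (hF : Measurable F) (hfin : ∫⁻ a, F a ∂ν ≠ ∞)
    (h : f =ᵐ[ν] fun a => (F a).toReal) :
    Integrable f ν ∧ ∫ a, f a ∂ν = (∫⁻ a, F a ∂ν).toReal := by
  refine ⟨(integrable_toReal_of_lintegral_ne_top hF.aemeasurable hfin).congr h.symm, ?_⟩
  rw [integral_congr_ae h, integral_toReal hF.aemeasurable (ae_lt_top hF hfin)]

theorem realCost_eq_toReal (hs : s ≤ 0)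
    (hkl : klDiv (jointLaw μ P Q (n + 1)) (jointLaw μ P (outputRep μ P Q) (n + 1)) ≠ ∞)
    (hRQ : jointLaw μ P (outputRep μ P Q) (n + 1) ≪ jointLaw μ P Q (n + 1))
    (hd : expectedDistortion μ P d n Q ≠ ∞) (k t : ℕ) (ht : t + k = n) :
    ∀ᵐ a ∂jointLaw μ P Q (t + 1),
      gibbsCost P d (outputRep μ P Q) (ENNReal.ofReal (-s)) k t (a.1, a.2.2) a.2.1 ≠ ∞ ∧
      realCost P d s (outputKernel μ P Q) k t (a.1, a.2.2) a.2.1 =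
        (gibbsCost P d (outputRep μ P Q) (ENNReal.ofReal (-s)) k t (a.1, a.2.2) a.2.1).toReal := by
  have hfin : klDiv (jointLaw μ P Q (n + 1)) (jointLaw μ P (outputRep μ P Q) (n + 1)) +
      ENNReal.ofReal (-s) * expectedDistortion μ P d n Q ≠ ∞ := by finiteness
  induction k generalizing t with
  | zero => exact ae_of_all _ fun a => ⟨by simp [gibbsCost], by simp [gibbsCost, realCost]⟩
  | succ k ih =>
    have hac := compProd_kernel_absolutelyContinuous (by omega : t + 1 < n + 1)
      (klDiv_ne_top_iff.mp hkl).1 hRQ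
    have h1 := partition_eq_stepPartition hs hac (ih (t + 1) (by omega))
    have hg := lintegral_gibbsCost_ne_top hfin (t := t) (by omega)
    rw [show n - t = k + 1 by omega] at hg
    have hL := lintegral_gibbsLoss_ne_top hfin (t := t + 1) (by omega)
    rw [show n - (t + 1) = k by omega] at hL
    filter_upwards [ae_ae_of_ae_pastLaw h1, ae_ae_of_ae_pastLaw (ae_lt_top
      (measurable_gibbsLoss P d (outputRep μ P Q) (ENNReal.ofReal (-s)) k (t + 1)) hL),
      ae_lt_top (measurable_gibbsCost_jointLaw P d _ _ (k + 1) t) hg] with a ha1 ha2 ha3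
    refine ⟨ha3.ne, ?_⟩
    have hm : Measurable fun x' => gibbsLoss P d (outputRep μ P Q) (ENNReal.ofReal (-s)) k (t + 1)
        ((a.1, a.2.2), a.2.1.snoc x') :=
      (measurable_gibbsLoss P d _ _ k (t + 1)).comp (by fun_prop)
    have heq : ∀ᵐ x' ∂P.kernel (t + 1) a.2.1, -logPartition d s (t + 1)
        (realCost P d s (outputKernel μ P Q) k (t + 1)) (outputKernel μ P Q (t + 1))
          ((a.1, a.2.2), a.2.1.snoc x') = (gibbsLoss P d (outputRep μ P Q) (ENNReal.ofReal (-s)) k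
            (t + 1) ((a.1, a.2.2), a.2.1.snoc x')).toReal := by
      filter_upwards [ha1, ha2] with x' h2 h3
      rw [logPartition_eq_of_partition_eq h2.2 h3.ne, neg_neg]
    have := (integrable_and_integral_of_ae_eq_toReal hm ha3.ne heq).2
    rw [integral_neg] at this
    exact this

end optimum

section gibbsForm

open InformationTheory

variable {W : Type w} {X : ℕ → Type u} {Y : ℕ → Type v} [MeasurableSpace W]
  [∀ t, MeasurableSpace (X t)] [∀ t, MeasurableSpace (Y t)]
  [∀ t, StandardBorelSpace (Y t)] [∀ t, Nonempty (Y t)]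
  {μ : Measure W} [IsProbabilityMeasure μ] {P : Source X} {d : Distortion X Y}
  {Q : Reproduction W X Y} {n : ℕ} {D : ℝ≥0} {s : ℝ}

theorem ae_partition_eq_stepPartition (hs : s ≤ 0)
    (hkl : klDiv (jointLaw μ P Q (n + 1)) (jointLaw μ P (outputRep μ P Q) (n + 1)) ≠ ∞)
    (hRQ : jointLaw μ P (outputRep μ P Q) (n + 1) ≪ jointLaw μ P Q (n + 1))
    (hd : expectedDistortion μ P d n Q ≠ ∞) {t : ℕ} (ht : t ≤ n) :
    ∀ᵐ p ∂pastLaw μ P Q t,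
      (∀ᵐ yt ∂outputKernel μ P Q t p.1,
        weight d s t (realCost P d s (outputKernel μ P Q) (n - t) t) (extend p.1 yt) p.2 =
          expNeg (stepCost P d (outputRep μ P Q) (ENNReal.ofReal (-s)) (n - t) t p yt)) ∧
      partition d s t (realCost P d s (outputKernel μ P Q) (n - t) t) (outputKernel μ P Q t) p =
        stepPartition ((outputRep μ P Q).kernel t)
          (stepCost P d (outputRep μ P Q) (ENNReal.ofReal (-s)) (n - t) t) p ∧
      gibbsLoss P d (outputRep μ P Q) (ENNReal.ofReal (-s)) (n - t) t p ≠ ∞ := by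
  have hfin : klDiv (jointLaw μ P Q (n + 1)) (jointLaw μ P (outputRep μ P Q) (n + 1)) +
      ENNReal.ofReal (-s) * expectedDistortion μ P d n Q ≠ ∞ := by finiteness
  have h1 := partition_eq_stepPartition hs
    (compProd_kernel_absolutelyContinuous (Nat.lt_succ_of_le ht) (klDiv_ne_top_iff.mp hkl).1 hRQ)
    (realCost_eq_toReal hs hkl hRQ hd (n - t) t (by omega))
  filter_upwards [h1, ae_lt_top (measurable_gibbsLoss P d _ _ _ _)
    (lintegral_gibbsLoss_ne_top hfin ht)] with p hp hp'
  exact ⟨hp.1, hp.2, hp'.ne⟩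

theorem integrable_logPartition_snoc (hs : s ≤ 0)
    (hkl : klDiv (jointLaw μ P Q (n + 1)) (jointLaw μ P (outputRep μ P Q) (n + 1)) ≠ ∞)
    (hRQ : jointLaw μ P (outputRep μ P Q) (n + 1) ≪ jointLaw μ P Q (n + 1))
    (hd : expectedDistortion μ P d n Q ≠ ∞) {t : ℕ} (ht : t < n) :
    ∀ᵐ a ∂jointLaw μ P Q (t + 1), Integrable (fun x' => logPartition d s (t + 1)
      (realCost P d s (outputKernel μ P Q) (n - (t + 1)) (t + 1)) (outputKernel μ P Q (t + 1))
        ((a.1, a.2.2), a.2.1.snoc x')) (P.kernel (t + 1) a.2.1) := by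
  have hfin : klDiv (jointLaw μ P Q (n + 1)) (jointLaw μ P (outputRep μ P Q) (n + 1)) +
      ENNReal.ofReal (-s) * expectedDistortion μ P d n Q ≠ ∞ := by finiteness
  have hg := lintegral_gibbsCost_ne_top hfin ht.le
  filter_upwards [ae_ae_of_ae_pastLaw (ae_partition_eq_stepPartition hs hkl hRQ hd ht),
    ae_lt_top (measurable_gibbsCost_jointLaw P d _ _ (n - t) t) hg] with a ha hga
  rw [show n - t = n - (t + 1) + 1 by omega, gibbsCost_succ] at hga
  refine integrable_neg_iff.mp (integrable_and_integral_of_ae_eq_toReal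
    (F := fun x' => gibbsLoss P d (outputRep μ P Q) (ENNReal.ofReal (-s)) (n - (t + 1)) (t + 1)
      ((a.1, a.2.2), a.2.1.snoc x'))
    ((measurable_gibbsLoss P d _ _ _ _).comp (by fun_prop)) hga.ne ?_).1
  filter_upwards [ha] with x' h
  rw [Pi.neg_apply, logPartition_eq_of_partition_eq h.2.1 h.2.2, neg_neg]

theorem integrable_logPartition (hs : s ≤ 0)
    (hkl : klDiv (jointLaw μ P Q (n + 1)) (jointLaw μ P (outputRep μ P Q) (n + 1)) ≠ ∞)
    (hRQ : jointLaw μ P (outputRep μ P Q) (n + 1) ≪ jointLaw μ P Q (n + 1))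
    (hd : expectedDistortion μ P d n Q ≠ ∞) {t : ℕ} (ht : t ≤ n) :
    Integrable (logPartition d s t (realCost P d s (outputKernel μ P Q) (n - t) t)
      (outputKernel μ P Q t)) (pastLaw μ P Q t) ∧
    ∫ p, logPartition d s t (realCost P d s (outputKernel μ P Q) (n - t) t)
      (outputKernel μ P Q t) p ∂pastLaw μ P Q t =
      -(∫⁻ p, gibbsLoss P d (outputRep μ P Q) (ENNReal.ofReal (-s)) (n - t) t p
        ∂pastLaw μ P Q t).toReal := by
  have hfin : klDiv (jointLaw μ P Q (n + 1)) (jointLaw μ P (outputRep μ P Q) (n + 1)) +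
      ENNReal.ofReal (-s) * expectedDistortion μ P d n Q ≠ ∞ := by finiteness
  have h := integrable_and_integral_of_ae_eq_toReal (measurable_gibbsLoss P d _ _ _ _)
    (lintegral_gibbsLoss_ne_top hfin ht) (f := -logPartition d s t
      (realCost P d s (outputKernel μ P Q) (n - t) t) (outputKernel μ P Q t)) (by
      filter_upwards [ae_partition_eq_stepPartition hs hkl hRQ hd ht] with p hp
      rw [Pi.neg_apply, logPartition_eq_of_partition_eq hp.2.1 hp.2.2, neg_neg])
  refine ⟨integrable_neg_iff.mp h.1, ?_⟩
  rw [← h.2, ← integral_neg]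
  simp

theorem integrable_realCost (hs : s ≤ 0)
    (hkl : klDiv (jointLaw μ P Q (n + 1)) (jointLaw μ P (outputRep μ P Q) (n + 1)) ≠ ∞)
    (hRQ : jointLaw μ P (outputRep μ P Q) (n + 1) ≪ jointLaw μ P Q (n + 1))
    (hd : expectedDistortion μ P d n Q ≠ ∞) {t : ℕ} (ht : t ≤ n) :
    (∀ᵐ p ∂pastLaw μ P Q t, Integrable (fun yt =>
      realCost P d s (outputKernel μ P Q) (n - t) t (extend p.1 yt) p.2) (Q.kernel t p)) ∧
    Integrable (fun p => ∫ yt, realCost P d s (outputKernel μ P Q) (n - t) t (extend p.1 yt) p.2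
      ∂Q.kernel t p) (pastLaw μ P Q t) ∧
    ∫ p, ∫ yt, realCost P d s (outputKernel μ P Q) (n - t) t (extend p.1 yt) p.2
      ∂Q.kernel t p ∂pastLaw μ P Q t =
      (∫⁻ a, gibbsCost P d (outputRep μ P Q) (ENNReal.ofReal (-s)) (n - t) t (a.1, a.2.2) a.2.1
        ∂jointLaw μ P Q (t + 1)).toReal := by
  have hfin : klDiv (jointLaw μ P Q (n + 1)) (jointLaw μ P (outputRep μ P Q) (n + 1)) +
      ENNReal.ofReal (-s) * expectedDistortion μ P d n Q ≠ ∞ := by finiteness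
  have hg := lintegral_gibbsCost_ne_top hfin ht
  have hm := measurable_gibbsCost_jointLaw P d (outputRep μ P Q) (ENNReal.ofReal (-s)) (n - t) t
  have hm' : Measurable fun q : ((W × Hist Y t) × Hist X (t + 1)) × Y t =>
      gibbsCost P d (outputRep μ P Q) (ENNReal.ofReal (-s)) (n - t) t (extend q.1.1 q.2) q.1.2 :=
    (measurable_gibbsCost P d _ _ _ _).comp
      (by fun_prop : Measurable fun q : ((W × Hist Y t) × Hist X (t + 1)) × Y t =>
        (extend q.1.1 q.2, q.1.2))
  have heq : ∫⁻ a, gibbsCost P d (outputRep μ P Q) (ENNReal.ofReal (-s)) (n - t) t (a.1, a.2.2)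
      a.2.1 ∂jointLaw μ P Q (t + 1) = ∫⁻ p, ∫⁻ yt, gibbsCost P d (outputRep μ P Q)
        (ENNReal.ofReal (-s)) (n - t) t (extend p.1 yt) p.2 ∂Q.kernel t p ∂pastLaw μ P Q t := by
    rw [jointLaw_succ, lintegral_map hm (joinEquiv t).measurable,
      ← Measure.lintegral_compProd hm']
    rfl
  have hmF : Measurable fun p => ∫⁻ yt, gibbsCost P d (outputRep μ P Q)
      (ENNReal.ofReal (-s)) (n - t) t (extend p.1 yt) p.2 ∂Q.kernel t p :=
    Measurable.lintegral_kernel_prod_right' hm'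
  rw [heq] at hg ⊢
  have hae : ∀ᵐ p ∂pastLaw μ P Q t,
      Integrable (fun yt => realCost P d s (outputKernel μ P Q) (n - t) t (extend p.1 yt) p.2)
        (Q.kernel t p) ∧
      ∫ yt, realCost P d s (outputKernel μ P Q) (n - t) t (extend p.1 yt) p.2 ∂Q.kernel t p =
        (∫⁻ yt, gibbsCost P d (outputRep μ P Q) (ENNReal.ofReal (-s)) (n - t) t (extend p.1 yt)
          p.2 ∂Q.kernel t p).toReal := by
    filter_upwards [Measure.ae_ae_of_ae_compProd (ae_compProd_of_ae_jointLaw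
      (realCost_eq_toReal hs hkl hRQ hd (n - t) t (by omega))), ae_lt_top hmF hg] with p hp hfp
    refine integrable_and_integral_of_ae_eq_toReal (hm'.comp measurable_prodMk_left) hfp.ne ?_
    filter_upwards [hp] with yt hy using hy.2
  have h2 := integrable_and_integral_of_ae_eq_toReal hmF hg (hae.mono fun p hp => hp.2)
  exact ⟨hae.mono fun p hp => hp.1, h2.1, h2.2⟩

/-- The Gibbs form of a minimizer of the energy. -/
theorem kernel_eq_withDensity_weight (hs : s ≤ 0)
    (hkl : klDiv (jointLaw μ P Q (n + 1)) (jointLaw μ P (outputRep μ P Q) (n + 1)) ≠ ∞)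
    (hRQ : jointLaw μ P (outputRep μ P Q) (n + 1) ≪ jointLaw μ P Q (n + 1))
    (hd : expectedDistortion μ P d n Q ≠ ∞)
    (hmin : klDiv (jointLaw μ P Q (n + 1)) (jointLaw μ P (outputRep μ P Q) (n + 1)) +
      ENNReal.ofReal (-s) * expectedDistortion μ P d n Q ≤
        ∫⁻ p, gibbsLoss P d (outputRep μ P Q) (ENNReal.ofReal (-s)) n 0 p
          ∂pastLaw μ P (outputRep μ P Q) 0) {t : ℕ} (ht : t ≤ n) :
    ∀ᵐ p ∂pastLaw μ P Q t,
      partition d s t (realCost P d s (outputKernel μ P Q) (n - t) t) (outputKernel μ P Q t) p ≠ 0 ∧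
      partition d s t (realCost P d s (outputKernel μ P Q) (n - t) t) (outputKernel μ P Q t) p ≠ ∞ ∧
      Q.kernel t p = (outputKernel μ P Q t p.1).withDensity (fun yt =>
        weight d s t (realCost P d s (outputKernel μ P Q) (n - t) t) (extend p.1 yt) p.2 /
          partition d s t (realCost P d s (outputKernel μ P Q) (n - t) t)
            (outputKernel μ P Q t) p) := by
  have hfin : klDiv (jointLaw μ P Q (n + 1)) (jointLaw μ P (outputRep μ P Q) (n + 1)) +
      ENNReal.ofReal (-s) * expectedDistortion μ P d n Q ≠ ∞ := by finiteness
  filter_upwards [ae_partition_eq_stepPartition hs hkl hRQ hd ht,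
    kernel_eq_stepGibbs_of_optimal hfin hmin ht] with p hp hQ
  have h0 := negLog_eq_top_iff.not.mp hp.2.2
  rw [hp.2.1]
  refine ⟨h0, ne_top_of_le_ne_top ENNReal.one_ne_top (stepPartition_le_one _ _ _), ?_⟩
  rw [hQ, stepGibbs, Kernel.withDensity_apply _ (measurable_stepDensity _
    (measurable_stepCost P d _ _ _ _)), outputRep_kernel_apply]
  refine withDensity_congr_ae ?_
  filter_upwards [hp.1] with yt hy
  rw [stepDensity, if_neg h0, hy]

/-- The costs and losses telescope. -/
theorem sum_integral_realCost_add_logPartition (hs : s ≤ 0)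
    (hkl : klDiv (jointLaw μ P Q (n + 1)) (jointLaw μ P (outputRep μ P Q) (n + 1)) ≠ ∞)
    (hRQ : jointLaw μ P (outputRep μ P Q) (n + 1) ≪ jointLaw μ P Q (n + 1))
    (hd : expectedDistortion μ P d n Q ≠ ∞) :
    ∑ t ∈ Finset.range (n + 1), ∫ p,
      ((∫ yt, realCost P d s (outputKernel μ P Q) (n - t) t (extend p.1 yt) p.2 ∂Q.kernel t p) +
        logPartition d s t (realCost P d s (outputKernel μ P Q) (n - t) t)
          (outputKernel μ P Q t) p) ∂pastLaw μ P Q t =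
      -(∫⁻ p, gibbsLoss P d (outputRep μ P Q) (ENNReal.ofReal (-s)) n 0 p
          ∂pastLaw μ P (outputRep μ P Q) 0).toReal := by
  have hterm : ∀ t ∈ Finset.range (n + 1), ∫ p,
      ((∫ yt, realCost P d s (outputKernel μ P Q) (n - t) t (extend p.1 yt) p.2 ∂Q.kernel t p) +
        logPartition d s t (realCost P d s (outputKernel μ P Q) (n - t) t)
          (outputKernel μ P Q t) p) ∂pastLaw μ P Q t =
      (∫⁻ a, gibbsCost P d (outputRep μ P Q) (ENNReal.ofReal (-s)) (n - t) t (a.1, a.2.2) a.2.1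
        ∂jointLaw μ P Q (t + 1)).toReal -
      (∫⁻ p, gibbsLoss P d (outputRep μ P Q) (ENNReal.ofReal (-s)) (n - t) t p
        ∂pastLaw μ P Q t).toReal := by
    intro t ht
    have htn : t ≤ n := Nat.lt_succ_iff.mp (Finset.mem_range.mp ht)
    obtain ⟨_, h1, h2⟩ := integrable_realCost hs hkl hRQ hd htn
    obtain ⟨h3, h4⟩ := integrable_logPartition hs hkl hRQ hd htn
    rw [integral_add h1 h3, h2, h4, sub_eq_add_neg]
  rw [Finset.sum_congr rfl hterm, Finset.sum_sub_distrib, Finset.sum_range_succ,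
    Finset.sum_range_succ', Nat.sub_self, Nat.sub_zero, pastLaw_congr (jointLaw_zero_eq μ P
      (outputRep μ P Q) Q)]
  have hstep : ∀ t ∈ Finset.range n,
      (∫⁻ a, gibbsCost P d (outputRep μ P Q) (ENNReal.ofReal (-s)) (n - t) t (a.1, a.2.2) a.2.1
        ∂jointLaw μ P Q (t + 1)).toReal =
      (∫⁻ p, gibbsLoss P d (outputRep μ P Q) (ENNReal.ofReal (-s)) (n - (t + 1)) (t + 1) p
        ∂pastLaw μ P Q (t + 1)).toReal := by
    intro t ht
    have := Finset.mem_range.mp ht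
    rw [lintegral_gibbsLoss_pastLaw, show n - t = n - (t + 1) + 1 by omega]
  rw [Finset.sum_congr rfl hstep]
  simp [gibbsCost]

theorem lintegral_total_eq_sum (μ : Measure W) [IsProbabilityMeasure μ] (P : Source X)
    (d : Distortion X Y) (Q : Reproduction W X Y) (N : ℕ) :
    ∫⁻ a, d.total N a.2.1 a.2.2 ∂jointLaw μ P Q N =
      ∑ t ∈ Finset.range N, ∫⁻ a, d.rho t a.2.1 a.2.2 ∂jointLaw μ P Q (t + 1) := by
  induction N with
  | zero => simp [Distortion.total]
  | succ N ih => rw [lintegral_total_succ, ih, Finset.sum_range_succ]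

end gibbsForm

end NRDF

end

theorem mainTheorem3 {W : Type*} {X Y : ℕ → Type*}
    [MeasurableSpace W] [StandardBorelSpace W]
    [∀ t, MeasurableSpace (X t)] [∀ t, StandardBorelSpace (X t)]
    [∀ t, MeasurableSpace (Y t)] [∀ t, StandardBorelSpace (Y t)] [∀ t, Nonempty (Y t)]
    (μ : Measure W) [IsProbabilityMeasure μ] (P : NRDF.Source X) (d : NRDF.Distortion X Y)
    (n : ℕ) (D : ℝ≥0) (Q : NRDF.Reproduction W X Y)
    (hopt : NRDF.IsOptimal μ P d n D Q)
    (hdiff : NRDF.GateauxDifferentiableAt μ P n Q) :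
    ∃ (s : ℝ) (g : ∀ t, W × NRDF.Hist Y (t + 1) → NRDF.Hist X (t + 1) → ℝ),
      NRDF.IsLagrangeMultiplier μ P d n D s ∧
      NRDF.BackwardRecursion P d n s (NRDF.outputKernel μ P Q) g ∧
      -- the integrals in the recursion and in the formula for the NRDF are well defined
      (∀ t < n, ∀ᵐ p ∂(NRDF.pastLaw μ P Q t), ∀ᵐ yt ∂(Q.kernel t p),
        Integrable (fun x' => NRDF.logPartition d s (t + 1) (g (t + 1))
          (NRDF.outputKernel μ P Q (t + 1)) (NRDF.extend p.1 yt, p.2.snoc x'))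
          (P.kernel (t + 1) p.2)) ∧
      (∀ t ≤ n,
        (∀ᵐ p ∂(NRDF.pastLaw μ P Q t),
          Integrable (fun yt => g t (NRDF.extend p.1 yt) p.2) (Q.kernel t p)) ∧
        Integrable (fun p => ∫ yt, g t (NRDF.extend p.1 yt) p.2 ∂(Q.kernel t p))
          (NRDF.pastLaw μ P Q t) ∧
        Integrable (NRDF.logPartition d s t (g t) (NRDF.outputKernel μ P Q t))
          (NRDF.pastLaw μ P Q t)) ∧
      -- (1) the Gibbs form of the optimal kernels
      (∀ t ≤ n, ∀ᵐ p ∂(NRDF.pastLaw μ P Q t),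
        NRDF.partition d s t (g t) (NRDF.outputKernel μ P Q t) p ≠ 0 ∧
        NRDF.partition d s t (g t) (NRDF.outputKernel μ P Q t) p ≠ ∞ ∧
        Q.kernel t p = (NRDF.outputKernel μ P Q t p.1).withDensity (fun yt =>
          NRDF.weight d s t (g t) (NRDF.extend p.1 yt) p.2 /
            NRDF.partition d s t (g t) (NRDF.outputKernel μ P Q t) p)) ∧
      -- (2) the value of the NRDF
      NRDF.nrdf (W := W) μ P d n D ≠ ∞ ∧
      ((n : ℝ) + 1)⁻¹ * (NRDF.nrdf (W := W) μ P d n D).toReal =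
        s * D - ((n : ℝ) + 1)⁻¹ * ∑ t ∈ Finset.range (n + 1),
          ∫ p, ((∫ yt, g t (NRDF.extend p.1 yt) p.2 ∂(Q.kernel t p)) +
            NRDF.logPartition d s t (g t) (NRDF.outputKernel μ P Q t) p)
            ∂(NRDF.pastLaw μ P Q t) ∧
      -- (3) the multiplier is negative and the constraint is tight at positive rate
      (0 < NRDF.nrdf (W := W) μ P d n D →
        s < 0 ∧
        ((n : ℝ≥0∞) + 1)⁻¹ * ∑ t ∈ Finset.range (n + 1),
          ∫⁻ a, d.rho t a.2.1 a.2.2 ∂(NRDF.jointLaw μ P Q (t + 1)) = D) := by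
  obtain ⟨hI, hRQ⟩ := hdiff.info_ne_top_and_absolutelyContinuous
  obtain ⟨s, hL⟩ := hopt.exists_isLagrangeMultiplier hdiff
  have hs := hL.1
  have hd := hopt.expectedDistortion_ne_top
  have hkl := hI
  rw [NRDF.info_eq_klDiv_jointLaw] at hkl
  have hmin := hL.klDiv_add_le hopt
  have hnt : NRDF.nrdf (W := W) μ P d n D ≠ ∞ := hopt.2 ▸ hI
  refine ⟨s, fun t => NRDF.realCost P d s (NRDF.outputKernel μ P Q) (n - t) t, hL,
    NRDF.backwardRecursion_realCost P d n s _, fun t ht => ?_, fun t ht => ?_, fun t ht =>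
    NRDF.kernel_eq_withDensity_weight hs hkl hRQ hd hmin ht, hnt, ?_, fun hpos => ?_⟩
  · exact Measure.ae_ae_of_ae_compProd (NRDF.ae_compProd_of_ae_jointLaw
      (NRDF.integrable_logPartition_snoc hs hkl hRQ hd ht))
  · obtain ⟨h1, h2, _⟩ := NRDF.integrable_realCost hs hkl hRQ hd ht
    exact ⟨h1, h2, (NRDF.integrable_logPartition hs hkl hRQ hd ht).1⟩
  · have hval := le_antisymm hmin (NRDF.lintegral_gibbsLoss_le (by finiteness))
    rw [hL.mul_expectedDistortion_eq hopt hI, ← NRDF.info_eq_klDiv_jointLaw, hopt.2] at hval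
    rw [NRDF.sum_integral_realCost_add_logPartition hs hkl hRQ hd, ← hval,
      ENNReal.toReal_add hnt (by finiteness), ENNReal.toReal_mul, ENNReal.toReal_mul,
      ENNReal.toReal_ofReal (by linarith), ENNReal.toReal_add (by finiteness) (by finiteness)]
    simp only [ENNReal.toReal_natCast, ENNReal.toReal_one, ENNReal.coe_toReal]
    field_simp
    ring
  · have hs0 : s < 0 := by
      refine lt_of_le_of_ne hs fun h => hpos.not_ge ?_
      have := hL.2 (NRDF.outputRep μ P Q)
      rwa [NRDF.info_outputRep, h, neg_zero, ENNReal.ofReal_zero, zero_mul, zero_mul, add_zero,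
        add_zero] at this
    refine ⟨hs0, ?_⟩
    rw [← NRDF.lintegral_total_eq_sum]
    have h := hL.mul_expectedDistortion_eq hopt hI
    rw [ENNReal.mul_right_inj (by simpa using hs0) ENNReal.ofReal_ne_top,
      NRDF.expectedDistortion] at h
    rw [h, ← mul_assoc, ENNReal.inv_mul_cancel (by simp) (by finiteness), one_mul]
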